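/- Let $G$ be a (finite-dimensional, real, Hausdorff) Lie group with Lie algebra $\mathfrak g$. Let $C^\infty(G)$ be the space of complex-valued smooth functions on $G$, and let $\mathbb D(G)$ be the algebra of left-invariant differential operators on $G$ with complex coefficients, acting on $C^\infty(G)$. For $X\in\mathfrak g$ let $\tilde X\in\mathbb D(G)$ be the left-invariant vector field $(\tilde Xf)(g)=\frac{d}{dt}f(g\exp tX)\big|_{t=0}$, and write $\mathrm{Ad}(g)D=R(g)\,D\,R(g)^{-1}$ for $D\in\mathbb D(G)$, $g\in G$, where $(R(g)f)(x)=f(xg)$; this is the automorphism of $\mathbb D(G)$ that extends $\mathrm{Ad}(g)$ on $\mathfrak g$. Let $H$ be a closed subgroup of $G$ with Lie algebra $\mathfrak h=\{X\in\mathfrak g:\exp tX\in H\text{ for all }t\in\mathbb R\}$, let $\mathfrak m$ be a linear subspace of $\mathfrak g$ complementary to $\mathfrak h$, and let $\chi\colon H\to\mathbb C\setminus\{0\}$ be a continuous homomorphism. Denote also by $\chi$ its differential, $\chi(X)=\frac{d}{dt}\chi(\exp tX)\big|_{t=0}$ for $X\in\mathfrak h$, extended complex-linearly to the complexification $\mathfrak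 h^{\mathbb C}$. Put $$\mathfrak h^\chi=\{\tilde X+\chi(X)\cdot 1: X\in\mathfrak h^{\mathbb C}\}\subset\mathbb D(G),$$ let $\mathbb D(G)\mathfrak h^\chi$ be the complex linear span of all products $vw$ with $v\in\mathbb D(G)$, $w\in\mathfrak h^\chi$, and put $$C^\infty_{H,\chi}(G)=\{f\in C^\infty(G): f(gh)=f(g)\chi(h^{-1})\ \text{for all } g\in G,\ h\in H\},$$ $$\mathbb D_{H,\chi,\mathrm{mod}}(G)=\{D\in\mathbb D(G):\mathrm{Ad}(h)D-D\in\mathbb D(G)\mathfrak h^\chi\ \text{for all } h\in H\}.$$ Let $S(\mathfrak m)$ be the complex symmetric algebra of $\mathfrak m$ (the polynomials with complex coefficients on $\mathfrak m^*$), and let $\lambda\colon S(\mathfrak m)\to\mathbb D(G)$ be the symmetrization map, the linear map with $\lambda(Y_1\cdots Y_k)=\frac1{k!}\sum_{\sigma}\tilde Y_{\sigma(1)}\cdots\tilde Y_{\sigma(k)}$ for $Y_1,\dots,Y_k\in\mathfrak m$, the sum being over all permutations $\sigma$ of $\{1,\dots,k\}$. Then: (a) $\mathbb D_{H,\chi,\mathrm{mod}}(G)$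 is a subalgebra of $\mathbb D(G)$. (b) $\mathbb D(G)\mathfrak h^\chi$ is contained in $\mathbb D_{H,\chi,\mathrm{mod}}(G)$ and is a two-sided ideal in it. (c) There is the direct sum decomposition $\mathbb D_{H,\chi,\mathrm{mod}}(G)=\mathbb D(G)\mathfrak h^\chi\oplus\big(\lambda(S(\mathfrak m))\cap\mathbb D_{H,\chi,\mathrm{mod}}(G)\big)$. (d) The map $$A\colon\lambda(S(\mathfrak m))\cap\mathbb D_{H,\chi,\mathrm{mod}}(G)\to\mathbb D_{H,\chi,\mathrm{mod}}(G)/\mathbb D(G)\mathfrak h^\chi,\qquad u\mapsto u \bmod \mathbb D(G)\mathfrak h^\chi,$$ is a linear bijection. Every $u\in\mathbb D_{H,\chi,\mathrm{mod}}(G)$ maps $C^\infty_{H,\chi}(G)$ into itself, and the map $$B\colon\mathbb D_{H,\chi,\mathrm{mod}}(G)/\mathbb D(G)\mathfrak h^\chi\to\{u|_{C^\infty_{H,\chi}(G)}:u\in\mathbb D_{H,\chi,\mathrm{mod}}(G)\},\qquad u\bmod\mathbb D(G)\mathfrak h^\chi\mapsto u|_{C^\infty_{H,\chi}(G)},$$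 is a well-defined isomorphism of algebras onto the algebra of restricted operators. -/

import Mathlib

open scoped Manifold ContDiff Topology

noncomputable section

namespace InvDiffOp

/-! ### Linear differential operators in a normed space -/

section Local

variable {E : Type*} [NormedAddCommGroup E] [NormedSpace ℝ E]

/-- Iterated directional derivative `∂_{v₁} ∂_{v₂} ⋯ ∂_{v_k} F` of a function on `E`, for a list
`[v₁, …, v_k]` of directions. -/
def dirDeriv : List E → (E → ℂ) → E → ℂ
  | [], F => F
  | v :: l, F => fun y => fderiv ℝ (dirDeriv l F) y v

/-- On the open set `V`, the operator `T` on functions is given by a finite sum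
`T F = ∑ i, a i · ∂_{L i} F` with smooth complex coefficients `a i`, for all smooth `F`. -/
def IsLocalDiffOp (V : Set E) (T : (E → ℂ) → E → ℂ) : Prop :=
  ∃ (ι : Type) (_ : Fintype ι) (a : ι → E → ℂ) (L : ι → List E),
    (∀ i, ContDiffOn ℝ ∞ (a i) V) ∧
    ∀ F : E → ℂ, ContDiffOn ℝ ∞ F V → ∀ y ∈ V, T F y = ∑ i, a i y * dirDeriv (L i) F y

theorem contDiffOn_dirDeriv {V : Set E} (hV : IsOpen V) (l : List E) {F : E → ℂ}
    (hF : ContDiffOn ℝ ∞ F V) : ContDiffOn ℝ ∞ (dirDeriv l F) V := by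
  induction l with
  | nil => exact hF
  | cons v l ih => exact (ih.fderiv_of_isOpen hV (by simp)).clm_apply contDiffOn_const

theorem dirDeriv_congr {V : Set E} (hV : IsOpen V) (l : List E) {F F' : E → ℂ}
    (h : Set.EqOn F F' V) : Set.EqOn (dirDeriv l F) (dirDeriv l F') V := by
  induction l with
  | nil => exact h
  | cons v l ih =>
    intro y hy
    simp only [dirDeriv]
    have hev : dirDeriv l F =ᶠ[𝓝 y] dirDeriv l F' :=
      Filter.eventually_of_mem (hV.mem_nhds hy) ih
    rw [hev.fderiv_eq]

theorem IsLocalDiffOp.add {V : Set E} {T T' : (E → ℂ) → E → ℂ}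
    (hT : IsLocalDiffOp V T) (hT' : IsLocalDiffOp V T') :
    IsLocalDiffOp V (fun F y => T F y + T' F y) := by
  obtain ⟨ι, _, a, L, ha, h⟩ := hT
  obtain ⟨ι', _, a', L', ha', h'⟩ := hT'
  refine ⟨ι ⊕ ι', inferInstance, Sum.elim a a', Sum.elim L L', ?_, ?_⟩
  · rintro (i | i)
    · exact ha i
    · exact ha' i
  · intro F hF y hy
    simp [h F hF y hy, h' F hF y hy]

theorem IsLocalDiffOp.smul {V : Set E} {T : (E → ℂ) → E → ℂ} (hT : IsLocalDiffOp V T)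
    {b : E → ℂ} (hb : ContDiffOn ℝ ∞ b V) : IsLocalDiffOp V (fun F y => b y * T F y) := by
  obtain ⟨ι, _, a, L, ha, h⟩ := hT
  refine ⟨ι, inferInstance, fun i y => b y * a i y, L, fun i => hb.mul (ha i), ?_⟩
  intro F hF y hy
  simp [h F hF y hy, Finset.mul_sum, mul_assoc]

theorem IsLocalDiffOp.fderiv_apply {V : Set E} (hV : IsOpen V) {T : (E → ℂ) → E → ℂ}
    (hT : IsLocalDiffOp V T) (v : E) :
    IsLocalDiffOp V (fun F y => fderiv ℝ (T F) y v) := by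
  obtain ⟨ι, _, a, L, ha, h⟩ := hT
  refine ⟨ι ⊕ ι, inferInstance, Sum.elim (fun i y => fderiv ℝ (a i) y v) a,
    Sum.elim L (fun i => v :: L i), ?_, ?_⟩
  · rintro (i | i)
    · exact ((ha i).fderiv_of_isOpen hV (by simp)).clm_apply contDiffOn_const
    · exact ha i
  · intro F hF y hy
    have hev : T F =ᶠ[𝓝 y] fun y => ∑ i, a i y * dirDeriv (L i) F y :=
      Filter.eventually_of_mem (hV.mem_nhds hy) (h F hF)
    have hd : ∀ i, DifferentiableAt ℝ (a i) y := fun i =>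
      ((ha i).contDiffAt (hV.mem_nhds hy)).differentiableAt (by simp)
    have hd' : ∀ i, DifferentiableAt ℝ (dirDeriv (L i) F) y := fun i =>
      ((contDiffOn_dirDeriv hV (L i) hF).contDiffAt (hV.mem_nhds hy)).differentiableAt (by simp)
    beta_reduce
    rw [hev.fderiv_eq, fderiv_fun_sum (fun i _ => (hd i).fun_mul (hd' i))]
    simp only [sum_apply, Fintype.sum_sum_type, Sum.elim_inl, Sum.elim_inr,
      dirDeriv]
    rw [← Finset.sum_add_distrib]
    refine Finset.sum_congr rfl fun i _ => ?_
    rw [fderiv_fun_mul (hd i) (hd' i)]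
    simp
    ring

theorem IsLocalDiffOp.dirDeriv_comp {V : Set E} (hV : IsOpen V) {T : (E → ℂ) → E → ℂ}
    (hT : IsLocalDiffOp V T) (l : List E) :
    IsLocalDiffOp V (fun F => dirDeriv l (T F)) := by
  induction l with
  | nil => exact hT
  | cons v l ih => exact ih.fderiv_apply hV v

theorem IsLocalDiffOp.zero (V : Set E) : IsLocalDiffOp V (fun _ _ => 0) :=
  ⟨Empty, inferInstance, fun i => i.elim, fun i => i.elim, fun i => i.elim, by simp⟩

theorem IsLocalDiffOp.sum {V : Set E} {ι : Type*} (s : Finset ι)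
    {T : ι → (E → ℂ) → E → ℂ} (hT : ∀ i ∈ s, IsLocalDiffOp V (T i)) :
    IsLocalDiffOp V (fun F y => ∑ i ∈ s, T i F y) := by
  classical
  induction s using Finset.induction_on with
  | empty => simpa using IsLocalDiffOp.zero V
  | insert i s hi ih =>
    simp only [Finset.sum_insert hi]
    exact (hT i (by simp)).add (ih fun j hj => hT j (by simp [hj]))

/-- The composition of two operators in local form is again of that form. -/
theorem isLocalDiffOp_comp {V : Set E} (hV : IsOpen V) {ι κ : Type} [Fintype ι] [Fintype κ]
    {a : ι → E → ℂ} {b : κ → E → ℂ} (L : ι → List E) (M : κ → List E)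
    (ha : ∀ i, ContDiffOn ℝ ∞ (a i) V) (hb : ∀ j, ContDiffOn ℝ ∞ (b j) V) :
    IsLocalDiffOp V (fun F y => ∑ i, a i y *
      dirDeriv (L i) (fun z => ∑ j, b j z * dirDeriv (M j) F z) y) := by
  have hT : IsLocalDiffOp V (fun F z => ∑ j, b j z * dirDeriv (M j) F z) :=
    ⟨κ, inferInstance, b, M, hb, fun _ _ _ _ => rfl⟩
  exact IsLocalDiffOp.sum Finset.univ fun i _ => (hT.dirDeriv_comp hV (L i)).smul (ha i)

end Local

/-! ### Smooth functions on a Lie group and left invariant differential operators -/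

section Group

variable (E : Type*) [NormedAddCommGroup E] [NormedSpace ℝ E]
  (G : Type*) [TopologicalSpace G] [ChartedSpace E G]

/-- The smooth complex-valued functions on `G`, as a subspace of all functions. -/
def smoothSubmodule : Submodule ℂ (G → ℂ) where
  carrier := {f | ContMDiff 𝓘(ℝ, E) 𝓘(ℝ, ℂ) ∞ f}
  add_mem' := fun hf hg => ContMDiff.add hf hg
  zero_mem' := contMDiff_const
  smul_mem' := fun c f hf => by
    have : ContMDiff 𝓘(ℝ, E) 𝓘(ℝ, ℂ) ∞ (fun x => c * f x) :=
      (contDiff_const.mul contDiff_id : ContDiff ℝ ∞ fun z : ℂ => c * z).comp_contMDiff hf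
    exact this

/-- The complex vector space `C^∞(G)` of smooth complex-valued functions on `G`. -/
def SmoothFun : Type _ := smoothSubmodule E G

instance : AddCommGroup (SmoothFun E G) := inferInstanceAs (AddCommGroup (smoothSubmodule E G))

instance : Module ℂ (SmoothFun E G) := inferInstanceAs (Module ℂ (smoothSubmodule E G))

variable {E G}

@[ext]
theorem SmoothFun.ext {f f' : SmoothFun E G} (h : ∀ x, f.1 x = f'.1 x) : f = f' :=
  Subtype.ext (funext h)

/-- A linear operator `D` on `C^∞(G)` is a differential operator if near each point, in a chart
`φ`, it is given by a finite sum `(D f) ∘ φ⁻¹ = ∑ i, a i · ∂_{L i} (f ∘ φ⁻¹)` with smooth complex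
coefficients `a i`. -/
def IsDiffOp (D : Module.End ℂ (SmoothFun E G)) : Prop :=
  ∀ x₀ : G, ∃ V : Set E, IsOpen V ∧ chartAt E x₀ x₀ ∈ V ∧ V ⊆ (chartAt E x₀).target ∧
    ∃ (ι : Type) (_ : Fintype ι) (a : ι → E → ℂ) (L : ι → List E),
      (∀ i, ContDiffOn ℝ ∞ (a i) V) ∧
      ∀ f : SmoothFun E G, ∀ y ∈ V,
        (D f).1 ((chartAt E x₀).symm y) =
          ∑ i, a i y * dirDeriv (L i) (f.1 ∘ (chartAt E x₀).symm) y

theorem IsDiffOp.add {D D' : Module.End ℂ (SmoothFun E G)} (hD : IsDiffOp D) (hD' : IsDiffOp D') :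
    IsDiffOp (D + D') := by
  intro x₀
  obtain ⟨V, hV, hxV, hVt, ι, _, a, L, ha, h⟩ := hD x₀
  obtain ⟨V', hV', hxV', hVt', κ, _, b, M, hb, h'⟩ := hD' x₀
  refine ⟨V ∩ V', hV.inter hV', ⟨hxV, hxV'⟩, fun y hy => hVt hy.1, ι ⊕ κ, inferInstance,
    Sum.elim a b, Sum.elim L M, ?_, ?_⟩
  · rintro (i | i)
    · exact (ha i).mono Set.inter_subset_left
    · exact (hb i).mono Set.inter_subset_right
  · intro f y hy
    simp only [Fintype.sum_sum_type, Sum.elim_inl, Sum.elim_inr]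
    rw [← h f y hy.1, ← h' f y hy.2]
    rfl

theorem isDiffOp_algebraMap (c : ℂ) :
    IsDiffOp (algebraMap ℂ (Module.End ℂ (SmoothFun E G)) c) := by
  intro x₀
  refine ⟨(chartAt E x₀).target, (chartAt E x₀).open_target, mem_chart_target E x₀, le_rfl, Unit,
    inferInstance, fun _ _ => c, fun _ => [], fun _ => contDiffOn_const, ?_⟩
  intro f y _
  simp only [dirDeriv, Module.algebraMap_end_apply, Finset.univ_unique, Finset.sum_singleton]
  rfl

variable [IsManifold 𝓘(ℝ, E) ∞ G]

theorem SmoothFun.contDiffOn_chart (f : SmoothFun E G) (x₀ : G) :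
    ContDiffOn ℝ ∞ (f.1 ∘ (chartAt E x₀).symm) (chartAt E x₀).target := by
  have h1 : ContMDiffOn 𝓘(ℝ, E) 𝓘(ℝ, E) ∞ (chartAt E x₀).symm (chartAt E x₀).target :=
    contMDiffOn_chart_symm
  have hf : ContMDiff 𝓘(ℝ, E) 𝓘(ℝ, ℂ) ∞ f.1 := f.2
  exact (hf.comp_contMDiffOn h1).contDiffOn

theorem IsDiffOp.mul {D D' : Module.End ℂ (SmoothFun E G)} (hD : IsDiffOp D) (hD' : IsDiffOp D') :
    IsDiffOp (D * D') := by
  intro x₀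
  obtain ⟨V, hV, hxV, hVt, ι, _, a, L, ha, h⟩ := hD x₀
  obtain ⟨V', hV', hxV', hVt', κ, _, b, M, hb, h'⟩ := hD' x₀
  have hW : IsOpen (V ∩ V') := hV.inter hV'
  obtain ⟨μ, _, c, N, hc, hT⟩ := isLocalDiffOp_comp hW L M
    (fun i => (ha i).mono Set.inter_subset_left) (fun j => (hb j).mono Set.inter_subset_right)
  refine ⟨V ∩ V', hW, ⟨hxV, hxV'⟩, fun y hy => hVt hy.1, μ, inferInstance, c, N, hc, ?_⟩
  intro f y hy
  rw [← hT _ ((SmoothFun.contDiffOn_chart f x₀).mono fun y hy => hVt hy.1) y hy]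
  change (D (D' f)).1 _ = _
  rw [h (D' f) y hy.1]
  refine Finset.sum_congr rfl fun i _ => ?_
  congr 1
  exact dirDeriv_congr hW (L i) (fun z hz => h' f z hz.2) hy

end Group

section LieGroup

variable (E : Type*) [NormedAddCommGroup E] [NormedSpace ℝ E]
  (G : Type*) [TopologicalSpace G] [ChartedSpace E G] [Group G] [LieGroup 𝓘(ℝ, E) ∞ G]

variable {G} in
/-- Left translation `(L(g) f)(x) = f(g x)` on `C^∞(G)`. -/
def leftTranslation (g : G) : Module.End ℂ (SmoothFun E G) where
  toFun f := ⟨fun x => f.1 (g * x),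
    ContMDiff.comp (g := f.1) (f := fun x : G => g * x) f.2 contMDiff_mul_left⟩
  map_add' _ _ := rfl
  map_smul' _ _ := rfl

variable {G} in
/-- Right translation `(R(g) f)(x) = f(x g)` on `C^∞(G)`. -/
def rightTranslation (g : G) : Module.End ℂ (SmoothFun E G) where
  toFun f := ⟨fun x => f.1 (x * g),
    ContMDiff.comp (g := f.1) (f := fun x : G => x * g) f.2 contMDiff_mul_right⟩
  map_add' _ _ := rfl
  map_smul' _ _ := rfl

/-- The algebra `𝔻(G)` of left invariant differential operators on `G` with complex coefficients,
as a subalgebra of the algebra of all linear operators on `C^∞(G)`. -/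
def LeftInvDiffOp : Subalgebra ℂ (Module.End ℂ (SmoothFun E G)) where
  carrier := {D | IsDiffOp D ∧ ∀ g : G, D * leftTranslation E g = leftTranslation E g * D}
  mul_mem' := fun {D D'} hD hD' => ⟨hD.1.mul hD'.1, fun g => by
    rw [mul_assoc, hD'.2, ← mul_assoc, hD.2, mul_assoc]⟩
  add_mem' := fun {D D'} hD hD' => ⟨hD.1.add hD'.1, fun g => by
    rw [add_mul, mul_add, hD.2, hD'.2]⟩
  algebraMap_mem' := fun c => ⟨isDiffOp_algebraMap c, fun g => Algebra.commutes c _⟩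

variable {E G}

theorem mdiff_translate (f : SmoothFun E G) (g : G) :
    MDifferentiableAt 𝓘(ℝ, E) 𝓘(ℝ, ℂ) (fun x => f.1 (g * x)) 1 :=
  (show ContMDiff 𝓘(ℝ, E) 𝓘(ℝ, ℂ) ∞ (fun x => f.1 (g * x)) from
    (leftTranslation E g f).2).mdifferentiable (by simp) 1

/-- The operator `X̃` on `C^∞(G)` given by the left invariant vector field with value `X` at the
identity: `(X̃ f)(g)` is the derivative at the identity, in the direction `X`, of `x ↦ f(g x)`. -/
def leftInvField (X : GroupLieAlgebra 𝓘(ℝ, E) G) : Module.End ℂ (SmoothFun E G) where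
  toFun f := ⟨fun g => mfderiv 𝓘(ℝ, E) 𝓘(ℝ, ℂ) (fun x => f.1 (g * x)) 1 X, by
    intro g₀
    have hf : ContMDiff 𝓘(ℝ, E) 𝓘(ℝ, ℂ) ∞ f.1 := f.2
    have h := ContMDiffAt.mfderiv_apply (I := 𝓘(ℝ, E)) (I' := 𝓘(ℝ, ℂ)) (J := 𝓘(ℝ, E))
      (J' := 𝓘(ℝ, E)) (n := ∞) (m := ∞) (x₀ := g₀)
      (fun (g : G) (x : G) => f.1 (g * x)) (fun _ => (1 : G)) id (fun _ => (X : E))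
      ((hf.comp (contMDiff_mul 𝓘(ℝ, E) ∞)).contMDiffAt) contMDiffAt_const contMDiffAt_id
      contMDiffAt_const (by simp)
    refine h.congr_of_eventuallyEq (Filter.Eventually.of_forall fun g => ?_)
    have key := inTangentCoordinates_eq (I := 𝓘(ℝ, E)) (I' := 𝓘(ℝ, ℂ)) (fun _ : G => (1 : G))
      (fun x => f.1 (x * 1)) (fun x => mfderiv 𝓘(ℝ, E) 𝓘(ℝ, ℂ) (fun y => f.1 (x * y)) 1)
      (x₀ := g₀) (x := g) (by simp) (by rw [chartAt_self_eq]; exact Set.mem_univ _)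
    rw [tangentBundleCore_coordChange_model_space] at key
    have hc : (tangentBundleCore 𝓘(ℝ, E) G).coordChange (achart E (1 : G)) (achart E (1 : G)) 1 X
        = X := (tangentBundleCore 𝓘(ℝ, E) G).coordChange_self _ 1 (mem_chart_source E 1) X
    refine Eq.trans ?_ (congrArg (fun T => T X) key).symm
    exact congrArg (mfderiv 𝓘(ℝ, E) 𝓘(ℝ, ℂ) (fun x => f.1 (g * x)) 1) hc.symm⟩
  map_add' f f' := by
    ext g
    have hf := mdiff_translate f g
    have hf' := mdiff_translate f' g
    exact congrArg (fun T => T X) (mfderiv_add hf hf')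
  map_smul' c f := by
    ext g
    have h1 := ((c • ContinuousLinearMap.id ℝ ℂ).hasMFDerivAt).comp (1 : G)
      (mdiff_translate f g).hasMFDerivAt
    exact congrArg (fun T => T X) h1.mfderiv

/-- The adjoint action `Ad(g) D = R(g) ∘ D ∘ R(g)⁻¹` of `g ∈ G` on operators on `C^∞(G)`. On left
invariant vector fields this is the differential of `x ↦ g x g⁻¹`, see `Ad_leftInvField`. -/
def Ad (g : G) (D : Module.End ℂ (SmoothFun E G)) : Module.End ℂ (SmoothFun E G) :=
  rightTranslation E g * D * rightTranslation E g⁻¹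

theorem Ad_leftInvField (g : G) (X : GroupLieAlgebra 𝓘(ℝ, E) G) :
    Ad g (leftInvField X) = leftInvField
      (mfderiv 𝓘(ℝ, E) 𝓘(ℝ, E) (fun x : G => g * x * g⁻¹) 1 X : E) := by
  ext f x
  have hc : MDifferentiableAt 𝓘(ℝ, E) 𝓘(ℝ, E) (fun y : G => g * y * g⁻¹) 1 :=
    ((contMDiff_mul_right (I := 𝓘(ℝ, E)) (n := ∞) (a := g⁻¹)).comp
      (contMDiff_mul_left (I := 𝓘(ℝ, E)) (n := ∞) (a := g))).mdifferentiable (by simp) 1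
  have hf : MDifferentiableAt 𝓘(ℝ, E) 𝓘(ℝ, ℂ) (fun y => f.1 (x * y)) (g * 1 * g⁻¹) := by
    have h := mdiff_translate f x
    rwa [show (1 : G) = g * 1 * g⁻¹ by simp] at h
  have h := (hf.hasMFDerivAt.comp (1 : G) hc.hasMFDerivAt).mfderiv
  have e1 : (fun y => f.1 (x * y)) ∘ (fun y : G => g * y * g⁻¹)
      = fun y => f.1 (x * g * y * g⁻¹) := by
    ext y
    simp [mul_assoc]
  rw [e1] at h
  have h1 : g * 1 * g⁻¹ = 1 := by simp
  rw [h1] at h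
  exact congrArg (fun T => T X) h

theorem Ad_mul (g : G) (D D' : Module.End ℂ (SmoothFun E G)) :
    Ad g (D * D') = Ad g D * Ad g D' := by
  have h : rightTranslation E g⁻¹ * rightTranslation E g = 1 := by
    ext f x
    change f.1 (x * g⁻¹ * g) = f.1 x
    simp
  simp only [Ad, mul_assoc]
  rw [← mul_assoc (rightTranslation E g⁻¹) (rightTranslation E g), h, one_mul]

theorem exists_integralCurve [FiniteDimensional ℝ E] [T2Space G] (X : GroupLieAlgebra 𝓘(ℝ, E) G) :
    ∃ γ : ℝ → G, γ 0 = 1 ∧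
      IsMIntegralCurve (I := 𝓘(ℝ, E)) γ (mulInvariantVectorField (I := 𝓘(ℝ, E)) X) := by
  have : CompleteSpace E := FiniteDimensional.complete ℝ E
  have : LieGroup 𝓘(ℝ, E) (minSmoothness ℝ 3) G := LieGroup.of_le (n := ∞) (by simpa using (WithTop.coe_le_coe.2 le_top : ((3 : ℕ∞) : ℕ∞ω) ≤ ∞))
  have : IsManifold 𝓘(ℝ, E) 1 G := IsManifold.of_le (n := ∞) (by simp)
  have hv := contMDiff_mulInvariantVectorField (I := 𝓘(ℝ, E)) X
  have hv1 := hv.of_le (m := 1) (by simp)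
  obtain ⟨γ, h0, hγ⟩ := exists_isMIntegralCurveAt_of_contMDiffAt_boundaryless (t₀ := 0)
    (hv1.contMDiffAt (x := (1 : G)))
  obtain ⟨ε, hε, hγ⟩ := isMIntegralCurveAt_iff'.1 hγ
  refine exists_isMIntegralCurve_of_isMIntegralCurveOn hv1 hε (fun x => ?_) 1
  refine ⟨fun t => x * γ t, by simp [h0], ?_⟩
  intro t ht
  have hx : ∀ a y : G, MDifferentiableAt 𝓘(ℝ, E) 𝓘(ℝ, E) (fun z : G => a * z) y := fun a y =>
    (contMDiff_mul_left (I := 𝓘(ℝ, E)) (n := ∞) (a := a)).mdifferentiable (by simp) y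
  have ht' : t ∈ Metric.ball (0 : ℝ) ε := by
    simpa [Real.ball_eq_Ioo] using ht
  have h1 := (hx x (γ t)).hasMFDerivAt.comp_hasMFDerivWithinAt t
    ((hγ t ht').mono (s := Set.Ioo (-ε) ε) (by rw [Real.ball_eq_Ioo]; simp))
  have h2 := ((hx x (γ t * 1)).hasMFDerivAt.comp (1 : G) (hx (γ t) 1).hasMFDerivAt).mfderiv
  have e : (fun z : G => x * z) ∘ (fun z : G => γ t * z) = fun z => x * γ t * z := by
    ext z
    simp [mul_assoc]
  rw [e, mul_one] at h2
  have h3 : (1 : ℝ →L[ℝ] ℝ).smulRight (mulInvariantVectorField (I := 𝓘(ℝ, E)) X (x * γ t) : E) =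
      (mfderiv 𝓘(ℝ, E) 𝓘(ℝ, E) (fun z => x * z) (γ t) : E →L[ℝ] E) ∘L
        (1 : ℝ →L[ℝ] ℝ).smulRight (mulInvariantVectorField (I := 𝓘(ℝ, E)) X (γ t) : E) := by
    refine ContinuousLinearMap.ext fun s => ?_
    exact (congrArg (fun T => s • (T X : E)) h2).trans (map_smul
      (mfderiv 𝓘(ℝ, E) 𝓘(ℝ, E) (fun z => x * z) (γ t) : E →L[ℝ] E) s
      (mulInvariantVectorField (I := 𝓘(ℝ, E)) X (γ t) : E)).symm
  exact h3 ▸ h1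

/-- The one-parameter group `t ↦ exp(tX)`: the integral curve through the identity of the left
invariant vector field determined by `X`. -/
def expCurve [FiniteDimensional ℝ E] [T2Space G] (X : GroupLieAlgebra 𝓘(ℝ, E) G) : ℝ → G :=
  Classical.choose (exists_integralCurve X)

/-- The Lie algebra of a closed subgroup `H`: all `X` with `exp(tX) ∈ H` for every real `t`. (By the
closed subgroup theorem this set is a real linear subspace of the Lie algebra of `G`.) -/
def lieAlg [FiniteDimensional ℝ E] [T2Space G] (H : Subgroup G) :
    Set (GroupLieAlgebra 𝓘(ℝ, E) G) :=
  {X | ∀ t : ℝ, expCurve X t ∈ H}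

/-- The differential of a character `χ` of `H`: the derivative at `t = 0` of `χ(exp(tX))`. -/
def charDeriv [FiniteDimensional ℝ E] [T2Space G] {H : Subgroup G} (χ : H →ₜ* ℂˣ)
    (X : lieAlg (E := E) H) : ℂ :=
  deriv (fun t : ℝ => ((χ ⟨expCurve X.1 t, X.2 t⟩ : ℂˣ) : ℂ)) 0

/-- The set of operators `Z̃ + χ(Z)` where `Z = X + iY` runs over the complexification of the Lie
algebra of `H`, and `χ(Z) = χ(X) + i χ(Y)`. -/
def twistedLieAlg [FiniteDimensional ℝ E] [T2Space G] {H : Subgroup G} (χ : H →ₜ* ℂˣ) :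
    Set (Module.End ℂ (SmoothFun E G)) :=
  {D | ∃ X Y : lieAlg (E := E) H,
    D = (leftInvField X.1 + Complex.I • leftInvField Y.1)
      + algebraMap ℂ (Module.End ℂ (SmoothFun E G)) (charDeriv χ X + Complex.I * charDeriv χ Y)}

/-- `𝔻(G)𝔥^χ`: the complex linear span of all `v w` with `v ∈ 𝔻(G)` and `w ∈ 𝔥^χ`. -/
def twistedIdeal [FiniteDimensional ℝ E] [T2Space G] {H : Subgroup G} (χ : H →ₜ* ℂˣ) :
    Submodule ℂ (Module.End ℂ (SmoothFun E G)) :=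
  Submodule.span ℂ {D | ∃ v ∈ LeftInvDiffOp E G, ∃ w ∈ twistedLieAlg χ, D = v * w}

/-- `𝔻_{H,χ,mod}(G)`: all `D ∈ 𝔻(G)` with `Ad(h) D - D ∈ 𝔻(G)𝔥^χ` for all `h ∈ H`. -/
def modInvDiffOp [FiniteDimensional ℝ E] [T2Space G] {H : Subgroup G} (χ : H →ₜ* ℂˣ) :
    Set (Module.End ℂ (SmoothFun E G)) :=
  {D | D ∈ LeftInvDiffOp E G ∧ ∀ h ∈ H, Ad h D - D ∈ twistedIdeal χ}

variable (E) in
/-- `C^∞_{H,χ}(G)`: all `f ∈ C^∞(G)` with `f(g h) = f(g) χ(h⁻¹)` for `g ∈ G`, `h ∈ H`. -/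
def equivariantFun {H : Subgroup G} (χ : H →ₜ* ℂˣ) : Submodule ℂ (SmoothFun E G) where
  carrier := {f | ∀ (g : G) (h : H), f.1 (g * h) = f.1 g * ((χ h⁻¹ : ℂˣ) : ℂ)}
  add_mem' := fun {f f'} hf hf' g h => by
    have e : (f + f').1 = f.1 + f'.1 := rfl
    simp only [e, Pi.add_apply, hf g h, hf' g h, add_mul]
  zero_mem' := fun g h => (zero_mul _).symm
  smul_mem' := fun c f hf g h => by
    have e : (c • f).1 = c • f.1 := rfl
    simp only [e, Pi.smul_apply, hf g h, smul_eq_mul, mul_assoc]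

/-- The symmetrized product `(1/k!) ∑_σ Ỹ_{σ(1)} ⋯ Ỹ_{σ(k)}` over all permutations `σ`. -/
def symProd {k : ℕ} (Y : Fin k → GroupLieAlgebra 𝓘(ℝ, E) G) : Module.End ℂ (SmoothFun E G) :=
  (k.factorial : ℂ)⁻¹ •
    ∑ σ : Equiv.Perm (Fin k), (List.ofFn fun j => leftInvField (Y (σ j))).prod

/-- The symmetrization map `λ`, as the complex linear map sending a monomial `X_{i₁} ⋯ X_{i_k}` to
the symmetrized product of `X̃_{i₁}, …, X̃_{i_k}`. When the `X i` form a basis of a real subspace `V`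
of the Lie algebra, `MvPolynomial ι ℂ` is the complex symmetric algebra `S(V)`, i.e. the algebra of
complex polynomials on the dual of `V`, and this is `λ` on `S(V)`. -/
def symmetrization {ι : Type*} (X : ι → GroupLieAlgebra 𝓘(ℝ, E) G) :
    MvPolynomial ι ℂ →ₗ[ℂ] Module.End ℂ (SmoothFun E G) :=
  (MvPolynomial.basisMonomials ι ℂ).constr ℂ fun s =>
    symProd fun j => X ((Finsupp.toMultiset s).toList.get j)

/-- The subspace `λ(S(𝔪))`, for a real subspace `𝔪` of the Lie algebra with basis `b`. -/
def symmetrizedSubspace {m : Submodule ℝ (GroupLieAlgebra 𝓘(ℝ, E) G)} {ι : Type*}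
    (b : Module.Basis ι ℝ m) : Submodule ℂ (Module.End ℂ (SmoothFun E G)) :=
  LinearMap.range (symmetrization fun i => (b i : GroupLieAlgebra 𝓘(ℝ, E) G))

end LieGroup
end InvDiffOp

end

/-!
Everything follows from two descriptions by means of the equivariant functions `C^∞_{H,χ}(G)`:

* `𝔻(G)𝔥^χ` is the annihilator of `C^∞_{H,χ}(G)` in `𝔻(G)` (`mem_twistedIdeal_iff`);
* `𝔻_{H,χ,mod}(G)` is the stabilizer of `C^∞_{H,χ}(G)` in `𝔻(G)` (`mem_modInvDiffOp_iff`).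

Granted these, restriction to `C^∞_{H,χ}(G)` is an algebra homomorphism on the stabilizer whose kernel
is `𝔻(G)𝔥^χ`, so the latter is a two-sided ideal and the quotient is the algebra of restricted
operators; the direct sum decomposition of the stabilizer is obtained by intersecting that of `𝔻(G)`.
The second description follows from the first, since on an equivariant function `Ad(h) D` acts as
`χ(h) R(h) D`.

That `𝔻(G)𝔥^χ` annihilates equivariant functions is differentiation of `f(g exp tX) = f(g) χ(exp(-tX))`
at `t = 0`. The converse rests on two facts, with `𝔪` a complement of the Lie algebra of `H`.

*Spanning*, `𝔻(G) = 𝔻(G)𝔥^χ + λ(S(𝔪))` (`leftInvDiffOp_le_sup`). A left invariant differential operator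
is determined by its value at the identity, where the left invariant fields form a frame; hence
`𝔻(G)` is spanned by products of left invariant fields (`leftInvDiffOp_le_span`). The factors of such
a product commute up to operators of lower order, because a commutator of left invariant fields is a
left invariant field. So, by induction on the order, factors from the Lie algebra of `H` can be moved
to the right and replaced by scalars modulo `𝔻(G)𝔥^χ`, and products of factors from `𝔪` can be
symmetrized (`fieldFiltration_le_sup`).

*Injectivity*, `λ(P) = 0` on `C^∞_{H,χ}(G)` only for `P = 0`
(`eq_zero_of_symmetrization_apply_eq_zero`). If `u` vanishes at the identity and `k` is the degree of
`P`, the Leibniz rule gives `(λ(P)(u ^ k f))(1) = k! Pₖ(du) f(1)` with `Pₖ` the leading term. When `u`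
is right `H`-invariant and `f` is equivariant, so is `u ^ k f`; it remains to find such `u` with
arbitrary derivatives in the directions of `𝔪`, and `f` with `f(1) = 1`. They are defined by
`ψ(x) χ(h⁻¹)` at `σ(x) h`, where `σ` is a slice through the identity in the directions of `𝔪`
(`exists_equivariantFun_extension`). This is well defined and smooth because small points of the slice
lie in different cosets of `H`: otherwise there would be points of `H` converging to the identity in a
direction of `𝔪`, and as `H` is closed that direction would belong to the Lie algebra of `H`
(`mem_lieVec_of_tendsto`).
-/

noncomputable section

namespace InvDiffOp

/-! ### Left invariant vector fields in charts -/

section Chart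

variable {E : Type*} [NormedAddCommGroup E] [NormedSpace ℝ E]
  {G : Type*} [TopologicalSpace G] [ChartedSpace E G]

theorem mfderiv_eq_fderiv_chart {F : Type*} [NormedAddCommGroup F] [NormedSpace ℝ F]
    {u : G → F} {x : G} (hu : MDifferentiableAt 𝓘(ℝ, E) 𝓘(ℝ, F) u x) :
    (mfderiv 𝓘(ℝ, E) 𝓘(ℝ, F) u x : E →L[ℝ] F) =
      fderiv ℝ (u ∘ (chartAt E x).symm) (chartAt E x x) := by
  refine (if_pos hu).trans ?_
  change fderivWithin ℝ (u ∘ (chartAt E x).symm) (Set.range id) (chartAt E x x) = _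
  rw [Set.range_id, fderivWithin_univ]

variable [Group G] [LieGroup 𝓘(ℝ, E) ∞ G]

/-- Multiplication of `G` read in the chart at `x₀` (first factor and product) and in the chart at
the identity (second factor). -/
def chartMul (x₀ : G) (y b : E) : E :=
  chartAt E x₀ ((chartAt E x₀).symm y * (chartAt E (1 : G)).symm b)

theorem contDiffAt_chartMul {x₀ : G} {y : E} (hy : y ∈ (chartAt E x₀).target) :
    ContDiffAt ℝ ∞ (fun q : E × E => chartMul x₀ q.1 q.2) (y, chartAt E (1 : G) 1) := by
  have h1 : ContMDiffAt 𝓘(ℝ, E) 𝓘(ℝ, E) ∞ (chartAt E x₀).symm y :=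
    (contMDiffOn_chart_symm (I := 𝓘(ℝ, E)) (n := ∞) (x := x₀)).contMDiffAt
      ((chartAt E x₀).open_target.mem_nhds hy)
  have h2 : ContMDiffAt 𝓘(ℝ, E) 𝓘(ℝ, E) ∞ (chartAt E (1 : G)).symm (chartAt E (1 : G) 1) :=
    (contMDiffOn_chart_symm (I := 𝓘(ℝ, E)) (n := ∞) (x := (1 : G))).contMDiffAt
      ((chartAt E (1 : G)).open_target.mem_nhds (mem_chart_target E 1))
  have h3 : ContMDiffAt 𝓘(ℝ, E) 𝓘(ℝ, E) ∞ (chartAt E x₀)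
      ((chartAt E x₀).symm y * (chartAt E (1 : G)).symm (chartAt E (1 : G) 1)) := by
    refine (contMDiffOn_chart (I := 𝓘(ℝ, E)) (n := ∞) (x := x₀)).contMDiffAt
      ((chartAt E x₀).open_source.mem_nhds ?_)
    rw [(chartAt E (1 : G)).left_inv (mem_chart_source E 1), mul_one]
    exact (chartAt E x₀).map_target hy
  have h4 : ContMDiffAt 𝓘(ℝ, E × E) 𝓘(ℝ, E) ∞
      (fun q : E × E => (chartAt E x₀).symm q.1 * (chartAt E (1 : G)).symm q.2)
      (y, chartAt E (1 : G) 1) :=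
    (ContMDiffAt.comp (y, chartAt E (1 : G) 1) h1 contDiff_fst.contMDiff.contMDiffAt).mul
      (ContMDiffAt.comp (y, chartAt E (1 : G) 1) h2 contDiff_snd.contMDiff.contMDiffAt)
  exact (ContMDiffAt.comp (y, chartAt E (1 : G) 1) h3 h4).contDiffAt

/-- The left invariant vector fields in the chart at `x₀`: `chartField x₀ y X` is the value at `y` of
the field determined by `X`. -/
def chartField (x₀ : G) (y : E) : E →L[ℝ] E :=
  fderiv ℝ (chartMul x₀ y) (chartAt E (1 : G) 1)

theorem contDiffOn_chartField (x₀ : G) :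
    ContDiffOn ℝ ∞ (chartField (E := E) x₀) (chartAt E x₀).target := by
  intro y hy
  refine ContDiffAt.contDiffWithinAt ?_
  exact ContDiffAt.fderiv (f := chartMul x₀) (g := fun _ => chartAt E (1 : G) 1) (n := ∞)
    (contDiffAt_chartMul hy) contDiffAt_const (by simp)

theorem chartField_one : chartField (1 : G) (chartAt E (1 : G) 1) = ContinuousLinearMap.id ℝ E := by
  have h : chartMul (1 : G) (chartAt E (1 : G) 1) =ᶠ[𝓝 (chartAt E (1 : G) 1)] id := by
    filter_upwards [(chartAt E (1 : G)).open_target.mem_nhds (mem_chart_target E 1)] with b hb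
    rw [chartMul, (chartAt E (1 : G)).left_inv (mem_chart_source E 1), one_mul,
      (chartAt E (1 : G)).right_inv hb, id]
  rw [chartField, h.fderiv_eq, fderiv_id]

theorem differentiableAt_chartMul {x₀ : G} {y : E} (hy : y ∈ (chartAt E x₀).target) :
    DifferentiableAt ℝ (chartMul x₀ y) (chartAt E (1 : G) 1) :=
  ((contDiffAt_chartMul hy).comp (f := fun b : E => (y, b)) (chartAt E (1 : G) 1)
    (contDiffAt_const.prodMk contDiffAt_id)).differentiableAt (by simp)

theorem chartMul_base {x₀ : G} {y : E} (hy : y ∈ (chartAt E x₀).target) :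
    chartMul x₀ y (chartAt E (1 : G) 1) = y := by
  rw [chartMul, (chartAt E (1 : G)).left_inv (mem_chart_source E 1), mul_one,
    (chartAt E x₀).right_inv hy]

/-- For a map `u` defined near `φ⁻¹ y`, the derivative of `x ↦ u (φ⁻¹(y) x)` at the identity is the
derivative of `u ∘ φ⁻¹` composed with `chartField`. -/
theorem mfderiv_mul_left_chart {F : Type*} [NormedAddCommGroup F] [NormedSpace ℝ F]
    {u : G → F} {x₀ : G} {y : E} (hy : y ∈ (chartAt E x₀).target)
    (hu : MDifferentiableAt 𝓘(ℝ, E) 𝓘(ℝ, F) u ((chartAt E x₀).symm y)) :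
    (mfderiv 𝓘(ℝ, E) 𝓘(ℝ, F) (fun x => u ((chartAt E x₀).symm y * x)) 1 : E →L[ℝ] F) =
      fderiv ℝ (u ∘ (chartAt E x₀).symm) y ∘L chartField x₀ y := by
  set g := (chartAt E x₀).symm y with hg
  have hmul : MDifferentiableAt 𝓘(ℝ, E) 𝓘(ℝ, E) (fun x : G => g * x) 1 :=
    (contMDiff_mul_left (I := 𝓘(ℝ, E)) (n := ∞) (a := g)).mdifferentiable (by simp) 1
  have hu' : MDifferentiableAt 𝓘(ℝ, E) 𝓘(ℝ, F) u (g * 1) := by rwa [mul_one]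
  have hc : MDifferentiableAt 𝓘(ℝ, E) 𝓘(ℝ, F) (fun x => u (g * x)) 1 :=
    MDifferentiableAt.comp (1 : G) hu' hmul
  rw [mfderiv_eq_fderiv_chart hc]
  have hs : MDifferentiableAt 𝓘(ℝ, E) 𝓘(ℝ, E) (chartAt E x₀).symm y :=
    ((contMDiffOn_chart_symm (I := 𝓘(ℝ, E)) (n := ∞) (x := x₀)).contMDiffAt
      ((chartAt E x₀).open_target.mem_nhds hy)).mdifferentiableAt (by simp)
  have hd : DifferentiableAt ℝ (u ∘ (chartAt E x₀).symm) y :=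
    (MDifferentiableAt.comp y hu hs).differentiableAt
  have hev : (fun x => u (g * x)) ∘ (chartAt E (1 : G)).symm =ᶠ[𝓝 (chartAt E (1 : G) 1)]
      (u ∘ (chartAt E x₀).symm) ∘ chartMul x₀ y := by
    have hcont : ContinuousAt (fun b => g * (chartAt E (1 : G)).symm b) (chartAt E (1 : G) 1) := by
      have h1 : ContinuousAt (chartAt E (1 : G)).symm (chartAt E (1 : G) 1) :=
        (chartAt E (1 : G)).continuousAt_symm (mem_chart_target E 1)
      have h2 : Continuous (fun x : G => g * x) :=
        (contMDiff_mul_left (I := 𝓘(ℝ, E)) (n := ∞) (a := g)).continuous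
      exact h2.continuousAt.comp h1
    have hmem : (chartAt E x₀).source ∈ 𝓝 (g * (chartAt E (1 : G)).symm (chartAt E (1 : G) 1)) := by
      refine (chartAt E x₀).open_source.mem_nhds ?_
      rw [(chartAt E (1 : G)).left_inv (mem_chart_source E 1), mul_one]
      exact (chartAt E x₀).map_target hy
    filter_upwards [hcont hmem] with b hb
    simp only [Function.comp, chartMul]
    rw [(chartAt E x₀).left_inv hb]
  rw [hev.fderiv_eq, fderiv_comp _ (by rwa [chartMul_base hy]) (differentiableAt_chartMul hy),
    chartMul_base hy]
  rfl

end Chart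

section Fields

variable {E : Type*} [NormedAddCommGroup E] [NormedSpace ℝ E]
  {G : Type*} [TopologicalSpace G] [ChartedSpace E G]

/-- A smooth function, coerced to its underlying function on `G`. -/
instance : FunLike (SmoothFun E G) G ℂ where
  coe f := f.1
  coe_injective _ _ h := Subtype.ext h

theorem SmoothFun.contMDiff (f : SmoothFun E G) : ContMDiff 𝓘(ℝ, E) 𝓘(ℝ, ℂ) ∞ f := f.2

theorem SmoothFun.mdifferentiableAt (f : SmoothFun E G) (x : G) :
    MDifferentiableAt 𝓘(ℝ, E) 𝓘(ℝ, ℂ) f x :=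
  f.contMDiff.mdifferentiable (by simp) x

theorem SmoothFun.add_apply (f f' : SmoothFun E G) (x : G) : (f + f') x = f x + f' x := rfl

theorem SmoothFun.sub_apply (f f' : SmoothFun E G) (x : G) : (f - f') x = f x - f' x := rfl

theorem SmoothFun.smul_apply (c : ℂ) (f : SmoothFun E G) (x : G) : (c • f) x = c * f x := rfl

theorem SmoothFun.zero_apply (x : G) : (0 : SmoothFun E G) x = 0 := rfl

theorem SmoothFun.contDiffOn [IsManifold 𝓘(ℝ, E) ∞ G] (f : SmoothFun E G) (x₀ : G) :
    ContDiffOn ℝ ∞ (f ∘ (chartAt E x₀).symm) (chartAt E x₀).target := f.contDiffOn_chart x₀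

variable [Group G] [LieGroup 𝓘(ℝ, E) ∞ G]

theorem leftTranslation_apply (g : G) (f : SmoothFun E G) (x : G) :
    leftTranslation E g f x = f (g * x) := rfl

variable (G) in
/-- The operator `leftInvField` with its argument regarded as a vector of the model space `E`, the
tangent space at the identity being `E` by definition. -/
def invField (X : E) : Module.End ℂ (SmoothFun E G) :=
  leftInvField (G := G) (X : GroupLieAlgebra 𝓘(ℝ, E) G)

theorem invField_apply_mfderiv (X : E) (f : SmoothFun E G) (g : G) :
    invField G X f g = (mfderiv 𝓘(ℝ, E) 𝓘(ℝ, ℂ) (fun x => f (g * x)) 1 : E →L[ℝ] ℂ) X := rfl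

theorem invField_apply (X : E) (f : SmoothFun E G) (g : G) :
    invField G X f g =
      fderiv ℝ (fun b => f (g * (chartAt E (1 : G)).symm b)) (chartAt E (1 : G) 1) X := by
  have h := mfderiv_eq_fderiv_chart (F := ℂ) (u := fun x => f (g * x)) (mdiff_translate f g)
  rw [invField_apply_mfderiv, h]
  rfl

theorem invField_chart (X : E) (f : SmoothFun E G) {x₀ : G} {y : E}
    (hy : y ∈ (chartAt E x₀).target) :
    invField G X f ((chartAt E x₀).symm y) =
      fderiv ℝ (f ∘ (chartAt E x₀).symm) y (chartField x₀ y X) := by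
  rw [invField_apply_mfderiv, mfderiv_mul_left_chart hy (f.mdifferentiableAt _)]
  rfl

theorem invField_apply_one (X : E) (f : SmoothFun E G) :
    invField G X f 1 = fderiv ℝ (f ∘ (chartAt E (1 : G)).symm) (chartAt E (1 : G) 1) X := by
  have h := invField_chart X f (mem_chart_target E (1 : G))
  rw [(chartAt E (1 : G)).left_inv (mem_chart_source E 1)] at h
  rw [h, chartField_one]
  rfl

theorem invField_comm_leftTranslation (X : E) (g : G) :
    invField G X * leftTranslation E g = leftTranslation E g * invField G X := by
  refine LinearMap.ext fun f => DFunLike.ext _ _ fun x => ?_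
  simp only [Module.End.mul_apply, leftTranslation_apply, invField_apply, mul_assoc]

theorem invField_add (X Y : E) : invField G (X + Y) = invField G X + invField G Y := by
  refine LinearMap.ext fun f => DFunLike.ext _ _ fun x => ?_
  simp only [LinearMap.add_apply, SmoothFun.add_apply, invField_apply, map_add]

theorem invField_smul (c : ℝ) (X : E) : invField G (c • X) = (c : ℂ) • invField G X := by
  refine LinearMap.ext fun f => DFunLike.ext _ _ fun x => ?_
  simp only [LinearMap.smul_apply, SmoothFun.smul_apply, invField_apply, map_smul,
    Complex.real_smul]

theorem invField_zero : invField G (0 : E) = 0 := by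
  simpa using invField_smul (G := G) 0 (0 : E)

/-- An operator commuting with left translations is determined by the functional
`f ↦ (D f)(1)`. -/
theorem eq_of_apply_one_eq {D D' : Module.End ℂ (SmoothFun E G)}
    (hD : ∀ g : G, D * leftTranslation E g = leftTranslation E g * D)
    (hD' : ∀ g : G, D' * leftTranslation E g = leftTranslation E g * D')
    (h : ∀ f, D f 1 = D' f 1) : D = D' := by
  refine LinearMap.ext fun f => DFunLike.ext _ _ fun g => ?_
  have h1 : (leftTranslation E g * D) f 1 = (leftTranslation E g * D') f 1 := by
    rw [← hD, ← hD']
    exact h _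
  rwa [Module.End.mul_apply, Module.End.mul_apply, leftTranslation_apply, leftTranslation_apply,
    mul_one] at h1

/-- The commutator of two left invariant vector fields is again one: in a chart, the second
derivatives cancel by symmetry. -/
theorem exists_invField_commutator (X Y : E) :
    ∃ Z : E, invField G X * invField G Y - invField G Y * invField G X = invField G Z := by
  set p := chartAt E (1 : G) 1 with hp
  have hpt : (chartAt E (1 : G)).target ∈ 𝓝 p :=
    (chartAt E (1 : G)).open_target.mem_nhds (mem_chart_target E 1)
  have hV : DifferentiableAt ℝ (chartField (E := E) (1 : G)) p :=
    ((contDiffOn_chartField (1 : G)).contDiffAt hpt).differentiableAt (by simp)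
  set A := fderiv ℝ (chartField (E := E) (1 : G)) p with hA
  have key : ∀ (X Y : E) (f : SmoothFun E G), invField G X (invField G Y f) 1 =
      fderiv ℝ (fderiv ℝ (f ∘ (chartAt E (1 : G)).symm)) p X Y +
        fderiv ℝ (f ∘ (chartAt E (1 : G)).symm) p (A X Y) := by
    intro X Y f
    rw [invField_apply_one]
    set F := f ∘ (chartAt E (1 : G)).symm with hF
    have hev : invField G Y f ∘ (chartAt E (1 : G)).symm =ᶠ[𝓝 p]
        fun y => fderiv ℝ F y (chartField (1 : G) y Y) := by
      filter_upwards [hpt] with y hy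
      exact invField_chart Y f hy
    have hF1 : DifferentiableAt ℝ (fderiv ℝ F) p :=
      (((f.contDiffOn (1 : G)).contDiffAt hpt).fderiv_right (m := ∞)
        (by simp)).differentiableAt (by simp)
    have hV' : DifferentiableAt ℝ (fun y => chartField (1 : G) y Y) p :=
      hV.clm_apply (differentiableAt_const Y)
    rw [hev.fderiv_eq, fderiv_clm_apply hF1 hV', fderiv_clm_apply hV (differentiableAt_const Y),
      chartField_one]
    simp [hA, add_comm]
  refine ⟨A X Y - A Y X, eq_of_apply_one_eq (fun g => ?_)
    (invField_comm_leftTranslation _) fun f => ?_⟩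
  · have h : ∀ X Y : E, invField G X * invField G Y * leftTranslation E g =
        leftTranslation E g * (invField G X * invField G Y) := fun X Y => by
      rw [mul_assoc, invField_comm_leftTranslation, ← mul_assoc,
        invField_comm_leftTranslation, mul_assoc]
    rw [sub_mul, mul_sub, h, h]
  · have hsymm : IsSymmSndFDerivAt ℝ (f ∘ (chartAt E (1 : G)).symm) p :=
      ((f.contDiffOn (1 : G)).contDiffAt hpt).isSymmSndFDerivAt
        (by simpa using (WithTop.coe_le_coe.2 le_top : ((2 : ℕ∞) : ℕ∞ω) ≤ ∞))
    rw [LinearMap.sub_apply, SmoothFun.sub_apply, Module.End.mul_apply, Module.End.mul_apply,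
      key, key, invField_apply_one, hsymm.eq X Y, map_sub]
    ring

end Fields

/-! ### Left invariant differential operators are polynomials in left invariant fields -/

section Generation

variable {E : Type*} [NormedAddCommGroup E] [NormedSpace ℝ E]
  {G : Type*} [TopologicalSpace G] [ChartedSpace E G] [Group G] [LieGroup 𝓘(ℝ, E) ∞ G]

variable (G) in
/-- The composition `X̃₁ ⋯ X̃ₖ` of the left invariant fields given by a list `[X₁, …, Xₖ]`. -/
def fieldProd (l : List E) : Module.End ℂ (SmoothFun E G) := (l.map (invField G)).prod

theorem fieldProd_nil : fieldProd G ([] : List E) = 1 := rfl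

theorem fieldProd_cons (X : E) (l : List E) :
    fieldProd G (X :: l) = invField G X * fieldProd G l := by
  simp [fieldProd]

theorem fieldProd_append (l l' : List E) :
    fieldProd G (l ++ l') = fieldProd G l * fieldProd G l' := by
  simp [fieldProd]

theorem fieldProd_comm_leftTranslation (l : List E) (g : G) :
    fieldProd G l * leftTranslation E g = leftTranslation E g * fieldProd G l := by
  induction l with
  | nil => simp [fieldProd_nil]
  | cons X l ih =>
    rw [fieldProd_cons, mul_assoc, ih, ← mul_assoc, invField_comm_leftTranslation, mul_assoc]

variable [FiniteDimensional ℝ E]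

theorem isDiffOp_invField (X : E) : IsDiffOp (invField G X) := by
  intro x₀
  let B := Module.finBasis ℝ E
  have hsm : ∀ j, ContDiffOn ℝ ∞ (fun y => ((B.coord j (chartField x₀ y X) : ℝ) : ℂ))
      (chartAt E x₀).target := fun j =>
    Complex.ofRealCLM.contDiff.comp_contDiffOn
      ((LinearMap.toContinuousLinearMap (B.coord j)).contDiff.comp_contDiffOn
        ((contDiffOn_chartField x₀).clm_apply contDiffOn_const))
  refine ⟨(chartAt E x₀).target, (chartAt E x₀).open_target, mem_chart_target E x₀, le_rfl,
    _, inferInstance, fun j y => ((B.coord j (chartField x₀ y X) : ℝ) : ℂ), fun j => [B j], hsm, ?_⟩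
  intro f y hy
  refine (invField_chart X f hy).trans ?_
  conv_lhs => rw [← B.sum_repr (chartField x₀ y X)]
  simp only [map_sum, map_smul, dirDeriv, Complex.real_smul]
  rfl

theorem invField_mem (X : E) : invField G X ∈ LeftInvDiffOp E G :=
  ⟨isDiffOp_invField X, invField_comm_leftTranslation X⟩

theorem fieldProd_mem (l : List E) : fieldProd G l ∈ LeftInvDiffOp E G := by
  refine Subalgebra.list_prod_mem _ fun D hD => ?_
  obtain ⟨X, -, rfl⟩ := List.mem_map.1 hD
  exact invField_mem X

variable (E G) in
/-- Near the identity the left invariant fields form a frame, so that every coordinate derivative is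
a combination of them with smooth coefficients. -/
theorem exists_frame :
    ∃ V : Set E, IsOpen V ∧ chartAt E (1 : G) 1 ∈ V ∧ V ⊆ (chartAt E (1 : G)).target ∧
      ∀ v : E, ∃ c : Fin (Module.finrank ℝ E) → E → ℂ, (∀ j, ContDiffOn ℝ ∞ (c j) V) ∧
        ∀ f : SmoothFun E G, ∀ y ∈ V, fderiv ℝ (f ∘ (chartAt E (1 : G)).symm) y v =
          ∑ j, c j y * invField G (Module.finBasis ℝ E j) f ((chartAt E (1 : G)).symm y) := by
  have : CompleteSpace E := FiniteDimensional.complete ℝ E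
  let B := Module.finBasis ℝ E
  let A : E → E →L[ℝ] E := chartField (1 : G)
  let U : Set (E →L[ℝ] E) := Set.range ((↑) : (E ≃L[ℝ] E) → E →L[ℝ] E)
  have hU : IsOpen U := ContinuousLinearEquiv.isOpen
  have hA : ContDiffOn ℝ ∞ A (chartAt E (1 : G)).target := contDiffOn_chartField (1 : G)
  have hV : IsOpen ((chartAt E (1 : G)).target ∩ A ⁻¹' U) :=
    hA.continuousOn.isOpen_inter_preimage (chartAt E (1 : G)).open_target hU
  refine ⟨(chartAt E (1 : G)).target ∩ A ⁻¹' U, hV, ⟨mem_chart_target E 1, ?_⟩,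
    Set.inter_subset_left, fun v => ?_⟩
  · exact ⟨ContinuousLinearEquiv.refl ℝ E, chartField_one.symm⟩
  have hinv : ContDiffOn ℝ ∞ (fun y => (A y).inverse)
      ((chartAt E (1 : G)).target ∩ A ⁻¹' U) := by
    intro y hy
    obtain ⟨e, he⟩ := hy.2
    refine ContDiffAt.contDiffWithinAt ?_
    have h1 : ContDiffAt ℝ ∞ ContinuousLinearMap.inverse (A y) := by
      rw [← he]
      exact contDiffAt_map_inverse e
    exact h1.comp y (hA.contDiffAt ((chartAt E (1 : G)).open_target.mem_nhds hy.1))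
  refine ⟨fun j y => ((B.coord j ((A y).inverse v) : ℝ) : ℂ), fun j => ?_, fun f y hy => ?_⟩
  · exact Complex.ofRealCLM.contDiff.comp_contDiffOn
      ((LinearMap.toContinuousLinearMap (B.coord j)).contDiff.comp_contDiffOn
        (hinv.clm_apply contDiffOn_const))
  · obtain ⟨e, he⟩ := hy.2
    have h1 : A y ((A y).inverse v) = v := by
      rw [← he, ContinuousLinearMap.inverse_equiv]
      exact e.apply_symm_apply v
    have h2 : ∀ j, invField G (B j) f ((chartAt E (1 : G)).symm y) =
        fderiv ℝ (f ∘ (chartAt E (1 : G)).symm) y (A y (B j)) := fun j => invField_chart _ f hy.1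
    change _ = ∑ j, _ * invField G (B j) f ((chartAt E (1 : G)).symm y)
    conv_lhs => rw [← h1, ← B.sum_repr ((A y).inverse v)]
    simp only [map_sum, map_smul, Complex.real_smul, h2]
    rfl

variable (E G) in
/-- Near the identity, iterated coordinate derivatives are combinations of products of left
invariant fields with smooth coefficients. -/
theorem exists_dirDeriv_eq_sum_fieldProd :
    ∃ V : Set E, IsOpen V ∧ chartAt E (1 : G) 1 ∈ V ∧ V ⊆ (chartAt E (1 : G)).target ∧
      ∀ l : List E, ∃ (ι : Type) (_ : Fintype ι) (a : ι → E → ℂ) (M : ι → List E),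
        (∀ i, ContDiffOn ℝ ∞ (a i) V) ∧
        ∀ f : SmoothFun E G, ∀ y ∈ V, dirDeriv l (f ∘ (chartAt E (1 : G)).symm) y =
          ∑ i, a i y * fieldProd G (M i) f ((chartAt E (1 : G)).symm y) := by
  obtain ⟨V, hV, hpV, hVt, hfr⟩ := exists_frame E G
  refine ⟨V, hV, hpV, hVt, fun l => ?_⟩
  induction l with
  | nil => exact ⟨Unit, inferInstance, fun _ _ => 1, fun _ => [], fun _ => contDiffOn_const,
      fun f y _ => by simp [dirDeriv, fieldProd_nil]⟩
  | cons v l ih =>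
    obtain ⟨ι, _, a, M, ha, h⟩ := ih
    obtain ⟨c, hc, hcf⟩ := hfr v
    refine ⟨ι ⊕ ι × Fin (Module.finrank ℝ E), inferInstance,
      Sum.elim (fun i y => fderiv ℝ (a i) y v) (fun q y => a q.1 y * c q.2 y),
      Sum.elim M (fun q => Module.finBasis ℝ E q.2 :: M q.1), ?_, fun f y hy => ?_⟩
    · rintro (i | q)
      · exact ((ha i).fderiv_of_isOpen hV (by simp)).clm_apply contDiffOn_const
      · exact (ha q.1).mul (hc q.2)
    · have hev : dirDeriv l (f ∘ (chartAt E (1 : G)).symm) =ᶠ[𝓝 y]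
          fun y => ∑ i, a i y * (fieldProd G (M i) f ∘ (chartAt E (1 : G)).symm) y :=
        Filter.eventually_of_mem (hV.mem_nhds hy) (h f)
      have hd : ∀ i, DifferentiableAt ℝ (a i) y := fun i =>
        ((ha i).contDiffAt (hV.mem_nhds hy)).differentiableAt (by simp)
      have hd' : ∀ i, DifferentiableAt ℝ
          (fieldProd G (M i) f ∘ (chartAt E (1 : G)).symm) y := fun i =>
        (((fieldProd G (M i) f).contDiffOn (1 : G)).contDiffAt
          ((chartAt E (1 : G)).open_target.mem_nhds (hVt hy))).differentiableAt (by simp)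
      rw [dirDeriv]
      beta_reduce
      rw [hev.fderiv_eq, fderiv_fun_sum (fun i _ => (hd i).fun_mul (hd' i))]
      simp only [sum_apply, Fintype.sum_sum_type, Sum.elim_inl, Sum.elim_inr,
        Fintype.sum_prod_type, fieldProd_cons, Module.End.mul_apply]
      rw [← Finset.sum_add_distrib]
      refine Finset.sum_congr rfl fun i _ => ?_
      rw [fderiv_fun_mul (hd i) (hd' i)]
      simp only [add_apply, smul_apply, smul_eq_mul,
        hcf (fieldProd G (M i) f) y hy, Finset.mul_sum, Function.comp, mul_assoc]
      rw [add_comm, mul_comm (fieldProd G (M i) f _)]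

/-- The algebra of left invariant differential operators is spanned by the products of left
invariant vector fields. -/
theorem leftInvDiffOp_le_span :
    Subalgebra.toSubmodule (LeftInvDiffOp E G) ≤ Submodule.span ℂ (Set.range (fieldProd G)) := by
  rintro D ⟨hD, hDL⟩
  obtain ⟨V, -, hpV, -, κ, _, a, L, -, hDf⟩ := hD 1
  obtain ⟨W, hW, hpW, hWt, hlist⟩ := exists_dirDeriv_eq_sum_fieldProd E G
  choose ι hι c M hc hM using hlist
  have hp : (chartAt E (1 : G)).symm (chartAt E (1 : G) 1) = 1 :=
    (chartAt E (1 : G)).left_inv (mem_chart_source E 1)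
  set p := chartAt E (1 : G) 1
  have hsum : D = ∑ i, a i p • ∑ j, c (L i) j p • fieldProd G (M (L i) j) := by
    refine eq_of_apply_one_eq hDL (fun g => ?_) fun f => ?_
    · simp only [Finset.sum_mul, Finset.mul_sum, smul_mul_assoc, mul_smul_comm,
        fieldProd_comm_leftTranslation]
    · have h1 : D f 1 = ∑ i, a i p * dirDeriv (L i) (f ∘ (chartAt E (1 : G)).symm) p := by
        have := hDf f p hpV
        rwa [hp] at this
      have hev : ∀ (κ : Type) (s : Finset κ) (T : κ → SmoothFun E G),
          (∑ i ∈ s, T i) 1 = ∑ i ∈ s, T i 1 := fun κ s T =>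
        map_sum (⟨⟨fun f : SmoothFun E G => f 1, rfl⟩, fun _ _ => rfl⟩ : SmoothFun E G →+ ℂ) T s
      simp only [h1, LinearMap.sum_apply, hev, LinearMap.smul_apply, SmoothFun.smul_apply]
      refine Finset.sum_congr rfl fun i _ => ?_
      rw [hM (L i) f p hpW, hp]
  rw [hsum]
  exact Submodule.sum_mem _ fun i _ => Submodule.smul_mem _ _ <| Submodule.sum_mem _ fun j _ =>
    Submodule.smul_mem _ _ (Submodule.subset_span ⟨_, rfl⟩)

end Generation

/-! ### Reordering products of left invariant fields -/

section Reorder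

variable {E : Type*} [NormedAddCommGroup E] [NormedSpace ℝ E]
  {G : Type*} [TopologicalSpace G] [ChartedSpace E G] [Group G] [LieGroup 𝓘(ℝ, E) ∞ G]

variable (E G) in
/-- The filtration by order: the span of the products of at most `n` left invariant fields. -/
def fieldFiltration (n : ℕ) : Submodule ℂ (Module.End ℂ (SmoothFun E G)) :=
  Submodule.span ℂ {D | ∃ l : List E, l.length ≤ n ∧ D = fieldProd G l}

theorem fieldProd_mem_filtration {l : List E} {n : ℕ} (h : l.length ≤ n) :
    fieldProd G l ∈ fieldFiltration E G n :=
  Submodule.subset_span ⟨l, h, rfl⟩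

theorem invField_mul_mem_filtration (X : E) {n : ℕ} {D : Module.End ℂ (SmoothFun E G)}
    (hD : D ∈ fieldFiltration E G n) : invField G X * D ∈ fieldFiltration E G (n + 1) := by
  induction hD using Submodule.span_induction with
  | mem D h =>
    obtain ⟨l, hl, rfl⟩ := h
    rw [← fieldProd_cons]
    exact fieldProd_mem_filtration (by simpa using hl)
  | zero => simp
  | add D D' _ _ h h' =>
    rw [mul_add]
    exact add_mem h h'
  | smul c D _ h =>
    rw [mul_smul_comm]
    exact Submodule.smul_mem _ _ h

/-- Permuting the factors of a product of left invariant fields changes it by an operator of lower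
order. -/
theorem fieldProd_sub_mem_of_perm {l l' : List E} (h : l.Perm l') :
    ∀ {n : ℕ}, l.length ≤ n + 1 → fieldProd G l - fieldProd G l' ∈ fieldFiltration E G n := by
  induction h with
  | nil => intro n _; simp
  | @cons X l₁ l₂ h ih =>
    intro n hn
    rw [fieldProd_cons, fieldProd_cons, ← mul_sub]
    cases n with
    | zero =>
      have h0 : l₁ = [] := List.eq_nil_of_length_eq_zero (by simpa using hn)
      subst h0
      rw [List.nil_perm.1 h, sub_self, mul_zero]
      exact zero_mem _
    | succ n => exact invField_mul_mem_filtration X (ih (by simpa using hn))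
  | swap X Y l =>
    intro n hn
    obtain ⟨Z, hZ⟩ := exists_invField_commutator (G := G) Y X
    have e : fieldProd G (Y :: X :: l) - fieldProd G (X :: Y :: l) = fieldProd G (Z :: l) := by
      simp only [fieldProd_cons, ← hZ, sub_mul, mul_assoc]
    rw [e]
    exact fieldProd_mem_filtration (by simpa using hn)
  | trans h₁ _ ih₁ ih₂ =>
    intro n hn
    have h := add_mem (ih₁ hn) (ih₂ (h₁.length_eq ▸ hn))
    simpa using h

/-- If `S` spans `E`, the products of elements of `S` span the filtration. -/
theorem fieldFiltration_le_span {S : Set E} (hS : Submodule.span ℝ S = ⊤) (n : ℕ) :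
    fieldFiltration E G n ≤
      Submodule.span ℂ {D | ∃ l : List E, l.length ≤ n ∧ (∀ X ∈ l, X ∈ S) ∧ D = fieldProd G l} := by
  refine Submodule.span_le.2 ?_
  rintro _ ⟨l, hl, rfl⟩
  induction l generalizing n with
  | nil => exact Submodule.subset_span ⟨[], by simp, by simp, rfl⟩
  | cons X l ih =>
    cases n with
    | zero => simp at hl
    | succ n =>
      have h := ih n (by simpa using hl)
      rw [fieldProd_cons]
      clear hl
      have hX : X ∈ Submodule.span ℝ S := hS ▸ Submodule.mem_top
      generalize fieldProd G l = P at h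
      induction hX using Submodule.span_induction with
      | mem X hX =>
        induction h using Submodule.span_induction with
        | mem D h =>
          obtain ⟨l', hl', hl'S, rfl⟩ := h
          rw [← fieldProd_cons]
          refine Submodule.subset_span ⟨X :: l', by simpa using hl', ?_, rfl⟩
          simpa using ⟨hX, hl'S⟩
        | zero =>
          rw [mul_zero]
          exact zero_mem _
        | add D D' _ _ h h' =>
          rw [mul_add]
          exact add_mem h h'
        | smul c D _ h =>
          rw [mul_smul_comm]
          exact Submodule.smul_mem _ _ h
      | zero =>
        rw [invField_zero, zero_mul]
        exact zero_mem _
      | add X Y _ _ hX hY =>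
        rw [invField_add, add_mul]
        exact add_mem hX hY
      | smul c X _ hX =>
        rw [invField_smul, smul_mul_assoc]
        exact Submodule.smul_mem _ _ hX

theorem symProd_eq {k : ℕ} (Y : Fin k → E) :
    symProd (G := G) (fun j => (Y j : GroupLieAlgebra 𝓘(ℝ, E) G)) = (k.factorial : ℂ)⁻¹ •
      ∑ σ : Equiv.Perm (Fin k), fieldProd G (List.ofFn (Y ∘ σ)) := by
  refine congrArg ((k.factorial : ℂ)⁻¹ • ·) (Finset.sum_congr rfl fun σ _ => ?_)
  rw [fieldProd, List.map_ofFn]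
  rfl

theorem symProd_of_eq_zero {k : ℕ} (hk : k = 0) (Y : Fin k → E) :
    symProd (G := G) (fun j => (Y j : GroupLieAlgebra 𝓘(ℝ, E) G)) = 1 := by
  subst hk
  rw [symProd_eq]
  simp [fieldProd_nil]

theorem symProd_sub_mem {l : List E} {k : ℕ} (Y : Fin k → E) (h : l.Perm (List.ofFn Y)) {n : ℕ}
    (hn : l.length ≤ n + 1) :
    symProd (G := G) (fun j => (Y j : GroupLieAlgebra 𝓘(ℝ, E) G)) - fieldProd G l ∈
      fieldFiltration E G n := by
  have hk : (k.factorial : ℂ) ≠ 0 := by exact_mod_cast k.factorial_ne_zero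
  have e : symProd (G := G) (fun j => (Y j : GroupLieAlgebra 𝓘(ℝ, E) G)) - fieldProd G l =
      (k.factorial : ℂ)⁻¹ • ∑ σ : Equiv.Perm (Fin k),
        (fieldProd G (List.ofFn (Y ∘ σ)) - fieldProd G l) := by
    rw [Finset.sum_sub_distrib, smul_sub, ← symProd_eq, Finset.sum_const, Finset.card_univ,
      Fintype.card_perm, Fintype.card_fin, ← Nat.cast_smul_eq_nsmul ℂ, smul_smul,
      inv_mul_cancel₀ hk, one_smul]
  rw [e]
  refine Submodule.smul_mem _ _ (Submodule.sum_mem _ fun σ _ => ?_)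
  have hp : (List.ofFn (Y ∘ σ)).Perm l := (Equiv.Perm.ofFn_comp_perm σ Y).trans h.symm
  exact fieldProd_sub_mem_of_perm hp (hp.length_eq ▸ hn)

/-- The image under symmetrization of the monomial attached to a multiset of indices. -/
theorem symmetrization_monomial {ι : Type*} (b : ι → E) (s : ι →₀ ℕ) :
    symmetrization (G := G) (fun i => (b i : GroupLieAlgebra 𝓘(ℝ, E) G))
      (MvPolynomial.monomial s 1) =
      symProd (G := G) (fun j => (b ((Finsupp.toMultiset s).toList.get j) :
        GroupLieAlgebra 𝓘(ℝ, E) G)) := by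
  have h := (MvPolynomial.basisMonomials ι ℂ).constr_basis ℂ
    (fun s => symProd (G := G) (fun j => (b ((Finsupp.toMultiset s).toList.get j) :
        GroupLieAlgebra 𝓘(ℝ, E) G))) s
  rw [MvPolynomial.coe_basisMonomials] at h
  exact h

/-- Let `Λ` together with the vectors `b i` span `E`, and let `I` contain all operators
`v (X̃ + c X)` for `X ∈ Λ`. Then every product of left invariant fields is, modulo `I`, the
symmetrization of a polynomial in the `b i`: move factors from `Λ` to the right, where they can be
replaced by scalars, and symmetrize the products that contain none. -/
theorem fieldFiltration_le_sup {ι : Type*} (b : ι → E) {Λ : Set E}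
    (hspan : Submodule.span ℝ (Set.range b ∪ Λ) = ⊤)
    {I : Submodule ℂ (Module.End ℂ (SmoothFun E G))} (c : E → ℂ)
    (hI : ∀ l : List E, ∀ X ∈ Λ,
      fieldProd G l * (invField G X + algebraMap ℂ (Module.End ℂ (SmoothFun E G)) (c X)) ∈ I)
    (n : ℕ) :
    fieldFiltration E G n ≤ I ⊔ LinearMap.range
      (symmetrization (G := G) (fun i => (b i : GroupLieAlgebra 𝓘(ℝ, E) G))) := by
  induction n using Nat.strong_induction_on with
  | _ n ih =>
  refine (fieldFiltration_le_span hspan n).trans (Submodule.span_le.2 ?_)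
  rintro _ ⟨l, hl, hlS, rfl⟩
  rcases hl.lt_or_eq with hlt | hn
  · exact ih _ hlt (fieldProd_mem_filtration le_rfl)
  by_cases hΛ : ∃ X ∈ l, X ∈ Λ
  · obtain ⟨X, hXl, hXΛ⟩ := hΛ
    obtain ⟨l₁, l₂, rfl⟩ := List.append_of_mem hXl
    have hlen : (l₁ ++ l₂).length + 1 = n := by
      rw [← hn]
      simp [add_assoc]
    have hperm : (l₁ ++ X :: l₂).Perm ((l₁ ++ l₂) ++ [X]) :=
      List.perm_middle.trans (List.perm_append_singleton X _).symm
    have h1 := ih _ (by omega : (l₁ ++ l₂).length < n)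
      (fieldProd_sub_mem_of_perm (G := G) hperm (by omega))
    have h2 := ih _ (by omega : (l₁ ++ l₂).length < n)
      (fieldProd_mem_filtration (G := G) (le_refl (l₁ ++ l₂).length))
    have h3 := hI (l₁ ++ l₂) X hXΛ
    have e : fieldProd G (l₁ ++ X :: l₂) =
        (fieldProd G (l₁ ++ X :: l₂) - fieldProd G ((l₁ ++ l₂) ++ [X])) +
        fieldProd G (l₁ ++ l₂) * (invField G X + algebraMap ℂ (Module.End ℂ (SmoothFun E G)) (c X))
        - c X • fieldProd G (l₁ ++ l₂) := by
      rw [fieldProd_append (l₁ ++ l₂), fieldProd_cons, fieldProd_nil, mul_one, mul_add,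
        ← Algebra.commutes, ← Algebra.smul_def]
      abel
    rw [e]
    exact sub_mem (add_mem h1 (Submodule.mem_sup_left h3)) (Submodule.smul_mem _ _ h2)
  · have hlb : ∀ X ∈ l, ∃ i, b i = X := fun X hX =>
      (hlS X hX).resolve_right fun h => hΛ ⟨X, hX, h⟩
    obtain ⟨l', rfl⟩ : ∃ l' : List ι, l'.map b = l := by
      refine ⟨l.attach.map fun X => (hlb X.1 X.2).choose, ?_⟩
      rw [List.map_map]
      conv_rhs => rw [← List.attach_map_subtype_val l]
      exact List.map_congr_left fun X _ => (hlb X.1 X.2).choose_spec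
    classical
    let s : ι →₀ ℕ := Multiset.toFinsupp (l' : Multiset ι)
    have hs : (Finsupp.toMultiset s).toList.Perm l' := by
      rw [← Multiset.coe_eq_coe, Multiset.coe_toList]
      exact Multiset.toFinsupp_toMultiset _
    let Y : Fin (Finsupp.toMultiset s).toList.length → E :=
      fun j => b ((Finsupp.toMultiset s).toList.get j)
    have hY : (l'.map b).Perm (List.ofFn Y) := by
      have h : List.ofFn Y = (Finsupp.toMultiset s).toList.map b := by
        refine (List.map_ofFn (f := (Finsupp.toMultiset s).toList.get) (g := b)).symm.trans ?_
        rw [List.ofFn_get]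
      rw [h]
      exact (hs.map b).symm
    have hmem : symProd (G := G) (fun j => (Y j : GroupLieAlgebra 𝓘(ℝ, E) G)) ∈
        I ⊔ LinearMap.range
          (symmetrization (G := G) (fun i => (b i : GroupLieAlgebra 𝓘(ℝ, E) G))) :=
      Submodule.mem_sup_right ⟨_, symmetrization_monomial b s⟩
    cases n with
    | zero =>
      have h0 : l' = [] := List.eq_nil_of_length_eq_zero (by simpa using hn)
      rw [symProd_of_eq_zero (by rw [hs.length_eq, h0, List.length_nil]) Y] at hmem
      rw [h0]
      exact hmem
    | succ n =>
      have h1 := ih n n.lt_succ_self (symProd_sub_mem Y hY hn.le)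
      have h2 := sub_mem hmem h1
      rwa [sub_sub_cancel] at h2

end Reorder

/-! ### One-parameter subgroups -/

section OneParameter

/-- A continuous multiplicative function `k` on the line is smooth, since
`k t * ∫₀ᵃ k = ∫ₜᵗ⁺ᵃ k`. -/
theorem contDiff_of_map_add_eq_mul {k : ℝ → ℂ} (hc : Continuous k) (h0 : k 0 = 1)
    (hadd : ∀ s t, k (s + t) = k s * k t) : ContDiff ℝ ∞ k := by
  let F : ℝ → ℂ := fun t => ∫ s in (0 : ℝ)..t, k s
  have hF : ∀ t, HasDerivAt F (k t) t := fun t =>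
    intervalIntegral.integral_hasDerivAt_right (hc.intervalIntegrable _ _)
      hc.stronglyMeasurable.stronglyMeasurableAtFilter hc.continuousAt
  obtain ⟨a, ha⟩ : ∃ a, F a ≠ 0 := by
    by_contra! h
    have h1 : F = fun _ => 0 := funext h
    have h2 := hF 0
    rw [h1, h0] at h2
    exact one_ne_zero (h2.unique (hasDerivAt_const 0 (0 : ℂ)))
  have hk : k = fun t => (F a)⁻¹ * (F (t + a) - F t) := by
    funext t
    have h1 : F (t + a) - F t = ∫ s in t..(t + a), k s :=
      intervalIntegral.integral_interval_sub_left (hc.intervalIntegrable _ _)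
        (hc.intervalIntegrable _ _)
    have h2 : ∫ s in t..(t + a), k s = ∫ s in (0 : ℝ)..a, k (t + s) := by
      rw [intervalIntegral.integral_comp_add_left k t, add_zero]
    rw [h1, h2]
    simp only [hadd, intervalIntegral.integral_const_mul]
    change k t = (F a)⁻¹ * (k t * F a)
    field_simp
  have hderiv : deriv F = k := funext fun t => (hF t).deriv
  refine contDiff_infty.2 fun n => ?_
  induction n with
  | zero => exact contDiff_zero.2 hc
  | succ n ih =>
    have hF' : ContDiff ℝ ((n : ℕ∞ω) + 1) F :=
      contDiff_succ_iff_deriv.2 ⟨fun t => (hF t).differentiableAt, by simp, by rwa [hderiv]⟩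
    rw [hk]
    push_cast
    exact contDiff_const.mul ((hF'.comp (contDiff_id.add contDiff_const)).sub hF')

variable {E : Type*} [NormedAddCommGroup E] [NormedSpace ℝ E] [FiniteDimensional ℝ E]
  {G : Type*} [TopologicalSpace G] [T2Space G] [ChartedSpace E G] [Group G]
  [LieGroup 𝓘(ℝ, E) ∞ G]

variable (G) in
/-- The curve `t ↦ exp (tX)`, for `X` in the model space. -/
def oneParam (X : E) : ℝ → G := expCurve (X : GroupLieAlgebra 𝓘(ℝ, E) G)

theorem oneParam_zero (X : E) : oneParam G X 0 = 1 :=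
  (Classical.choose_spec (exists_integralCurve (G := G) (X : GroupLieAlgebra 𝓘(ℝ, E) G))).1

theorem isMIntegralCurve_oneParam (X : E) :
    IsMIntegralCurve (I := 𝓘(ℝ, E)) (oneParam G X)
      (mulInvariantVectorField (I := 𝓘(ℝ, E)) (X : GroupLieAlgebra 𝓘(ℝ, E) G)) :=
  (Classical.choose_spec (exists_integralCurve (G := G) (X : GroupLieAlgebra 𝓘(ℝ, E) G))).2

theorem continuous_oneParam (X : E) : Continuous (oneParam G X) :=
  (isMIntegralCurve_oneParam X).continuous

theorem hasDerivAt_comp_oneParam {F : Type*} [NormedAddCommGroup F] [NormedSpace ℝ F] (X : E)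
    {u : G → F} (t : ℝ) (hu : MDifferentiableAt 𝓘(ℝ, E) 𝓘(ℝ, F) u (oneParam G X t)) :
    HasDerivAt (fun s => u (oneParam G X s))
      ((mfderiv 𝓘(ℝ, E) 𝓘(ℝ, F) (fun x => u (oneParam G X t * x)) 1 : E →L[ℝ] F) X) t := by
  obtain ⟨A, hA⟩ : ∃ A : E →L[ℝ] F, A = mfderiv 𝓘(ℝ, E) 𝓘(ℝ, F) u (oneParam G X t) := ⟨_, rfl⟩
  obtain ⟨v, hv⟩ : ∃ v : E, v = mulInvariantVectorField (I := 𝓘(ℝ, E))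
    (X : GroupLieAlgebra 𝓘(ℝ, E) G) (oneParam G X t) := ⟨_, rfl⟩
  have h2 : HasFDerivAt (fun s => u (oneParam G X s)) (A ∘L (1 : ℝ →L[ℝ] ℝ).smulRight v) t := by
    rw [hA, hv]
    exact hasMFDerivAt_iff_hasFDerivAt.1
      (hu.hasMFDerivAt.comp t (isMIntegralCurve_oneParam X t))
  have hL : MDifferentiableAt 𝓘(ℝ, E) 𝓘(ℝ, E) (fun x : G => oneParam G X t * x) 1 :=
    (contMDiff_mul_left (I := 𝓘(ℝ, E)) (n := ∞) (a := oneParam G X t)).mdifferentiable (by simp) 1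
  have hu' : MDifferentiableAt 𝓘(ℝ, E) 𝓘(ℝ, F) u (oneParam G X t * 1) := by rwa [mul_one]
  have h3 := (hu'.hasMFDerivAt.comp (1 : G) hL.hasMFDerivAt).mfderiv
  rw [mul_one] at h3
  have h4 : (mfderiv 𝓘(ℝ, E) 𝓘(ℝ, F) (fun x => u (oneParam G X t * x)) 1 : E →L[ℝ] F) X = A v := by
    rw [hA, hv]
    exact congrArg (fun T : E →L[ℝ] F => T X) h3
  have h5 := h2.hasDerivAt
  rw [h4]
  simpa using h5

/-- A left translate of an integral curve of a left invariant field is again an integral curve. -/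
theorem isMIntegralCurve_mul_left {X : E} {γ : ℝ → G} (hγ : IsMIntegralCurve (I := 𝓘(ℝ, E)) γ
      (mulInvariantVectorField (I := 𝓘(ℝ, E)) (X : GroupLieAlgebra 𝓘(ℝ, E) G))) (x : G) :
    IsMIntegralCurve (I := 𝓘(ℝ, E)) (fun t => x * γ t)
      (mulInvariantVectorField (I := 𝓘(ℝ, E)) (X : GroupLieAlgebra 𝓘(ℝ, E) G)) := by
  intro t
  have hx : ∀ a y : G, MDifferentiableAt 𝓘(ℝ, E) 𝓘(ℝ, E) (fun z : G => a * z) y := fun a y =>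
    (contMDiff_mul_left (I := 𝓘(ℝ, E)) (n := ∞) (a := a)).mdifferentiable (by simp) y
  have h1 := (hx x (γ t)).hasMFDerivAt.comp t (hγ t)
  have h2 := ((hx x (γ t * 1)).hasMFDerivAt.comp (1 : G) (hx (γ t) 1).hasMFDerivAt).mfderiv
  have e : (fun z : G => x * z) ∘ (fun z : G => γ t * z) = fun z => x * γ t * z := by
    ext z
    simp [mul_assoc]
  rw [e, mul_one] at h2
  have h3 : (1 : ℝ →L[ℝ] ℝ).smulRight (mulInvariantVectorField (I := 𝓘(ℝ, E))
        (X : GroupLieAlgebra 𝓘(ℝ, E) G) (x * γ t) : E) =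
      (mfderiv 𝓘(ℝ, E) 𝓘(ℝ, E) (fun z => x * z) (γ t) : E →L[ℝ] E) ∘L
        (1 : ℝ →L[ℝ] ℝ).smulRight (mulInvariantVectorField (I := 𝓘(ℝ, E))
          (X : GroupLieAlgebra 𝓘(ℝ, E) G) (γ t) : E) := by
    refine ContinuousLinearMap.ext fun s => ?_
    exact (congrArg (fun T : E →L[ℝ] E => s • (T X : E)) h2).trans (map_smul
      (mfderiv 𝓘(ℝ, E) 𝓘(ℝ, E) (fun z => x * z) (γ t) : E →L[ℝ] E) s
      (mulInvariantVectorField (I := 𝓘(ℝ, E)) (X : GroupLieAlgebra 𝓘(ℝ, E) G) (γ t) : E)).symm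
  exact h3 ▸ h1

theorem oneParam_add (X : E) (s t : ℝ) :
    oneParam G X (s + t) = oneParam G X s * oneParam G X t := by
  have : CompleteSpace E := FiniteDimensional.complete ℝ E
  have : LieGroup 𝓘(ℝ, E) (minSmoothness ℝ 3) G := LieGroup.of_le (n := ∞)
    (by simpa using (WithTop.coe_le_coe.2 le_top : ((3 : ℕ∞) : ℕ∞ω) ≤ ∞))
  have : IsManifold 𝓘(ℝ, E) 1 G := IsManifold.of_le (n := ∞) (by simp)
  have hv := (contMDiff_mulInvariantVectorField (I := 𝓘(ℝ, E)) (G := G)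
    (X : GroupLieAlgebra 𝓘(ℝ, E) G)).of_le (m := 1) (by simp)
  have h1 := isMIntegralCurve_mul_left (isMIntegralCurve_oneParam (G := G) X) (oneParam G X s)
  have h2 := (isMIntegralCurve_oneParam (G := G) X).comp_add s
  have h3 := isMIntegralCurve_Ioo_eq_of_contMDiff_boundaryless (t₀ := 0) hv h2 h1
    (by simp [oneParam_zero])
  have h4 := congrFun h3 t
  rwa [Function.comp, add_comm] at h4

theorem oneParam_neg (X : E) (t : ℝ) : oneParam G X (-t) = (oneParam G X t)⁻¹ := by
  rw [eq_inv_iff_mul_eq_one, ← oneParam_add, neg_add_cancel, oneParam_zero]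

theorem oneParam_nsmul (X : E) (n : ℕ) (t : ℝ) : oneParam G X (n * t) = oneParam G X t ^ n := by
  induction n with
  | zero => simp [oneParam_zero]
  | succ n ih => rw [pow_succ, ← ih, ← oneParam_add]; push_cast; ring_nf

/-- In the chart at the identity a one-parameter subgroup solves the differential equation given by
`chartField`. -/
theorem hasDerivAt_chart_oneParam (X : E) {t : ℝ}
    (ht : oneParam G X t ∈ (chartAt E (1 : G)).source) :
    HasDerivAt (fun s => chartAt E (1 : G) (oneParam G X s))
      (chartField (1 : G) (chartAt E (1 : G) (oneParam G X t)) X) t := by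
  have hu : MDifferentiableAt 𝓘(ℝ, E) 𝓘(ℝ, E) (chartAt E (1 : G)) (oneParam G X t) :=
    ((contMDiffOn_chart (I := 𝓘(ℝ, E)) (n := ∞) (x := (1 : G))).contMDiffAt
      ((chartAt E (1 : G)).open_source.mem_nhds ht)).mdifferentiableAt (by simp)
  have h := hasDerivAt_comp_oneParam X t hu
  have hy := (chartAt E (1 : G)).map_source ht
  have hl := (chartAt E (1 : G)).left_inv ht
  have h1 := mfderiv_mul_left_chart (F := E) (u := chartAt E (1 : G)) hy (by rwa [hl])
  rw [hl] at h1
  have h2 : chartAt E (1 : G) ∘ (chartAt E (1 : G)).symm =ᶠ[𝓝 (chartAt E (1 : G) (oneParam G X t))]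
      id := by
    filter_upwards [(chartAt E (1 : G)).open_target.mem_nhds hy] with b hb
    exact (chartAt E (1 : G)).right_inv hb
  rw [h2.fderiv_eq, fderiv_id] at h1
  exact h.congr_deriv (congrArg (fun T : E →L[ℝ] E => T X) h1)

theorem hasDerivAt_chart_oneParam_zero (X : E) :
    HasDerivAt (fun s => chartAt E (1 : G) (oneParam G X s)) X 0 := by
  have h := hasDerivAt_chart_oneParam (G := G) X (t := 0)
    (by rw [oneParam_zero]; exact mem_chart_source E 1)
  rw [oneParam_zero, chartField_one] at h
  exact h

theorem contMDiff_oneParam (X : E) : ContMDiff 𝓘(ℝ, ℝ) 𝓘(ℝ, E) ∞ (oneParam G X) := by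
  have h0 : ContMDiffAt 𝓘(ℝ, ℝ) 𝓘(ℝ, E) ∞ (oneParam G X) 0 := by
    have hs : oneParam G X ⁻¹' (chartAt E (1 : G)).source ∈ 𝓝 (0 : ℝ) := by
      refine (continuous_oneParam X).continuousAt.preimage_mem_nhds ?_
      rw [oneParam_zero]
      exact (chartAt E (1 : G)).open_source.mem_nhds (mem_chart_source E 1)
    obtain ⟨ε, hε, hball⟩ := Metric.mem_nhds_iff.1 hs
    have hIcc : Set.Icc (-(ε / 2)) (ε / 2) ⊆ oneParam G X ⁻¹' (chartAt E (1 : G)).source := by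
      intro t ht
      refine hball ?_
      rw [Metric.mem_ball, Real.dist_eq, sub_zero]
      exact (abs_le.2 ht).trans_lt (by linarith)
    have hz : ContDiffOn ℝ ∞ (fun s => chartAt E (1 : G) (oneParam G X s))
        (Set.Icc (-(ε / 2)) (ε / 2)) := by
      refine ODE.contDiffOn_enat_Icc_of_hasDerivWithinAt (n := ⊤)
        (f := fun _ y => chartField (1 : G) y X) (u := (chartAt E (1 : G)).target) ?_
        (fun t ht => (hasDerivAt_chart_oneParam X (hIcc ht)).hasDerivWithinAt)
        (fun t ht => (chartAt E (1 : G)).map_source (hIcc ht))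
      exact ((contDiffOn_chartField (1 : G)).comp contDiff_snd.contDiffOn
        fun q hq => hq.2).clm_apply contDiffOn_const
    have hnhds : Set.Icc (-(ε / 2)) (ε / 2) ∈ 𝓝 (0 : ℝ) := Icc_mem_nhds (by linarith) (by linarith)
    have hz0 := (hz.contDiffAt hnhds).contMDiffAt
    have hsymm : ContMDiffAt 𝓘(ℝ, E) 𝓘(ℝ, E) ∞ (chartAt E (1 : G)).symm
        (chartAt E (1 : G) (oneParam G X 0)) :=
      (contMDiffOn_chart_symm (I := 𝓘(ℝ, E)) (n := ∞) (x := (1 : G))).contMDiffAt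
        ((chartAt E (1 : G)).open_target.mem_nhds ((chartAt E (1 : G)).map_source
          (hIcc ⟨by linarith, by linarith⟩)))
    refine (hsymm.comp (0 : ℝ) hz0).congr_of_eventuallyEq ?_
    filter_upwards [hs] with t ht
    exact ((chartAt E (1 : G)).left_inv ht).symm
  intro t
  have e : oneParam G X = fun s => oneParam G X t * oneParam G X (s - t) := by
    funext s
    rw [← oneParam_add]
    congr 1
    ring
  rw [e]
  have h1 : ContMDiffAt 𝓘(ℝ, ℝ) 𝓘(ℝ, E) ∞ (fun s => oneParam G X (s - t)) t := by
    refine ContMDiffAt.comp t (g := oneParam G X) (f := fun s : ℝ => s - t) ?_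
      (contDiff_id.sub contDiff_const).contMDiff.contMDiffAt
    rwa [sub_self]
  exact contMDiffAt_const.mul h1

theorem hasDerivAt_mul_oneParam (X : E) (f : SmoothFun E G) (g : G) :
    HasDerivAt (fun t => f (g * oneParam G X t)) (invField G X f g) 0 := by
  have h := hasDerivAt_comp_oneParam X (u := fun x => f (g * x)) 0
    ((leftTranslation E g f).mdifferentiableAt _)
  rw [oneParam_zero] at h
  refine h.congr_deriv ?_
  rw [invField_apply_mfderiv]
  exact congrArg (fun u : G → ℂ => (mfderiv 𝓘(ℝ, E) 𝓘(ℝ, ℂ) u 1 : E →L[ℝ] ℂ) X)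
    (funext fun x => by rw [one_mul])

end OneParameter

/-! ### The twisted ideal annihilates the equivariant functions -/

section Annihilator

variable {E : Type*} [NormedAddCommGroup E] [NormedSpace ℝ E] [FiniteDimensional ℝ E]
  {G : Type*} [TopologicalSpace G] [T2Space G] [ChartedSpace E G] [Group G]
  [LieGroup 𝓘(ℝ, E) ∞ G] {H : Subgroup G}

variable (E) in
/-- The Lie algebra of `H` as a set of vectors of the model space. -/
def lieVec (H : Subgroup G) : Set E := lieAlg (E := E) H

/-- The restriction of a character of `H` to a one-parameter subgroup of `H`. -/
def charCurve (χ : H →ₜ* ℂˣ) {X : E} (hX : X ∈ lieVec E H) (t : ℝ) : ℂ :=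
  ((χ ⟨oneParam G X t, hX t⟩ : ℂˣ) : ℂ)

theorem contDiff_charCurve (χ : H →ₜ* ℂˣ) {X : E} (hX : X ∈ lieVec E H) :
    ContDiff ℝ ∞ (charCurve χ hX) := by
  refine contDiff_of_map_add_eq_mul ?_ ?_ fun s t => ?_
  · exact Units.continuous_val.comp (χ.continuous_toFun.comp
      ((continuous_oneParam X).subtype_mk _))
  · have h : (⟨oneParam G X 0, hX 0⟩ : H) = 1 := Subtype.ext (oneParam_zero X)
    rw [charCurve, h, map_one, Units.val_one]
  · have h : (⟨oneParam G X (s + t), hX (s + t)⟩ : H) =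
        ⟨oneParam G X s, hX s⟩ * ⟨oneParam G X t, hX t⟩ := Subtype.ext (oneParam_add X s t)
    rw [charCurve, h, map_mul, Units.val_mul]
    rfl

variable (E) in
/-- The differential of `χ` as a function on the model space, zero outside the Lie algebra. -/
def charDiff (χ : H →ₜ* ℂˣ) (X : E) : ℂ :=
  open scoped Classical in if hX : X ∈ lieVec E H then deriv (charCurve χ hX) 0 else 0

theorem mem_equivariantFun {χ : H →ₜ* ℂˣ} {f : SmoothFun E G} :
    f ∈ equivariantFun E χ ↔ ∀ (g : G) (h : H), f (g * h) = f g * ((χ h⁻¹ : ℂˣ) : ℂ) := Iff.rfl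

theorem invField_add_charDiff_apply {χ : H →ₜ* ℂˣ} {X : E} (hX : X ∈ lieVec E H)
    {f : SmoothFun E G} (hf : f ∈ equivariantFun E χ) :
    (invField G X + algebraMap ℂ (Module.End ℂ (SmoothFun E G)) (charDiff E χ X)) f = 0 := by
  refine DFunLike.ext _ _ fun g => ?_
  have h1 := hasDerivAt_mul_oneParam X f g
  have hk : HasDerivAt (charCurve χ hX) (charDiff E χ X) 0 := by
    rw [charDiff, dif_pos hX]
    exact ((contDiff_charCurve χ hX).differentiable (by simp) 0).hasDerivAt
  have e : (fun t => f (g * oneParam G X t)) = fun t => f g * charCurve χ hX (-t) := by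
    funext t
    have h2 : (⟨oneParam G X t, hX t⟩ : H)⁻¹ = ⟨oneParam G X (-t), hX (-t)⟩ :=
      Subtype.ext (oneParam_neg X t).symm
    rw [charCurve, ← h2]
    exact mem_equivariantFun.1 hf g ⟨oneParam G X t, hX t⟩
  rw [e] at h1
  have hk' : HasDerivAt (charCurve χ hX) (charDiff E χ X) (-0) := by rwa [neg_zero]
  have h3 := h1.unique ((hk'.scomp (0 : ℝ) (hasDerivAt_neg (0 : ℝ))).const_mul (f g))
  rw [LinearMap.add_apply, SmoothFun.add_apply, h3, Module.algebraMap_end_apply,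
    SmoothFun.smul_apply, SmoothFun.zero_apply, neg_smul, one_smul]
  ring

theorem mem_twistedLieAlg_iff {χ : H →ₜ* ℂˣ} {D : Module.End ℂ (SmoothFun E G)} :
    D ∈ twistedLieAlg χ ↔ ∃ X ∈ lieVec E H, ∃ Y ∈ lieVec E H,
      D = (invField G X + algebraMap ℂ (Module.End ℂ (SmoothFun E G)) (charDiff E χ X)) +
        Complex.I • (invField G Y +
          algebraMap ℂ (Module.End ℂ (SmoothFun E G)) (charDiff E χ Y)) := by
  have hc : ∀ (X : E) (hX : X ∈ lieVec E H),
      charDeriv (E := E) χ ⟨X, hX⟩ = charDiff E χ X := fun X hX => by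
    simp only [charDiff, dif_pos hX]
    rfl
  have e : ∀ (X Y : E) (hX : X ∈ lieVec E H) (hY : Y ∈ lieVec E H),
      (invField G X + Complex.I • invField G Y) + algebraMap ℂ (Module.End ℂ (SmoothFun E G))
        (charDeriv (E := E) χ ⟨X, hX⟩ + Complex.I * charDeriv (E := E) χ ⟨Y, hY⟩) =
      (invField G X + algebraMap ℂ (Module.End ℂ (SmoothFun E G)) (charDiff E χ X)) +
      Complex.I • (invField G Y +
        algebraMap ℂ (Module.End ℂ (SmoothFun E G)) (charDiff E χ Y)) := by
    intro X Y hX hY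
    rw [hc, hc]
    simp only [Algebra.algebraMap_eq_smul_one, add_smul, mul_smul, smul_add]
    abel
  constructor
  · rintro ⟨⟨X, hX⟩, ⟨Y, hY⟩, rfl⟩
    exact ⟨X, hX, Y, hY, e X Y hX hY⟩
  · rintro ⟨X, hX, Y, hY, rfl⟩
    exact ⟨⟨X, hX⟩, ⟨Y, hY⟩, (e X Y hX hY).symm⟩

theorem twistedLieAlg_apply {χ : H →ₜ* ℂˣ} {D : Module.End ℂ (SmoothFun E G)}
    (hD : D ∈ twistedLieAlg χ) {f : SmoothFun E G} (hf : f ∈ equivariantFun E χ) : D f = 0 := by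
  obtain ⟨X, hX, Y, hY, rfl⟩ := mem_twistedLieAlg_iff.1 hD
  rw [LinearMap.add_apply, LinearMap.smul_apply, invField_add_charDiff_apply hX hf,
    invField_add_charDiff_apply hY hf, smul_zero, add_zero]

/-- All operators in `𝔻(G)𝔥^χ` vanish on `C^∞_{H,χ}(G)`. -/
theorem twistedIdeal_apply {χ : H →ₜ* ℂˣ} {D : Module.End ℂ (SmoothFun E G)}
    (hD : D ∈ twistedIdeal χ) {f : SmoothFun E G} (hf : f ∈ equivariantFun E χ) : D f = 0 := by
  induction hD using Submodule.span_induction with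
  | mem D h =>
    obtain ⟨v, -, w, hw, rfl⟩ := h
    rw [Module.End.mul_apply, twistedLieAlg_apply hw hf, map_zero]
  | zero => rfl
  | add D D' _ _ h h' => rw [LinearMap.add_apply, h, h', add_zero]
  | smul c D _ h => rw [LinearMap.smul_apply, h, smul_zero]

theorem mul_invField_add_mem_twistedIdeal {χ : H →ₜ* ℂˣ} {v : Module.End ℂ (SmoothFun E G)}
    (hv : v ∈ LeftInvDiffOp E G) {X : E} (hX : X ∈ lieVec E H) :
    v * (invField G X + algebraMap ℂ (Module.End ℂ (SmoothFun E G)) (charDiff E χ X)) ∈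
      twistedIdeal χ := by
  -- the elements of `𝔥^χ` are indexed by pairs `(X, Y)`; the pair `(X, X)` gives `1 + i` times `X`
  have hI : (1 + Complex.I) ≠ 0 := fun h => by simpa using congrArg Complex.re h
  have h1 : v * (_ + Complex.I • _) ∈ twistedIdeal χ :=
    Submodule.subset_span ⟨v, hv, _, mem_twistedLieAlg_iff.2 ⟨X, hX, X, hX, rfl⟩, rfl⟩
  generalize invField G X + algebraMap ℂ (Module.End ℂ (SmoothFun E G)) (charDiff E χ X) = T at h1 ⊢
  have h2 : v * T = (1 + Complex.I)⁻¹ • (v * (T + Complex.I • T)) := by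
    have h3 : v * (T + Complex.I • T) = (1 + Complex.I) • (v * T) := by
      rw [mul_add, mul_smul_comm, add_smul, one_smul]
    rw [h3, smul_smul, inv_mul_cancel₀ hI, one_smul]
  rw [h2]
  exact Submodule.smul_mem _ _ h1

end Annihilator

/-! ### Tangent directions of a closed subgroup -/

section ClosedSubgroup

/-- Comparison of powers in a group: if left and right multiplication by elements of `N` distort
the map `φ` at most by the factor `K`, then the powers of `g` and `c` stay close as long as those of
`c` stay well inside `N`. The proof telescopes along `g ^ i * c ^ (j - i)`. -/
theorem dist_pow_le {G E : Type*} [Group G] [PseudoMetricSpace E] {φ : G → E} {N S : Set G} {p : E}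
    {ρ K : ℝ} (hN : ∀ z, z ∈ N ↔ z ∈ S ∧ dist (φ z) p < ρ) (h1 : (1 : G) ∈ N)
    (hS : ∀ z ∈ N, ∀ b ∈ N, ∀ w ∈ N, z * b * w ∈ S)
    (hK : ∀ z ∈ N, ∀ b ∈ N, ∀ b' ∈ N, ∀ w ∈ N,
      dist (φ (z * b * w)) (φ (z * b' * w)) ≤ K * dist (φ b) (φ b'))
    {g c : G} (hg : g ∈ N) {m : ℕ} (hc1 : c ∈ N)
    (hc : ∀ i ≤ m, c ^ i ∈ N ∧ dist (φ (c ^ i)) p < ρ / 2)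
    (hK0 : 0 ≤ K) (hm : m * (K * dist (φ c) (φ g)) < ρ / 2) :
    ∀ j ≤ m, g ^ j ∈ N ∧ dist (φ (c ^ j)) (φ (g ^ j)) ≤ j * (K * dist (φ c) (φ g)) := by
  intro j
  induction j using Nat.strong_induction_on with
  | _ j ih =>
  intro hj
  have hdist : dist (φ (c ^ j)) (φ (g ^ j)) ≤ j * (K * dist (φ c) (φ g)) := by
    have h := dist_le_range_sum_dist (fun i => φ (g ^ i * c ^ (j - i))) j
    simp only [pow_zero, one_mul, Nat.sub_zero, Nat.sub_self, mul_one] at h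
    refine h.trans ?_
    have h2 : ∀ i ∈ Finset.range j, dist (φ (g ^ i * c ^ (j - i)))
        (φ (g ^ (i + 1) * c ^ (j - (i + 1)))) ≤ K * dist (φ c) (φ g) := by
      intro i hi
      have hij := Finset.mem_range.1 hi
      have e1 : g ^ i * c ^ (j - i) = g ^ i * c * c ^ (j - (i + 1)) := by
        rw [mul_assoc, ← pow_succ', show j - (i + 1) + 1 = j - i by omega]
      rw [e1, pow_succ]
      exact hK _ (ih i hij (by omega)).1 _ hc1 _ hg _ (hc _ (by omega)).1
    refine (Finset.sum_le_sum h2).trans ?_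
    rw [Finset.sum_const, Finset.card_range, nsmul_eq_mul]
  refine ⟨?_, hdist⟩
  rw [hN]
  constructor
  · cases j with
    | zero =>
      rw [pow_zero]
      exact ((hN 1).1 h1).1
    | succ j =>
      have h := hS _ (ih j (by omega) (by omega)).1 _ hg _ h1
      rwa [mul_one, ← pow_succ] at h
  · have h3 : (j : ℝ) * (K * dist (φ c) (φ g)) ≤ m * (K * dist (φ c) (φ g)) :=
      mul_le_mul_of_nonneg_right (by exact_mod_cast hj) (mul_nonneg hK0 dist_nonneg)
    have h4 := (hc j hj).2
    have h5 := dist_triangle_left (φ (g ^ j)) p (φ (c ^ j))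
    linarith

variable {E : Type*} [NormedAddCommGroup E] [NormedSpace ℝ E]
  {G : Type*} [TopologicalSpace G] [ChartedSpace E G] [Group G] [LieGroup 𝓘(ℝ, E) ∞ G]

variable (E G) in
/-- Triple products near the identity are Lipschitz in the middle factor, in the chart. -/
theorem exists_lipschitz_triple_mul : ∃ ρ > 0, ∃ K : ℝ, 0 ≤ K ∧
    (∀ z b w : G, z ∈ (chartAt E (1 : G)).source → b ∈ (chartAt E (1 : G)).source →
      w ∈ (chartAt E (1 : G)).source →
      dist (chartAt E (1 : G) z) (chartAt E (1 : G) 1) < ρ →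
      dist (chartAt E (1 : G) b) (chartAt E (1 : G) 1) < ρ →
      dist (chartAt E (1 : G) w) (chartAt E (1 : G) 1) < ρ →
      z * b * w ∈ (chartAt E (1 : G)).source ∧
      ∀ b' ∈ (chartAt E (1 : G)).source, dist (chartAt E (1 : G) b') (chartAt E (1 : G) 1) < ρ →
      dist (chartAt E (1 : G) (z * b * w)) (chartAt E (1 : G) (z * b' * w)) ≤
        K * dist (chartAt E (1 : G) b) (chartAt E (1 : G) b')) := by
  set φ := chartAt E (1 : G) with hφ
  set p := φ 1 with hp
  have hps : φ.symm p = 1 := φ.left_inv (mem_chart_source E 1)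
  have hsymm : ContMDiffAt 𝓘(ℝ, E) 𝓘(ℝ, E) ∞ φ.symm p :=
    (contMDiffOn_chart_symm (I := 𝓘(ℝ, E)) (n := ∞) (x := (1 : G))).contMDiffAt
      (φ.open_target.mem_nhds (mem_chart_target E 1))
  let Q : E × E × E → G := fun q => φ.symm q.1 * φ.symm q.2.1 * φ.symm q.2.2
  have hQ1 : Q (p, p, p) = 1 := by simp [Q, hps]
  have hQ : ContMDiffAt 𝓘(ℝ, E × E × E) 𝓘(ℝ, E) ∞ Q (p, p, p) :=
    ((ContMDiffAt.comp (p, p, p) hsymm contDiff_fst.contMDiff.contMDiffAt).mul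
      (ContMDiffAt.comp (f := fun q : E × E × E => q.2.1) (p, p, p) hsymm
        contDiff_snd.fst.contMDiff.contMDiffAt)).mul
      (ContMDiffAt.comp (f := fun q : E × E × E => q.2.2) (p, p, p) hsymm
        contDiff_snd.snd.contMDiff.contMDiffAt)
  have hφd : ContMDiffAt 𝓘(ℝ, E) 𝓘(ℝ, E) ∞ φ (Q (p, p, p)) := by
    rw [hQ1]
    exact (contMDiffOn_chart (I := 𝓘(ℝ, E)) (n := ∞) (x := (1 : G))).contMDiffAt
      (φ.open_source.mem_nhds (mem_chart_source E 1))
  have hM : ContDiffAt ℝ 1 (φ ∘ Q) (p, p, p) :=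
    ((ContMDiffAt.comp (p, p, p) hφd hQ).contDiffAt).of_le (by simp)
  obtain ⟨K, t, ht, hlip⟩ := hM.exists_lipschitzOnWith
  have hsrc : Q ⁻¹' φ.source ∈ 𝓝 (p, p, p) := hQ.continuousAt.preimage_mem_nhds
    (by rw [hQ1]; exact φ.open_source.mem_nhds (mem_chart_source E 1))
  obtain ⟨ρ, hρ, hball⟩ := Metric.mem_nhds_iff.1 (Filter.inter_mem ht hsrc)
  refine ⟨ρ, hρ, K, K.2, ?_⟩
  intro z b w hz hb hw hzp hbp hwp
  have hmem : ∀ b ∈ φ.source, dist (φ b) p < ρ → (φ z, φ b, φ w) ∈ t ∩ Q ⁻¹' φ.source :=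
    fun b _ hbp => hball (by simp [Prod.dist_eq, hzp, hbp, hwp])
  have hQe : ∀ b ∈ φ.source, Q (φ z, φ b, φ w) = z * b * w := fun b hb => by
    simp only [Q, φ.left_inv hz, φ.left_inv hb, φ.left_inv hw]
  refine ⟨hQe b hb ▸ (hmem b hb hbp).2, fun b' hb' hbp' => ?_⟩
  have h := hlip.dist_le_mul _ (hmem b hb hbp).1 _ (hmem b' hb' hbp').1
  simp only [Function.comp, hQe b hb, hQe b' hb'] at h
  refine h.trans (mul_le_mul_of_nonneg_left (le_of_eq ?_) K.2)
  simp [Prod.dist_eq]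

variable [FiniteDimensional ℝ E] [T2Space G]

/-- If the elements `g n` of a closed subgroup `H` tend to the identity in the direction `X`, then
`X` belongs to the Lie algebra of `H`: the powers `g n ^ ⌊t / ε n⌋` tend to `exp (tX)`. -/
theorem mem_lieVec_of_tendsto {H : Subgroup G} (hH : IsClosed (H : Set G)) {g : ℕ → G}
    (hg : ∀ n, g n ∈ H) (hg1 : Filter.Tendsto g Filter.atTop (𝓝 1)) {ε : ℕ → ℝ} (hε : ∀ n, 0 < ε n)
    (hε0 : Filter.Tendsto ε Filter.atTop (𝓝 0)) {X : E}
    (hX : Filter.Tendsto (fun n => (ε n)⁻¹ • (chartAt E (1 : G) (g n) - chartAt E (1 : G) 1))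
      Filter.atTop (𝓝 X)) : X ∈ lieVec E H := by
  obtain ⟨ρ, hρ, K, hK0, hlip⟩ := exists_lipschitz_triple_mul E G
  set φ := chartAt E (1 : G) with hφ
  set p := φ 1 with hp
  set γ := oneParam G X with hγ
  have hγ0 : γ 0 = 1 := oneParam_zero X
  have h1s : (1 : G) ∈ φ.source := mem_chart_source E 1
  have hφ1 : ContinuousAt φ 1 := φ.continuousAt h1s
  let N : Set G := {z | z ∈ φ.source ∧ dist (φ z) p < ρ}
  have hN1 : (1 : G) ∈ N := ⟨h1s, by rwa [dist_self]⟩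
  have hnear : ∀ r > 0, {z | z ∈ φ.source ∧ dist (φ z) p < r} ∈ 𝓝 (1 : G) := fun r hr =>
    Filter.inter_mem (φ.open_source.mem_nhds h1s) (hφ1 (Metric.ball_mem_nhds p hr))
  -- the curve stays well inside `N` for a short time
  obtain ⟨T, hT, hγT⟩ : ∃ T > 0, ∀ s, |s| ≤ T → γ s ∈ φ.source ∧ dist (φ (γ s)) p < ρ / 2 := by
    have h : γ ⁻¹' {z | z ∈ φ.source ∧ dist (φ z) p < ρ / 2} ∈ 𝓝 (0 : ℝ) :=
      (continuous_oneParam X).continuousAt.preimage_mem_nhds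
        (by rw [← hγ, hγ0]; exact hnear _ (by linarith))
    obtain ⟨T, hT, hball⟩ := Metric.mem_nhds_iff.1 h
    refine ⟨T / 2, by linarith, fun s hs => hball ?_⟩
    rw [Metric.mem_ball, Real.dist_eq, sub_zero]
    linarith
  have hδ : Filter.Tendsto (fun n => (ε n)⁻¹ * dist (φ (γ (ε n))) (φ (g n)))
      Filter.atTop (𝓝 0) := by
    have h1 : Filter.Tendsto (fun n => (ε n)⁻¹ • (φ (γ (ε n)) - p)) Filter.atTop (𝓝 X) := by
      have h := (hasDerivAt_chart_oneParam_zero (G := G) X).tendsto_slope_zero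
      have hne : Filter.Tendsto ε Filter.atTop (𝓝[≠] 0) :=
        tendsto_nhdsWithin_iff.2 ⟨hε0, Filter.Eventually.of_forall fun n => (hε n).ne'⟩
      have h2 := h.comp hne
      simpa only [Function.comp_def, zero_add, oneParam_zero] using h2
    have h2 := (h1.sub hX).norm
    rw [sub_self, norm_zero] at h2
    refine h2.congr fun n => ?_
    rw [← smul_sub, sub_sub_sub_cancel_right, norm_smul, Real.norm_eq_abs,
      abs_of_pos (inv_pos.2 (hε n)), dist_eq_norm]
  have hshort : ∀ t, 0 ≤ t → t ≤ T → γ t ∈ H := by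
    intro t ht0 htT
    let m : ℕ → ℕ := fun n => ⌊t / ε n⌋₊
    have hmle : ∀ n, (m n : ℝ) * ε n ≤ t := fun n =>
      (le_div_iff₀ (hε n)).1 (Nat.floor_le (div_nonneg ht0 (hε n).le))
    have hmt : Filter.Tendsto (fun n => (m n : ℝ) * ε n) Filter.atTop (𝓝 t) := by
      have hlow : Filter.Tendsto (fun n => t - ε n) Filter.atTop (𝓝 t) := by
        simpa using tendsto_const_nhds.sub hε0
      refine tendsto_of_tendsto_of_tendsto_of_le_of_le hlow tendsto_const_nhds (fun n => ?_) hmle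
      have h := (div_lt_iff₀ (hε n)).1 (Nat.lt_floor_add_one (t / ε n))
      change t - ε n ≤ (⌊t / ε n⌋₊ : ℝ) * ε n
      linarith
    have hbound : ∀ n, (m n : ℝ) * (K * dist (φ (γ (ε n))) (φ (g n))) ≤
        t * K * ((ε n)⁻¹ * dist (φ (γ (ε n))) (φ (g n))) := by
      intro n
      have hpos : 0 ≤ K * ((ε n)⁻¹ * dist (φ (γ (ε n))) (φ (g n))) :=
        mul_nonneg hK0 (mul_nonneg (inv_pos.2 (hε n)).le dist_nonneg)
      have h := mul_le_mul_of_nonneg_right (hmle n) hpos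
      have hne := (hε n).ne'
      calc (m n : ℝ) * (K * dist (φ (γ (ε n))) (φ (g n)))
          = m n * ε n * (K * ((ε n)⁻¹ * dist (φ (γ (ε n))) (φ (g n)))) := by field_simp
        _ ≤ t * (K * ((ε n)⁻¹ * dist (φ (γ (ε n))) (φ (g n)))) := h
        _ = _ := by ring
    have hb0 : Filter.Tendsto (fun n => t * K * ((ε n)⁻¹ * dist (φ (γ (ε n))) (φ (g n))))
        Filter.atTop (𝓝 0) := by simpa using hδ.const_mul (t * K)
    have hev : ∀ᶠ n in Filter.atTop, g n ^ m n ∈ N ∧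
        dist (φ (γ (m n * ε n))) (φ (g n ^ m n)) ≤
          t * K * ((ε n)⁻¹ * dist (φ (γ (ε n))) (φ (g n))) := by
      filter_upwards [hg1 (hnear ρ hρ), hb0.eventually (gt_mem_nhds (by linarith : 0 < ρ / 2)),
        hε0.eventually (gt_mem_nhds hT)] with n hgn hbn hεn
      have hpow : ∀ i : ℕ, γ (ε n) ^ i = γ (i * ε n) := fun i => (oneParam_nsmul X i (ε n)).symm
      have hin : ∀ s, |s| ≤ T → γ s ∈ N ∧ dist (φ (γ s)) p < ρ / 2 := fun s hs =>
        ⟨⟨(hγT s hs).1, (hγT s hs).2.trans (by linarith)⟩, (hγT s hs).2⟩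
      have h := dist_pow_le (φ := φ) (N := N) (S := φ.source) (p := p) (ρ := ρ) (K := K)
        (fun z => Iff.rfl) hN1
        (fun z hz b hb w hw => (hlip z b w hz.1 hb.1 hw.1 hz.2 hb.2 hw.2).1)
        (fun z hz b hb b' hb' w hw =>
          (hlip z b w hz.1 hb.1 hw.1 hz.2 hb.2 hw.2).2 b' hb'.1 hb'.2)
        (g := g n) (c := γ (ε n)) hgn (m := m n)
        (hin _ (by rw [abs_of_pos (hε n)]; exact hεn.le)).1
        (fun i hi => by
          rw [hpow]
          refine hin _ ?_
          rw [abs_of_nonneg (mul_nonneg i.cast_nonneg (hε n).le)]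
          have : (i : ℝ) * ε n ≤ m n * ε n :=
            mul_le_mul_of_nonneg_right (by exact_mod_cast hi) (hε n).le
          linarith [hmle n])
        hK0 ((hbound n).trans_lt hbn) (m n) le_rfl
      rw [hpow] at h
      exact ⟨h.1, h.2.trans (hbound n)⟩
    have hts : γ t ∈ φ.source := (hγT t (by rwa [abs_of_nonneg ht0])).1
    have hlim1 : Filter.Tendsto (fun n => φ (γ (m n * ε n))) Filter.atTop (𝓝 (φ (γ t))) :=
      ((φ.continuousAt hts).comp (continuous_oneParam X).continuousAt).tendsto.comp hmt
    have hlim2 : Filter.Tendsto (fun n => φ (g n ^ m n)) Filter.atTop (𝓝 (φ (γ t))) := by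
      refine (tendsto_iff_of_dist ?_).1 hlim1
      exact squeeze_zero' (Filter.Eventually.of_forall fun n => dist_nonneg)
        (hev.mono fun n h => h.2) hb0
    have hlim3 : Filter.Tendsto (fun n => g n ^ m n) Filter.atTop (𝓝 (γ t)) := by
      have h := (φ.continuousAt_symm (φ.map_source hts)).tendsto.comp hlim2
      rw [φ.left_inv hts] at h
      refine h.congr' ?_
      filter_upwards [hev] with n hn
      exact φ.left_inv hn.1.1
    exact hH.mem_of_tendsto hlim3 (Filter.Eventually.of_forall fun n => H.pow_mem (hg n) _)
  have hpos : ∀ t, 0 ≤ t → γ t ∈ H := by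
    intro t ht
    obtain ⟨k, hk⟩ := exists_nat_gt (t / T)
    have hk0 : (0 : ℝ) < k := (div_nonneg ht hT.le).trans_lt hk
    have h := hshort (t / k) (div_nonneg ht hk0.le)
      ((div_le_iff₀ hk0).2 (by have := (div_lt_iff₀ hT).1 hk; linarith))
    have h2 := H.pow_mem h k
    rw [hγ, ← oneParam_nsmul] at h2
    rwa [mul_div_cancel₀ _ hk0.ne'] at h2
  intro t
  rcases le_total 0 t with ht | ht
  · exact hpos t ht
  · have h := H.inv_mem (hpos (-t) (by linarith))
    rw [hγ, ← oneParam_neg, neg_neg] at h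
    exact h

end ClosedSubgroup

/-! ### Coordinates adapted to a subgroup -/

section InverseFunction

/-- The inverse function theorem, with the inverse smooth on the whole target. -/
theorem exists_smooth_openPartialHomeomorph {C E : Type*} [NormedAddCommGroup C] [NormedSpace ℝ C]
    [CompleteSpace C] [NormedAddCommGroup E] [NormedSpace ℝ E] {F : C → E} {Ω : Set C}
    (hΩ : IsOpen Ω) (hF : ContDiffOn ℝ ∞ F Ω) {c : C} (hc : c ∈ Ω) {A : C ≃L[ℝ] E}
    (hA : HasFDerivAt F (A : C →L[ℝ] E) c) :
    ∃ Φ : OpenPartialHomeomorph C E, (Φ : C → E) = F ∧ c ∈ Φ.source ∧ Φ.source ⊆ Ω ∧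
      ContDiffOn ℝ ∞ Φ.symm Φ.target := by
  have hFc : ContDiffAt ℝ ∞ F c := hF.contDiffAt (hΩ.mem_nhds hc)
  let Φ₀ := hFc.toOpenPartialHomeomorph F hA (by simp)
  let U : Set (C →L[ℝ] E) := Set.range ((↑) : (C ≃L[ℝ] E) → C →L[ℝ] E)
  have hU : IsOpen (Ω ∩ fderiv ℝ F ⁻¹' U) :=
    (hF.continuousOn_fderiv_of_isOpen hΩ (by simp)).isOpen_inter_preimage hΩ
      ContinuousLinearEquiv.isOpen
  refine ⟨Φ₀.restrOpen _ hU, rfl, ⟨?_, hc, ?_⟩, fun q hq => ?_, fun y hy => ?_⟩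
  · exact hFc.mem_toOpenPartialHomeomorph_source hA (by simp)
  · exact ⟨A, hA.fderiv.symm⟩
  · exact hq.2.1
  · have hq := (Φ₀.restrOpen _ hU).map_target hy
    have hq2 : (Φ₀.restrOpen _ hU).symm y ∈ Ω ∩ fderiv ℝ F ⁻¹' U := hq.2
    obtain ⟨A', hA'⟩ := hq2.2
    have hcd : ContDiffAt ℝ ∞ F ((Φ₀.restrOpen _ hU).symm y) :=
      hF.contDiffAt (hΩ.mem_nhds hq2.1)
    refine ((Φ₀.restrOpen _ hU).contDiffAt_symm (f₀' := A') hy ?_ hcd).contDiffWithinAt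
    rw [hA']
    exact (hcd.differentiableAt (by simp)).hasFDerivAt

end InverseFunction

section Slice

variable {E : Type*} [NormedAddCommGroup E] [NormedSpace ℝ E]
  {G : Type*} [TopologicalSpace G] [ChartedSpace E G] [Group G] [LieGroup 𝓘(ℝ, E) ∞ G]

/-- In the chart at the identity, the derivative of a product of two maps with value `1` is the sum
of the derivatives. -/
theorem hasFDerivAt_chart_mul {C : Type*} [NormedAddCommGroup C] [NormedSpace ℝ C]
    {A B : C → G} {c : C} (hA1 : A c = 1) (hB1 : B c = 1) (hAc : ContinuousAt A c)
    (hBc : ContinuousAt B c) {A' B' : C →L[ℝ] E}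
    (hA : HasFDerivAt (fun x => chartAt E (1 : G) (A x)) A' c)
    (hB : HasFDerivAt (fun x => chartAt E (1 : G) (B x)) B' c) :
    HasFDerivAt (fun x => chartAt E (1 : G) (A x * B x)) (A' + B') c := by
  set φ := chartAt E (1 : G) with hφ
  set p := φ 1 with hp
  have hpt : p ∈ φ.target := mem_chart_target E 1
  have hps : φ.symm p = 1 := φ.left_inv (mem_chart_source E 1)
  have hd : DifferentiableAt ℝ (fun q : E × E => chartMul (1 : G) q.1 q.2) (p, p) :=
    (contDiffAt_chartMul hpt).differentiableAt (by simp)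
  obtain ⟨L, hL⟩ : ∃ L, HasFDerivAt (fun q : E × E => chartMul (1 : G) q.1 q.2) L (p, p) :=
    ⟨_, hd.hasFDerivAt⟩
  have hL1 : L ∘L ContinuousLinearMap.inl ℝ E E = ContinuousLinearMap.id ℝ E := by
    have h1 := HasFDerivAt.comp (f := fun y => (y, p)) p hL (hasFDerivAt_prodMk_left p p)
    have h2 : HasFDerivAt (fun y => chartMul (1 : G) y p) (ContinuousLinearMap.id ℝ E) p := by
      refine (hasFDerivAt_id p).congr_of_eventuallyEq ?_
      filter_upwards [φ.open_target.mem_nhds hpt] with y hy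
      exact chartMul_base hy
    exact h1.unique h2
  have hL2 : L ∘L ContinuousLinearMap.inr ℝ E E = ContinuousLinearMap.id ℝ E := by
    have h1 := HasFDerivAt.comp (f := fun y => (p, y)) p hL (hasFDerivAt_prodMk_right p p)
    have h2 : HasFDerivAt (fun y => chartMul (1 : G) p y) (ContinuousLinearMap.id ℝ E) p := by
      rw [← chartField_one (G := G)]
      exact (differentiableAt_chartMul hpt).hasFDerivAt
    exact h1.unique h2
  have hL3 : L ∘L A'.prod B' = A' + B' := by
    ext v
    have h1 := congrArg (fun T : E →L[ℝ] E => T (A' v)) hL1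
    have h2 := congrArg (fun T : E →L[ℝ] E => T (B' v)) hL2
    have e : (A' v, B' v) = ((A' v, 0) : E × E) + (0, B' v) := by simp
    simp only [ContinuousLinearMap.comp_apply, ContinuousLinearMap.inl_apply,
      ContinuousLinearMap.inr_apply, ContinuousLinearMap.id_apply] at h1 h2
    simp only [ContinuousLinearMap.comp_apply, ContinuousLinearMap.prod_apply,
      add_apply]
    rw [e, map_add, h1, h2]
  rw [← hL3]
  have hAB : HasFDerivAt (fun x => (φ (A x), φ (B x))) (A'.prod B') c := hA.prodMk hB
  have hL' : HasFDerivAt (fun q : E × E => chartMul (1 : G) q.1 q.2) L (φ (A c), φ (B c)) := by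
    rwa [hA1, hB1]
  refine (hL'.comp c hAB).congr_of_eventuallyEq ?_
  have hsA : ∀ᶠ x in 𝓝 c, A x ∈ φ.source := hAc.preimage_mem_nhds
    (by rw [hA1]; exact φ.open_source.mem_nhds (mem_chart_source E 1))
  have hsB : ∀ᶠ x in 𝓝 c, B x ∈ φ.source := hBc.preimage_mem_nhds
    (by rw [hB1]; exact φ.open_source.mem_nhds (mem_chart_source E 1))
  filter_upwards [hsA, hsB] with x hx hx'
  simp only [Function.comp, chartMul]
  rw [φ.left_inv hx, φ.left_inv hx']

variable (G) in
/-- The slice through the identity in the directions `v i`: `x ↦ φ⁻¹ (φ 1 + ∑ i, x i • v i)`, where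
`φ` is the chart at the identity. -/
def sliceMap {r : ℕ} (v : Fin r → E) (x : Fin r → ℝ) : G :=
  (chartAt E (1 : G)).symm (chartAt E (1 : G) 1 + Fintype.linearCombination ℝ v x)

theorem sliceMap_zero {r : ℕ} (v : Fin r → E) : sliceMap G v 0 = 1 := by
  rw [sliceMap, map_zero, add_zero]
  exact (chartAt E (1 : G)).left_inv (mem_chart_source E 1)

theorem contDiff_add_linearCombination {r : ℕ} (v : Fin r → E) (p : E) :
    ContDiff ℝ ∞ (fun x : Fin r → ℝ => p + Fintype.linearCombination ℝ v x) :=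
  contDiff_const.add (LinearMap.toContinuousLinearMap (Fintype.linearCombination ℝ v)).contDiff

theorem contMDiffAt_sliceMap {r : ℕ} (v : Fin r → E) {x : Fin r → ℝ}
    (hx : chartAt E (1 : G) 1 + Fintype.linearCombination ℝ v x ∈ (chartAt E (1 : G)).target) :
    ContMDiffAt 𝓘(ℝ, Fin r → ℝ) 𝓘(ℝ, E) ∞ (sliceMap G v) x :=
  ContMDiffAt.comp x ((contMDiffOn_chart_symm (I := 𝓘(ℝ, E)) (n := ∞) (x := (1 : G))).contMDiffAt
    ((chartAt E (1 : G)).open_target.mem_nhds hx))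
    (contDiff_add_linearCombination v _).contMDiff.contMDiffAt

variable [FiniteDimensional ℝ E] [T2Space G]

variable (G) in
/-- The product of the one-parameter subgroups `exp (y j • w j)`, in the order of the list `l`. -/
def expProd {d : ℕ} (w : Fin d → E) (l : List (Fin d)) (y : Fin d → ℝ) : G :=
  (l.map fun j => oneParam G (w j) (y j)).prod

theorem expProd_zero {d : ℕ} (w : Fin d → E) (l : List (Fin d)) : expProd G w l 0 = 1 := by
  induction l with
  | nil => rfl
  | cons j l ih =>
    rw [expProd, List.map_cons, List.prod_cons, Pi.zero_apply, oneParam_zero, one_mul]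
    exact ih

theorem contMDiff_expProd {d : ℕ} (w : Fin d → E) (l : List (Fin d)) :
    ContMDiff 𝓘(ℝ, Fin d → ℝ) 𝓘(ℝ, E) ∞ (expProd G w l) := by
  induction l with
  | nil => exact contMDiff_const
  | cons j l ih =>
    exact ((contMDiff_oneParam (w j)).comp (contDiff_apply ℝ ℝ j).contMDiff).mul ih

theorem hasFDerivAt_chart_expProd {d : ℕ} (w : Fin d → E) (l : List (Fin d)) :
    HasFDerivAt (fun y => chartAt E (1 : G) (expProd G w l y))
      ((l.map fun j => (ContinuousLinearMap.proj (R := ℝ) (φ := fun _ : Fin d => ℝ) j).smulRight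
        (w j)).sum) 0 := by
  induction l with
  | nil => exact hasFDerivAt_const (chartAt E (1 : G) 1) (0 : Fin d → ℝ)
  | cons j l ih =>
    rw [List.map_cons, List.sum_cons]
    refine hasFDerivAt_chart_mul (A := fun y : Fin d → ℝ => oneParam G (w j) (y j))
      (oneParam_zero _) (expProd_zero w l)
      ((continuous_oneParam _).comp (continuous_apply j)).continuousAt
      (contMDiff_expProd w l).continuous.continuousAt ?_ ih
    have h := (hasDerivAt_chart_oneParam_zero (G := G) (w j)).hasFDerivAt
    have h2 : HasFDerivAt (fun y : Fin d → ℝ => y j)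
      (ContinuousLinearMap.proj (R := ℝ) (φ := fun _ : Fin d => ℝ) j) 0 := hasFDerivAt_apply j 0
    refine (HasFDerivAt.comp (g := fun s => chartAt E (1 : G) (oneParam G (w j) s))
      (0 : Fin d → ℝ) h h2).congr_fderiv ?_
    ext y
    simp

theorem expProd_mem {H : Subgroup G} {d : ℕ} {w : Fin d → E} (hw : ∀ j, w j ∈ lieVec E H)
    (l : List (Fin d)) (y : Fin d → ℝ) : expProd G w l y ∈ H := by
  refine H.list_prod_mem fun g hg => ?_
  obtain ⟨j, -, rfl⟩ := List.mem_map.1 hg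
  exact hw j (y j)

/-- Let the `v i` and `w j` together form a basis. Then `(x, y) ↦ σ x * τ y`, with `σ` the slice in
the directions `v i` and `τ` the product of the one-parameter groups of the `w j`, is a local
diffeomorphism at the origin. -/
theorem exists_slice_coordinates {r d : ℕ} (e : Module.Basis (Fin r ⊕ Fin d) ℝ E) :
    ∃ Φ : OpenPartialHomeomorph ((Fin r → ℝ) × (Fin d → ℝ)) E,
      (∀ q, Φ q = chartAt E (1 : G) (sliceMap G (e ∘ Sum.inl) q.1 *
        expProd G (e ∘ Sum.inr) (List.finRange d) q.2)) ∧ 0 ∈ Φ.source ∧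
      (∀ q ∈ Φ.source, chartAt E (1 : G) 1 + Fintype.linearCombination ℝ (e ∘ Sum.inl) q.1 ∈
          (chartAt E (1 : G)).target ∧ sliceMap G (e ∘ Sum.inl) q.1 *
          expProd G (e ∘ Sum.inr) (List.finRange d) q.2 ∈ (chartAt E (1 : G)).source) ∧
      ContDiffOn ℝ ∞ Φ.symm Φ.target := by
  set φ := chartAt E (1 : G) with hφ
  set v := e ∘ Sum.inl with hv
  set w := e ∘ Sum.inr with hw
  have hpt : φ 1 ∈ φ.target := mem_chart_target E 1
  let C := (Fin r → ℝ) × (Fin d → ℝ)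
  let Ψ : C → G := fun q => sliceMap G v q.1 * expProd G w (List.finRange d) q.2
  let Ω₀ : Set C := {q | φ 1 + Fintype.linearCombination ℝ v q.1 ∈ φ.target}
  have hΩ₀ : IsOpen Ω₀ := φ.open_target.preimage
    ((contDiff_add_linearCombination v _).continuous.comp continuous_fst)
  have hΨ : ∀ q ∈ Ω₀, ContMDiffAt 𝓘(ℝ, C) 𝓘(ℝ, E) ∞ Ψ q := fun q hq =>
    (ContMDiffAt.comp (f := Prod.fst) q (contMDiffAt_sliceMap v hq)
      contDiff_fst.contMDiff.contMDiffAt).mul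
      (ContMDiffAt.comp (f := Prod.snd) q (contMDiff_expProd w _).contMDiffAt
        contDiff_snd.contMDiff.contMDiffAt)
  have hΩ : IsOpen (Ω₀ ∩ Ψ ⁻¹' φ.source) :=
    ContinuousOn.isOpen_inter_preimage
      (fun q hq => (hΨ q hq).continuousAt.continuousWithinAt) hΩ₀ φ.open_source
  have hF : ContDiffOn ℝ ∞ (φ ∘ Ψ) (Ω₀ ∩ Ψ ⁻¹' φ.source) := fun q hq =>
    (ContMDiffAt.comp q ((contMDiffOn_chart (I := 𝓘(ℝ, E)) (n := ∞) (x := (1 : G))).contMDiffAt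
      (φ.open_source.mem_nhds hq.2)) (hΨ q hq.1)).contDiffAt.contDiffWithinAt
  have h0 : (0 : C) ∈ Ω₀ ∩ Ψ ⁻¹' φ.source := by
    constructor
    · change φ 1 + Fintype.linearCombination ℝ v 0 ∈ φ.target
      rwa [map_zero, add_zero]
    · change sliceMap G v 0 * expProd G w _ 0 ∈ φ.source
      rw [sliceMap_zero, expProd_zero, one_mul]
      exact mem_chart_source E 1
  -- the derivative at the origin is the coordinate isomorphism of the basis
  let A : C ≃L[ℝ] E := ((LinearEquiv.sumArrowLequivProdArrow (Fin r) (Fin d) ℝ ℝ).symm.trans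
    e.equivFun.symm).toContinuousLinearEquiv
  have hA : ∀ q : C, A q = ∑ i, q.1 i • v i + ∑ j, q.2 j • w j := by
    intro q
    change e.equivFun.symm ((LinearEquiv.sumArrowLequivProdArrow (Fin r) (Fin d) ℝ ℝ).symm q) = _
    rw [Module.Basis.equivFun_symm_apply, Fintype.sum_sum_type]
    rfl
  have hAd : HasFDerivAt (φ ∘ Ψ) (A : C →L[ℝ] E) 0 := by
    have h1 : HasFDerivAt (fun q : C => φ (sliceMap G v q.1))
        ((LinearMap.toContinuousLinearMap (Fintype.linearCombination ℝ v)) ∘L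
          ContinuousLinearMap.fst ℝ (Fin r → ℝ) (Fin d → ℝ)) 0 := by
      have h2 : HasFDerivAt (fun q : C => φ 1 + Fintype.linearCombination ℝ v q.1)
          ((LinearMap.toContinuousLinearMap (Fintype.linearCombination ℝ v)) ∘L
            ContinuousLinearMap.fst ℝ (Fin r → ℝ) (Fin d → ℝ)) 0 :=
        ((LinearMap.toContinuousLinearMap (Fintype.linearCombination ℝ v)) ∘L
          ContinuousLinearMap.fst ℝ (Fin r → ℝ) (Fin d → ℝ)).hasFDerivAt.const_add (φ 1)
      refine h2.congr_of_eventuallyEq ?_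
      filter_upwards [hΩ₀.mem_nhds h0.1] with q hq
      exact φ.right_inv hq
    have h2 := HasFDerivAt.comp (f := Prod.snd)
      (0 : C) (hasFDerivAt_chart_expProd (G := G) w (List.finRange d)) hasFDerivAt_snd
    have hσc : ContinuousAt (fun q : C => sliceMap G v q.1) 0 :=
      ContinuousAt.comp (f := Prod.fst) (x := (0 : C))
        (contMDiffAt_sliceMap v h0.1).continuousAt continuous_fst.continuousAt
    have hτc : ContinuousAt (fun q : C => expProd G w (List.finRange d) q.2) 0 :=
      ((contMDiff_expProd w _).continuous.comp continuous_snd).continuousAt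
    refine (hasFDerivAt_chart_mul (A := fun q : C => sliceMap G v q.1)
      (B := fun q : C => expProd G w (List.finRange d) q.2) (sliceMap_zero v)
      (expProd_zero w _) hσc hτc h1 h2).congr_fderiv ?_
    refine ContinuousLinearMap.ext fun q => ?_
    refine Eq.trans ?_ (hA q).symm
    have h3 : (List.map (fun j => (ContinuousLinearMap.proj (R := ℝ) (φ := fun _ : Fin d => ℝ)
        j).smulRight (w j)) (List.finRange d)).sum = ∑ j, (ContinuousLinearMap.proj (R := ℝ)
        (φ := fun _ : Fin d => ℝ) j).smulRight (w j) := by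
      rw [← List.ofFn_eq_map, List.sum_ofFn]
    rw [h3]
    simp [Fintype.linearCombination_apply]
    rfl
  obtain ⟨Φ, hΦ, h0Φ, hsub, hsm⟩ := exists_smooth_openPartialHomeomorph hΩ hF h0 hAd
  exact ⟨Φ, fun q => by rw [hΦ]; rfl, h0Φ, fun q hq => hsub hq, hsm⟩

end Slice

/-! ### Equivariant functions with prescribed values on a slice -/

section Transversality

variable {E : Type*} [NormedAddCommGroup E] [NormedSpace ℝ E] [FiniteDimensional ℝ E]
  {G : Type*} [TopologicalSpace G] [T2Space G] [ChartedSpace E G] [Group G]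
  [LieGroup 𝓘(ℝ, E) ∞ G] {H : Subgroup G} {r d : ℕ}

/-- A slice transversal to the Lie algebra of a closed subgroup meets the subgroup near the identity
only in the identity: otherwise the points of intersection would have a limiting direction, which
would be a vector of the Lie algebra tangent to the slice. -/
theorem eventually_sliceMap_mem_imp_eq_zero (hH : IsClosed (H : Set G)) {v : Fin r → E}
    (hv : ∀ x : Fin r → ℝ, Fintype.linearCombination ℝ v x ∈ lieVec E H → x = 0) :
    ∀ᶠ x in 𝓝 (0 : Fin r → ℝ), sliceMap G v x ∈ H → x = 0 := by
  by_contra hcon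
  have hfreq : ∃ᶠ x in 𝓝 (0 : Fin r → ℝ), sliceMap G v x ∈ H ∧ x ≠ 0 :=
    (Filter.not_eventually.1 hcon).mono fun x hx => by
      rwa [Classical.not_imp] at hx
  obtain ⟨x, hx0, hx⟩ := Filter.exists_seq_forall_of_frequently hfreq
  have hsph : ∀ n, ‖x n‖⁻¹ • x n ∈ Metric.sphere (0 : Fin r → ℝ) 1 := fun n => by
    rw [mem_sphere_zero_iff_norm, norm_smul, norm_inv, norm_norm,
      inv_mul_cancel₀ (norm_ne_zero_iff.2 (hx n).2)]
  obtain ⟨u, hu, s, hs, hlim⟩ := (isCompact_sphere (0 : Fin r → ℝ) 1).tendsto_subseq hsph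
  have hxs : Filter.Tendsto (x ∘ s) Filter.atTop (𝓝 0) := hx0.comp hs.tendsto_atTop
  have hpt : chartAt E (1 : G) 1 + Fintype.linearCombination ℝ v (0 : Fin r → ℝ) ∈
      (chartAt E (1 : G)).target := by
    rw [map_zero, add_zero]
    exact mem_chart_target E 1
  have hg1 : Filter.Tendsto (fun n => sliceMap G v (x (s n))) Filter.atTop (𝓝 1) := by
    have h := (contMDiffAt_sliceMap v hpt).continuousAt.tendsto.comp hxs
    rwa [sliceMap_zero] at h
  have hmem : Fintype.linearCombination ℝ v u ∈ lieVec E H := by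
    refine mem_lieVec_of_tendsto hH (fun n => (hx (s n)).1) hg1 (ε := fun n => ‖x (s n)‖)
      (fun n => norm_pos_iff.2 (hx (s n)).2) (by simpa using hxs.norm) ?_
    have h1 := ((LinearMap.toContinuousLinearMap
      (Fintype.linearCombination ℝ v)).continuous.tendsto u).comp hlim
    refine h1.congr' ?_
    have hev := hxs.eventually ((contDiff_add_linearCombination v
      (chartAt E (1 : G) 1)).continuous.continuousAt.preimage_mem_nhds
        ((chartAt E (1 : G)).open_target.mem_nhds hpt))
    filter_upwards [hev] with n hn
    have hn' : chartAt E (1 : G) 1 + Fintype.linearCombination ℝ v (x (s n)) ∈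
      (chartAt E (1 : G)).target := hn
    rw [sliceMap, (chartAt E (1 : G)).right_inv hn', add_sub_cancel_left]
    exact map_smul (Fintype.linearCombination ℝ v) _ _
  have hu0 := hv u hmem
  rw [mem_sphere_zero_iff_norm, hu0, norm_zero] at hu
  exact zero_ne_one hu

/-- A basis of the model space adapted to `H`: the first vectors span a complement of the Lie algebra
of `H`, the others belong to it. -/
structure IsAdaptedBasis (H : Subgroup G) (e : Module.Basis (Fin r ⊕ Fin d) ℝ E) : Prop where
  inr_mem : ∀ j, e (Sum.inr j) ∈ lieVec E H
  repr_inl : ∀ X ∈ lieVec E H, ∀ i, e.repr X (Sum.inl i) = 0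

theorem IsAdaptedBasis.eq_zero {e : Module.Basis (Fin r ⊕ Fin d) ℝ E} (he : IsAdaptedBasis H e)
    (x : Fin r → ℝ) (hx : Fintype.linearCombination ℝ (e ∘ Sum.inl) x ∈ lieVec E H) : x = 0 := by
  funext i
  have h := he.repr_inl _ hx i
  simpa [Fintype.linearCombination_apply, map_sum, Finsupp.single_apply] using h

/-- Different points of a small transversal slice lie in different cosets of `H`. -/
theorem eventually_slice_injective (hH : IsClosed (H : Set G))
    {e : Module.Basis (Fin r ⊕ Fin d) ℝ E} (he : IsAdaptedBasis H e) :
    ∀ᶠ q in 𝓝 (0 : (Fin r → ℝ) × (Fin r → ℝ)), ∀ h ∈ H,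
      sliceMap G (e ∘ Sum.inl) q.1 = sliceMap G (e ∘ Sum.inl) q.2 * h → q.1 = q.2 := by
  obtain ⟨Φ, hΦ, h0, hΦs, hΦsm⟩ := exists_slice_coordinates (G := G) e
  have : IsTopologicalGroup G := topologicalGroup_of_lieGroup 𝓘(ℝ, E) ∞
  set σ := sliceMap G (e ∘ Sum.inl) with hσ
  set τ := expProd G (e ∘ Sum.inr) (List.finRange d) with hτ
  set φ := chartAt E (1 : G) with hφ
  have hτH : ∀ y, τ y ∈ H := expProd_mem he.inr_mem _
  have hΦ0 : Φ 0 = φ 1 := by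
    rw [hΦ, hσ, hτ, Prod.fst_zero, Prod.snd_zero, sliceMap_zero, expProd_zero, one_mul]
  have hσ0 : ContinuousAt σ 0 := (contMDiffAt_sliceMap _ (hΦs 0 h0).1).continuousAt
  let P : (Fin r → ℝ) × (Fin r → ℝ) → G := fun q => (σ q.2)⁻¹ * σ q.1
  have hP0 : P 0 = 1 := inv_mul_cancel _
  have hP : ContinuousAt P 0 :=
    (ContinuousAt.comp (f := Prod.snd) (x := (0 : (Fin r → ℝ) × (Fin r → ℝ))) hσ0
      continuous_snd.continuousAt).inv.mul
    (ContinuousAt.comp (f := Prod.fst) (x := (0 : (Fin r → ℝ) × (Fin r → ℝ))) hσ0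
      continuous_fst.continuousAt)
  have hφP : ContinuousAt (fun q => φ (P q)) 0 :=
    ContinuousAt.comp (by rw [hP0]; exact φ.continuousAt (mem_chart_source E 1)) hP
  have ht0 : φ (P 0) ∈ Φ.target := by
    rw [hP0, ← hΦ0]
    exact Φ.map_source h0
  have hR : ContinuousAt (fun q => Φ.symm (φ (P q))) 0 :=
    ContinuousAt.comp (g := Φ.symm) (Φ.continuousAt_symm ht0) hφP
  have hR0 : Φ.symm (φ (P 0)) = 0 := by rw [hP0, ← hΦ0, Φ.left_inv h0]
  have hRt : Filter.Tendsto (fun q => Φ.symm (φ (P q))) (𝓝 0) (𝓝 0) := by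
    have h := hR.tendsto
    rwa [hR0] at h
  have hfst : Filter.Tendsto Prod.fst (𝓝 (0 : (Fin r → ℝ) × (Fin r → ℝ))) (𝓝 0) :=
    continuous_fst.tendsto _
  have hsnd : Filter.Tendsto Prod.snd (𝓝 (0 : (Fin r → ℝ) × (Fin r → ℝ))) (𝓝 0) :=
    continuous_snd.tendsto _
  have hsrc : Φ.source ∈ 𝓝 ((0 : Fin r → ℝ), (0 : Fin d → ℝ)) := Φ.open_source.mem_nhds h0
  have hA : ∀ᶠ q in 𝓝 (0 : (Fin r → ℝ) × (Fin r → ℝ)), (q.1, (0 : Fin d → ℝ)) ∈ Φ.source :=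
    (hfst.prodMk_nhds tendsto_const_nhds) hsrc
  have hB : ∀ᶠ q in 𝓝 (0 : (Fin r → ℝ) × (Fin r → ℝ)),
      (q.2, (Φ.symm (φ (P q))).2) ∈ Φ.source :=
    (hsnd.prodMk_nhds ((continuous_snd.tendsto (0 : (Fin r → ℝ) × (Fin d → ℝ))).comp hRt)) hsrc
  have hC : ∀ᶠ q in 𝓝 (0 : (Fin r → ℝ) × (Fin r → ℝ)),
      σ (Φ.symm (φ (P q))).1 ∈ H → (Φ.symm (φ (P q))).1 = 0 :=
    ((continuous_fst.tendsto (0 : (Fin r → ℝ) × (Fin d → ℝ))).comp hRt).eventually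
      (eventually_sliceMap_mem_imp_eq_zero hH he.eq_zero)
  filter_upwards [hA, hB, hC, hφP.preimage_mem_nhds (Φ.open_target.mem_nhds ht0),
    hP.preimage_mem_nhds (by rw [hP0]; exact φ.open_source.mem_nhds (mem_chart_source E 1))]
    with q hqA hqB hqC hqt hqs h hh heq
  have hPh : P q = h := by
    change (σ q.2)⁻¹ * σ q.1 = h
    rw [heq, inv_mul_cancel_left]
  set z := Φ.symm (φ (P q)) with hz
  have hzs : z ∈ Φ.source := Φ.map_target hqt
  -- in the coordinates the element `h` of `H` is `σ z.1 * τ z.2`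
  have hzP : σ z.1 * τ z.2 = P q := by
    have h1 : φ (σ z.1 * τ z.2) = φ (P q) := by rw [← hΦ, hz, Φ.right_inv hqt]
    exact φ.injOn (hΦs z hzs).2 hqs h1
  have hσH : σ z.1 ∈ H := by
    have h1 : σ z.1 = P q * (τ z.2)⁻¹ := by rw [← hzP, mul_inv_cancel_right]
    rw [h1, hPh]
    exact H.mul_mem hh (H.inv_mem (hτH _))
  have hz1 := hqC hσH
  have hPτ : h = τ z.2 := by
    rw [← hPh, ← hzP, hz1, hσ, sliceMap_zero, one_mul]
  have h2 : Φ (q.1, 0) = Φ (q.2, z.2) := by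
    rw [hΦ, hΦ]
    change φ (σ q.1 * τ 0) = φ (σ q.2 * τ z.2)
    rw [← hPτ, ← heq, hτ, expProd_zero, mul_one]
  exact congrArg Prod.fst (Φ.injOn hqA hqB h2)

open scoped Pointwise in
/-- Every smooth function `ψ` supported in a small ball is the restriction to the slice of a smooth
function `f` with `f (g * h) = f g * χ h⁻¹`, namely of the function given by
`f (σ x * h) = ψ x * χ h⁻¹` and by zero away from the cosets that meet the slice. -/
theorem exists_equivariantFun_extension (hH : IsClosed (H : Set G))
    {e : Module.Basis (Fin r ⊕ Fin d) ℝ E} (he : IsAdaptedBasis H e) :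
    ∃ ρ > 0, ∀ (χ : H →ₜ* ℂˣ) (ψ : (Fin r → ℝ) → ℂ), ContDiff ℝ ∞ ψ →
      (∀ x, ρ ≤ ‖x‖ → ψ x = 0) →
      ∃ f ∈ equivariantFun E χ, ∀ x, ‖x‖ < ρ → f (sliceMap G (e ∘ Sum.inl) x) = ψ x := by
  obtain ⟨Φ, hΦ, h0, hΦs, hΦsm⟩ := exists_slice_coordinates (G := G) e
  have : IsTopologicalGroup G := topologicalGroup_of_lieGroup 𝓘(ℝ, E) ∞
  have hinj := eventually_slice_injective hH he
  set σ := sliceMap G (e ∘ Sum.inl) with hσ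
  set τ := expProd G (e ∘ Sum.inr) (List.finRange d) with hτ
  set φ := chartAt E (1 : G) with hφ
  have hτH : ∀ y, τ y ∈ H := expProd_mem he.inr_mem _
  obtain ⟨R, hR, hRball⟩ := Metric.mem_nhds_iff.1 hinj
  obtain ⟨R', hR', hRball'⟩ := Metric.mem_nhds_iff.1 (Φ.open_source.mem_nhds h0)
  obtain ⟨ρ₀, hρ₀, hρR, hρR'⟩ : ∃ ρ₀ > 0, ρ₀ ≤ R ∧ ρ₀ ≤ R' :=
    ⟨min R R', lt_min hR hR', min_le_left _ _, min_le_right _ _⟩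
  have hinj' : ∀ x x' : Fin r → ℝ, ‖x‖ < ρ₀ → ‖x'‖ < ρ₀ → ∀ h ∈ H, σ x = σ x' * h → x = x' := by
    intro x x' hx hx' h hh heq
    have hmem : (x, x') ∈ Metric.ball (0 : (Fin r → ℝ) × (Fin r → ℝ)) R := by
      rw [mem_ball_zero_iff, Prod.norm_def]
      exact max_lt (hx.trans_le hρR) (hx'.trans_le hρR)
    exact hRball hmem h hh heq
  have hsrc : ∀ (x : Fin r → ℝ) (y : Fin d → ℝ), ‖x‖ < ρ₀ → ‖y‖ < ρ₀ → (x, y) ∈ Φ.source := by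
    intro x y hx hy
    refine hRball' ?_
    rw [mem_ball_zero_iff, Prod.norm_def]
    exact max_lt (hx.trans_le hρR') (hy.trans_le hρR')
  -- half the radius, so that the support of `ψ` lies in a compact ball on which all this applies
  refine ⟨ρ₀ / 2, by linarith, fun χ ψ hψ hψ0 => ?_⟩
  classical
  let Q : G → Prop := fun g => ∃ q : (Fin r → ℝ) × H, ‖q.1‖ < ρ₀ ∧ g = σ q.1 * q.2
  let f : G → ℂ := fun g =>
    if hg : Q g then ψ hg.choose.1 * ((χ hg.choose.2⁻¹ : ℂˣ) : ℂ) else 0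
  have hval : ∀ (x : Fin r → ℝ) (h : H), ‖x‖ < ρ₀ →
      f (σ x * h) = ψ x * ((χ h⁻¹ : ℂˣ) : ℂ) := by
    intro x h hx
    have hg : Q (σ x * h) := ⟨(x, h), hx, rfl⟩
    have hc := hg.choose_spec
    have h1 : hg.choose.1 = x := by
      refine hinj' _ _ hc.1 hx (h * (hg.choose.2 : G)⁻¹)
        (H.mul_mem h.2 (H.inv_mem hg.choose.2.2)) ?_
      rw [← mul_assoc]
      exact eq_mul_inv_of_mul_eq hc.2.symm
    have h2 : hg.choose.2 = h := by
      have h3 := hc.2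
      rw [h1] at h3
      exact Subtype.ext (mul_left_cancel h3).symm
    change (if hg : Q (σ x * h) then _ else _) = _
    rw [dif_pos hg, h1, h2]
  have hzero : ∀ g, ¬ Q g → f g = 0 := fun g hg => dif_neg hg
  have hequiv : ∀ (g : G) (h : H), f (g * h) = f g * ((χ h⁻¹ : ℂˣ) : ℂ) := by
    intro g h
    by_cases hg : Q g
    · obtain ⟨⟨x, k⟩, hx, rfl⟩ := hg
      have h1 := hval x (k * h) hx
      rw [Subgroup.coe_mul, ← mul_assoc] at h1
      rw [h1, hval x k hx, mul_inv_rev, map_mul, Units.val_mul]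
      ring
    · have hg' : ¬ Q (g * h) := by
        rintro ⟨⟨x, k⟩, hx, hgk⟩
        refine hg ⟨(x, k * h⁻¹), hx, ?_⟩
        rw [Subgroup.coe_mul, Subgroup.coe_inv, ← mul_assoc, ← hgk, mul_inv_cancel_right]
      rw [hzero _ hg, hzero _ hg', zero_mul]
  -- the character along the product of one-parameter subgroups
  let κ : (Fin d → ℝ) → ℂ := fun y => ∏ j, charCurve χ (he.inr_mem j) (-(y j))
  have hκ : ContDiff ℝ ∞ κ := contDiff_prod fun j _ =>
    (contDiff_charCurve χ (he.inr_mem j)).comp (contDiff_apply ℝ ℝ j).neg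
  have hκτ : ∀ y, ((χ (⟨τ y, hτH y⟩ : H)⁻¹ : ℂˣ) : ℂ) = κ y := by
    intro y
    have h1 : ∀ l : List (Fin d), (⟨expProd G (e ∘ Sum.inr) l y, expProd_mem he.inr_mem l y⟩ : H) =
        (l.map fun j => (⟨oneParam G (e (Sum.inr j)) (y j), he.inr_mem j _⟩ : H)).prod := by
      intro l
      induction l with
      | nil => rfl
      | cons j l ih =>
        rw [List.map_cons, List.prod_cons, ← ih]
        rfl
    have h2 : ∀ j, ((χ (⟨oneParam G (e (Sum.inr j)) (y j), he.inr_mem j _⟩ : H)⁻¹ : ℂˣ) : ℂ) =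
        charCurve χ (he.inr_mem j) (-(y j)) := fun j => by
      have h3 : (⟨oneParam G (e (Sum.inr j)) (y j), he.inr_mem j _⟩ : H)⁻¹ =
          ⟨oneParam G (e (Sum.inr j)) (-(y j)), he.inr_mem j _⟩ :=
        Subtype.ext (oneParam_neg _ _).symm
      rw [charCurve, h3]
    have h4 := h1 (List.finRange d)
    rw [← List.ofFn_eq_map] at h4
    have h5 : χ (⟨τ y, hτH y⟩ : H)⁻¹ =
        ∏ j, χ (⟨oneParam G (e (Sum.inr j)) (y j), he.inr_mem j _⟩ : H)⁻¹ := by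
      rw [map_inv]
      have h6 : χ (⟨τ y, hτH y⟩ : H) =
          ∏ j, χ (⟨oneParam G (e (Sum.inr j)) (y j), he.inr_mem j _⟩ : H) := by
        refine (congrArg χ h4).trans ?_
        rw [map_list_prod, List.map_ofFn, List.prod_ofFn]
        rfl
      rw [h6, ← Finset.prod_inv_distrib]
      simp only [map_inv]
    rw [h5, Units.coe_prod]
    exact Finset.prod_congr rfl fun j _ => h2 j
  have hsmooth : ContMDiff 𝓘(ℝ, E) 𝓘(ℝ, ℂ) ∞ f := by
    intro g
    by_cases hg : Q g
    · obtain ⟨⟨x₀, h₀⟩, hx₀, rfl⟩ := hg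
      -- near this point `f` is `ψ x * κ y * χ h₀⁻¹` in the coordinates `g = σ x * τ y * h₀`
      have hback : ContMDiffAt 𝓘(ℝ, E) 𝓘(ℝ, E) ∞ (fun g : G => g * (h₀ : G)⁻¹) (σ x₀ * h₀) :=
        contMDiff_mul_right.contMDiffAt
      have hb : σ x₀ * h₀ * (h₀ : G)⁻¹ = σ x₀ * τ 0 := by
        rw [mul_inv_cancel_right, hτ, expProd_zero, mul_one]
      have hx0s : (x₀, (0 : Fin d → ℝ)) ∈ Φ.source := hsrc _ _ hx₀ (by rwa [norm_zero])
      have hs : σ x₀ * τ 0 ∈ φ.source := (hΦs _ hx0s).2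
      have hφs : φ (σ x₀ * τ 0) = Φ (x₀, 0) := (hΦ (x₀, 0)).symm
      have hφb : ContMDiffAt 𝓘(ℝ, E) 𝓘(ℝ, E) ∞ (fun g : G => φ (g * (h₀ : G)⁻¹)) (σ x₀ * h₀) := by
        refine ContMDiffAt.comp (g := φ) _ ?_ hback
        rw [hb]
        exact (contMDiffOn_chart (I := 𝓘(ℝ, E)) (n := ∞) (x := (1 : G))).contMDiffAt
          (φ.open_source.mem_nhds hs)
      have hcoord : ContMDiffAt 𝓘(ℝ, E) 𝓘(ℝ, (Fin r → ℝ) × (Fin d → ℝ)) ∞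
          (fun g : G => Φ.symm (φ (g * (h₀ : G)⁻¹))) (σ x₀ * h₀) := by
        refine ContMDiffAt.comp (g := Φ.symm) _ ?_ hφb
        rw [hb, hφs]
        exact (hΦsm.contDiffAt (Φ.open_target.mem_nhds (Φ.map_source hx0s))).contMDiffAt
      have hloc : ContDiff ℝ ∞ (fun q : (Fin r → ℝ) × (Fin d → ℝ) =>
          ψ q.1 * (κ q.2 * ((χ h₀⁻¹ : ℂˣ) : ℂ))) :=
        (hψ.comp contDiff_fst).mul ((hκ.comp contDiff_snd).mul contDiff_const)
      refine (ContMDiffAt.comp (σ x₀ * (h₀ : G)) hloc.contMDiff.contMDiffAt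
        hcoord).congr_of_eventuallyEq ?_
      have hev1 : ∀ᶠ g in 𝓝 (σ x₀ * (h₀ : G)), g * (h₀ : G)⁻¹ ∈ φ.source :=
        hback.continuousAt.preimage_mem_nhds (by rw [hb]; exact φ.open_source.mem_nhds hs)
      have hev2 : ∀ᶠ g in 𝓝 (σ x₀ * (h₀ : G)), φ (g * (h₀ : G)⁻¹) ∈ Φ.target :=
        hφb.continuousAt.preimage_mem_nhds
          (by rw [hb, hφs]; exact Φ.open_target.mem_nhds (Φ.map_source hx0s))
      have hev3 : ∀ᶠ g in 𝓝 (σ x₀ * (h₀ : G)), ‖(Φ.symm (φ (g * (h₀ : G)⁻¹))).1‖ < ρ₀ := by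
        have hc : ContinuousAt (fun g : G => ‖(Φ.symm (φ (g * (h₀ : G)⁻¹))).1‖)
            (σ x₀ * (h₀ : G)) :=
          (continuous_fst.continuousAt.comp hcoord.continuousAt).norm
        refine hc.eventually (gt_mem_nhds ?_)
        change ‖(Φ.symm (φ (σ x₀ * h₀ * (h₀ : G)⁻¹))).1‖ < ρ₀
        rwa [hb, hφs, Φ.left_inv hx0s]
      filter_upwards [hev1, hev2, hev3] with g h1 h2 h3
      set q := Φ.symm (φ (g * (h₀ : G)⁻¹)) with hq
      have hqs : q ∈ Φ.source := Φ.map_target h2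
      have h4 : σ q.1 * τ q.2 = g * (h₀ : G)⁻¹ := by
        refine φ.injOn (hΦs q hqs).2 h1 ?_
        rw [← hΦ, hq, Φ.right_inv h2]
      have h5 : g = σ q.1 * ((⟨τ q.2, hτH q.2⟩ * h₀ : H) : G) := by
        rw [Subgroup.coe_mul, ← mul_assoc, h4, inv_mul_cancel_right]
      change f g = ψ q.1 * (κ q.2 * ((χ h₀⁻¹ : ℂˣ) : ℂ))
      rw [← hκτ]
      conv_lhs => rw [h5]
      rw [hval _ _ h3, mul_inv_rev, map_mul, Units.val_mul]
      ring
    · -- off the cosets meeting the slice, `f` vanishes near `g`: the cosets through the support of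
      -- `ψ` form a closed set, a product of a compact set with `H`
      have hcpt : IsCompact (σ '' Metric.closedBall 0 (ρ₀ / 2)) := by
        refine (isCompact_closedBall _ _).image_of_continuousOn fun x hx => ?_
        have hx' : ‖x‖ < ρ₀ := by
          have := mem_closedBall_zero_iff.1 hx
          linarith
        exact (contMDiffAt_sliceMap _ (hΦs (x, 0) (hsrc _ _ hx'
          (by rwa [norm_zero]))).1).continuousAt.continuousWithinAt
      have hcl : IsClosed ((σ '' Metric.closedBall 0 (ρ₀ / 2)) * (H : Set G)) :=
        hH.mul_left_of_isCompact hcpt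
      have hgn : g ∉ (σ '' Metric.closedBall 0 (ρ₀ / 2)) * (H : Set G) := by
        rintro ⟨_, ⟨x, hx, rfl⟩, h, hh, rfl⟩
        refine hg ⟨(x, ⟨h, hh⟩), ?_, rfl⟩
        have := mem_closedBall_zero_iff.1 hx
        change ‖x‖ < ρ₀
        linarith
      refine (contMDiffAt_const (c := (0 : ℂ))).congr_of_eventuallyEq ?_
      filter_upwards [hcl.isOpen_compl.mem_nhds hgn] with g' hg'
      by_cases hQ : Q g'
      · obtain ⟨⟨x, h⟩, hx, rfl⟩ := hQ
        rw [hval x h hx, hψ0 x, zero_mul]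
        by_contra hlt
        exact hg' ⟨σ x, ⟨x, mem_closedBall_zero_iff.2 (not_le.1 hlt).le, rfl⟩, h, h.2, rfl⟩
      · exact hzero _ hQ
  refine ⟨⟨f, hsmooth⟩, hequiv, fun x hx => ?_⟩
  have h1 := hval x 1 (by linarith)
  rw [Subgroup.coe_one, mul_one, inv_one, map_one, Units.val_one, mul_one] at h1
  exact h1

end Transversality

/-! ### The leading term of a symmetrized operator -/

section Symbol

variable {E : Type*} [NormedAddCommGroup E] [NormedSpace ℝ E]
  {G : Type*} [TopologicalSpace G] [ChartedSpace E G]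

/-- Multiplication by the smooth function `u`, as an operator on `C^∞(G)`. -/
def mulOp (u : SmoothFun E G) : Module.End ℂ (SmoothFun E G) where
  toFun f := ⟨fun x => u x * f x, (contDiff_fst.mul contDiff_snd : ContDiff ℝ ∞ fun p : ℂ × ℂ => p.1 * p.2).comp_contMDiff
      (u.contMDiff.prodMk_space f.contMDiff)⟩
  map_add' f f' := DFunLike.ext _ _ fun x => mul_add (u x) (f x) (f' x)
  map_smul' c f := DFunLike.ext _ _ fun x => mul_left_comm (u x) c (f x)

theorem mulOp_apply (u f : SmoothFun E G) (x : G) : mulOp u f x = u x * f x := rfl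

theorem mulOp_comm (u u' f : SmoothFun E G) : mulOp u (mulOp u' f) = mulOp u' (mulOp u f) :=
  DFunLike.ext _ _ fun x => mul_left_comm (u x) (u' x) (f x)

variable [Group G] [LieGroup 𝓘(ℝ, E) ∞ G]

theorem invField_mulOp (X : E) (u f : SmoothFun E G) :
    invField G X (mulOp u f) = mulOp u (invField G X f) + mulOp (invField G X u) f := by
  refine DFunLike.ext _ _ fun g => ?_
  have hd : ∀ f : SmoothFun E G, DifferentiableAt ℝ
      (fun b => f (g * (chartAt E (1 : G)).symm b)) (chartAt E (1 : G) 1) := fun f =>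
    (((leftTranslation E g f).contDiffOn (1 : G)).contDiffAt
      ((chartAt E (1 : G)).open_target.mem_nhds (mem_chart_target E 1))).differentiableAt (by simp)
  rw [SmoothFun.add_apply, mulOp_apply, mulOp_apply, invField_apply, invField_apply, invField_apply]
  simp only [mulOp_apply]
  rw [fderiv_fun_mul (hd u) (hd f)]
  simp only [add_apply, smul_apply, smul_eq_mul, (chartAt E (1 : G)).left_inv (mem_chart_source E 1),
    mul_one]
  ring

/-- The Leibniz rule for a power of `u`. -/
theorem invField_mulOp_pow (X : E) (u f : SmoothFun E G) (k : ℕ) :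
    invField G X ((mulOp u ^ (k + 1)) f) =
      (mulOp u ^ k) (((k : ℂ) + 1) • mulOp (invField G X u) f + mulOp u (invField G X f)) := by
  have hcomm : ∀ (n : ℕ) (u' f' : SmoothFun E G),
      mulOp u' ((mulOp u ^ n) f') = (mulOp u ^ n) (mulOp u' f') := by
    intro n u' f'
    induction n with
    | zero => rfl
    | succ n ih => rw [pow_succ', Module.End.mul_apply, Module.End.mul_apply, mulOp_comm, ih]
  induction k generalizing f with
  | zero => simp [invField_mulOp, add_comm]
  | succ k ih =>
    rw [pow_succ', Module.End.mul_apply, invField_mulOp, ih, hcomm]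
    simp only [pow_succ, Module.End.mul_apply, map_add, map_smul]
    rw [hcomm k (invField G X u), mulOp_comm (invField G X u) u f]
    push_cast
    simp only [add_smul, one_smul]
    abel

/-- If `u` vanishes at the identity, a product of `l.length` left invariant fields applied to
`u ^ k * f` vanishes there for `l.length < k`, and for `l.length = k` only the terms in which every
field hits one factor `u` survive. -/
theorem fieldProd_mulOp_pow_apply_one {u : SmoothFun E G} (hu : u 1 = 0) (l : List E) :
    ∀ (k : ℕ) (f : SmoothFun E G),
      (l.length < k → fieldProd G l ((mulOp u ^ k) f) 1 = 0) ∧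
      (l.length = k → fieldProd G l ((mulOp u ^ k) f) 1 =
        (k.factorial : ℂ) * (l.map fun X => invField G X u 1).prod * f 1) := by
  induction l using List.reverseRecOn with
  | nil =>
    intro k f
    refine ⟨fun hk => ?_, fun hk => ?_⟩
    · obtain ⟨k, rfl⟩ := Nat.exists_eq_succ_of_ne_zero hk.ne'
      rw [fieldProd_nil, Module.End.one_apply, pow_succ', Module.End.mul_apply, mulOp_apply, hu,
        zero_mul]
    · subst hk
      simp [fieldProd_nil]
  | append_singleton l X ih =>
    intro k f
    have hlen : (l ++ [X]).length = l.length + 1 := by simp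
    rcases k with _ | k
    · exact ⟨fun hk => absurd hk (by simp), fun hk => absurd hk (by simp)⟩
    rw [hlen, fieldProd_append, fieldProd_cons, fieldProd_nil, mul_one, Module.End.mul_apply,
      invField_mulOp_pow]
    refine ⟨fun hk => (ih k _).1 (by omega), fun hk => ?_⟩
    rw [(ih k _).2 (by omega), SmoothFun.add_apply, SmoothFun.smul_apply, mulOp_apply, mulOp_apply,
      hu, Nat.factorial_succ, List.map_append, List.prod_append]
    push_cast
    simp
    ring

theorem symProd_mulOp_pow_apply_one {u : SmoothFun E G} (hu : u 1 = 0) {n : ℕ} (Y : Fin n → E)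
    (k : ℕ) (f : SmoothFun E G) :
    (n < k → symProd (G := G) (fun j => (Y j : GroupLieAlgebra 𝓘(ℝ, E) G))
        ((mulOp u ^ k) f) 1 = 0) ∧
    (n = k → symProd (G := G) (fun j => (Y j : GroupLieAlgebra 𝓘(ℝ, E) G)) ((mulOp u ^ k) f) 1 =
        (k.factorial : ℂ) * (∏ j, invField G (Y j) u 1) * f 1) := by
  have hev : ∀ (s : Finset (Equiv.Perm (Fin n))) (T : Equiv.Perm (Fin n) → SmoothFun E G),
      (∑ i ∈ s, T i) 1 = ∑ i ∈ s, T i 1 := fun s T =>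
    map_sum (⟨⟨fun f : SmoothFun E G => f 1, rfl⟩, fun _ _ => rfl⟩ : SmoothFun E G →+ ℂ) T s
  have hlen : ∀ σ : Equiv.Perm (Fin n), (List.ofFn (Y ∘ σ)).length = n := fun σ => by simp
  rw [symProd_eq, LinearMap.smul_apply, LinearMap.sum_apply, SmoothFun.smul_apply, hev]
  refine ⟨fun hk => ?_, fun hk => ?_⟩
  · rw [Finset.sum_eq_zero fun σ _ => (fieldProd_mulOp_pow_apply_one hu _ k f).1
      ((hlen σ).trans_lt hk), mul_zero]
  · have hterm : ∀ σ ∈ (Finset.univ : Finset (Equiv.Perm (Fin n))),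
        fieldProd G (List.ofFn (Y ∘ σ)) ((mulOp u ^ k) f) 1 =
          (k.factorial : ℂ) * (∏ j, invField G (Y j) u 1) * f 1 := by
      intro σ _
      rw [(fieldProd_mulOp_pow_apply_one hu _ k f).2 ((hlen σ).trans hk), List.map_ofFn,
        List.prod_ofFn]
      congr 2
      exact Equiv.prod_comp σ fun j => invField G (Y j) u 1
    have hn : (n.factorial : ℂ) ≠ 0 := by exact_mod_cast n.factorial_ne_zero
    rw [Finset.sum_congr rfl hterm, Finset.sum_const, Finset.card_univ, Fintype.card_perm,
      Fintype.card_fin, nsmul_eq_mul, ← mul_assoc, inv_mul_cancel₀ hn, one_mul]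

/-- The symbol of a symmetrized operator: on `u ^ k * f` with `u 1 = 0` and `k` at least the degree
of `P`, the operator `λ(P)` takes at the identity the value of the degree `k` part of `P` at the
differential of `u`, up to the factor `k! * f 1`. -/
theorem symmetrization_mulOp_pow_apply_one {ι : Type*} (b : ι → E) {u : SmoothFun E G}
    (hu : u 1 = 0) (P : MvPolynomial ι ℂ) {k : ℕ} (hk : P.totalDegree ≤ k) (f : SmoothFun E G) :
    symmetrization (G := G) (fun i => (b i : GroupLieAlgebra 𝓘(ℝ, E) G)) P ((mulOp u ^ k) f) 1 =
      (k.factorial : ℂ) * MvPolynomial.eval (fun i => invField G (b i) u 1)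
        (MvPolynomial.homogeneousComponent k P) * f 1 := by
  classical
  have hev : ∀ (s : Finset (ι →₀ ℕ)) (T : (ι →₀ ℕ) → SmoothFun E G),
      (∑ i ∈ s, T i) 1 = ∑ i ∈ s, T i 1 := fun s T =>
    map_sum (⟨⟨fun f : SmoothFun E G => f 1, rfl⟩, fun _ _ => rfl⟩ : SmoothFun E G →+ ℂ) T s
  have hmono : ∀ s : ι →₀ ℕ, MvPolynomial.monomial s (P.coeff s) =
      P.coeff s • MvPolynomial.monomial s (1 : ℂ) := fun s => by
    rw [MvPolynomial.smul_monomial, smul_eq_mul, mul_one]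
  rw [MvPolynomial.homogeneousComponent_apply, map_sum]
  conv_lhs => rw [P.as_sum]
  simp only [hmono, map_sum, map_smul, LinearMap.sum_apply, LinearMap.smul_apply, hev,
    SmoothFun.smul_apply, symmetrization_monomial]
  rw [Finset.sum_filter, Finset.mul_sum, Finset.sum_mul]
  refine Finset.sum_congr rfl fun s hs => ?_
  have hlen : (Finsupp.toMultiset s).toList.length = s.degree := by
    rw [Multiset.length_toList, Finsupp.card_toMultiset]
    rfl
  have hsk : s.degree ≤ k := (MvPolynomial.le_totalDegree hs).trans hk
  have hsym := symProd_mulOp_pow_apply_one hu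
    (fun j => b ((Finsupp.toMultiset s).toList.get j)) k f
  split_ifs with hd
  · rw [hsym.2 (hlen.trans hd), MvPolynomial.smul_eval, MvPolynomial.eval_monomial, one_mul]
    have hprod : ∏ j, invField G (b ((Finsupp.toMultiset s).toList.get j)) u 1 =
        s.prod fun i n => invField G (b i) u 1 ^ n := by
      rw [← List.prod_ofFn]
      have h1 : (List.ofFn fun j => invField G (b ((Finsupp.toMultiset s).toList.get j)) u 1) =
          (Finsupp.toMultiset s).toList.map fun i => invField G (b i) u 1 := by
        conv_rhs => rw [← List.ofFn_get (Finsupp.toMultiset s).toList, List.map_ofFn]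
        rfl
      rw [h1, Multiset.prod_map_toList, Finset.prod_multiset_map_count,
        Finsupp.toFinset_toMultiset]
      simp only [Finsupp.count_toMultiset]
      rfl
    rw [hprod]
    ring
  · rw [hsym.1 (hlen.trans_lt (lt_of_le_of_ne hsk hd))]
    simp

theorem exists_eval_homogeneousComponent_ne_zero {ι : Type*} {P : MvPolynomial ι ℂ} (hP : P ≠ 0) :
    ∃ c : ι → ℂ, MvPolynomial.eval c (MvPolynomial.homogeneousComponent P.totalDegree P) ≠ 0 := by
  by_contra! h
  have h0 : MvPolynomial.homogeneousComponent P.totalDegree P = 0 :=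
    MvPolynomial.funext fun c => by rw [h c, map_zero]
  obtain ⟨s, hs, hsd⟩ := Finset.exists_mem_eq_sup P.support
    (MvPolynomial.support_nonempty.2 hP) fun s => s.sum fun _ e => e
  have h1 := congrArg (MvPolynomial.coeff s) h0
  have hsd' : s.degree = P.totalDegree := hsd.symm
  rw [MvPolynomial.coeff_homogeneousComponent, if_pos hsd', MvPolynomial.coeff_zero] at h1
  exact MvPolynomial.mem_support_iff.1 hs h1

end Symbol

section Injectivity

variable {E : Type*} [NormedAddCommGroup E] [NormedSpace ℝ E] [FiniteDimensional ℝ E]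
  {G : Type*} [TopologicalSpace G] [T2Space G] [ChartedSpace E G] [Group G]
  [LieGroup 𝓘(ℝ, E) ∞ G] {H : Subgroup G} {r d : ℕ}

/-- There are equivariant functions with prescribed value at the identity and prescribed
derivatives in the directions transversal to the Lie algebra of `H`. -/
theorem exists_equivariantFun_jet (hH : IsClosed (H : Set G))
    {e : Module.Basis (Fin r ⊕ Fin d) ℝ E} (he : IsAdaptedBasis H e) (χ : H →ₜ* ℂˣ) (a : ℂ)
    (c : Fin r → ℂ) :
    ∃ f ∈ equivariantFun E χ, f 1 = a ∧ ∀ i, invField G (e (Sum.inl i)) f 1 = c i := by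
  obtain ⟨ρ, hρ, hext⟩ := exists_equivariantFun_extension hH he
  -- an affine function with the required jet, cut off away from the origin
  let B : ContDiffBump (0 : Fin r → ℝ) := ⟨ρ / 2, ρ, by linarith, by linarith⟩
  let ψ : (Fin r → ℝ) → ℂ := fun x => (B x : ℂ) * (a + ∑ i, c i * (x i : ℂ))
  have hψ : ContDiff ℝ ∞ ψ := by
    refine (Complex.ofRealCLM.contDiff.comp B.contDiff).mul (contDiff_const.add ?_)
    exact ContDiff.sum fun i _ => contDiff_const.mul
      (Complex.ofRealCLM.contDiff.comp (contDiff_apply ℝ ℝ i))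
  have hψ0 : ∀ x, ρ ≤ ‖x‖ → ψ x = 0 := fun x hx => by
    have h : B x = 0 := B.zero_of_le_dist (by rwa [dist_zero_right])
    simp [ψ, h]
  obtain ⟨f, hf, hfψ⟩ := hext χ ψ hψ hψ0
  refine ⟨f, hf, ?_, fun i => ?_⟩
  · have h := hfψ 0 (by rwa [norm_zero])
    rw [sliceMap_zero] at h
    rw [h]
    have hB : B 0 = 1 := B.one_of_mem_closedBall (Metric.mem_closedBall_self B.rIn_pos.le)
    simp [ψ, hB]
  · set φ := chartAt E (1 : G) with hφ
    have hd : DifferentiableAt ℝ (f ∘ φ.symm) (φ 1) :=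
      ((f.contDiffOn (1 : G)).contDiffAt
        (φ.open_target.mem_nhds (mem_chart_target E 1))).differentiableAt (by simp)
    have hline : HasDerivAt (fun t : ℝ => φ 1 + t • e (Sum.inl i)) (e (Sum.inl i)) 0 := by
      simpa using ((hasDerivAt_id (0 : ℝ)).smul_const (e (Sum.inl i))).const_add (φ 1)
    have hd' : HasFDerivAt (f ∘ φ.symm) (fderiv ℝ (f ∘ φ.symm) (φ 1))
        (φ 1 + (0 : ℝ) • e (Sum.inl i)) := by
      rw [zero_smul, add_zero]
      exact hd.hasFDerivAt
    have h1 := hd'.comp_hasDerivAt (0 : ℝ) hline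
    have h2 : HasDerivAt ((f ∘ φ.symm) ∘ fun t : ℝ => φ 1 + t • e (Sum.inl i)) (c i) 0 := by
      have h3 : HasDerivAt (fun t : ℝ => a + c i * (t : ℂ)) (c i) 0 := by
        simpa using ((Complex.ofRealCLM.hasDerivAt (x := (0 : ℝ))).const_mul (c i)).const_add a
      refine h3.congr_of_eventuallyEq ?_
      filter_upwards [Metric.ball_mem_nhds (0 : ℝ) (by linarith : 0 < ρ / 2)] with t ht
      rw [Metric.mem_ball, dist_zero_right] at ht
      have hnorm : ‖(Pi.single i t : Fin r → ℝ)‖ = ‖t‖ :=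
        Pi.norm_single (G := fun _ => ℝ) t
      have h4 := hfψ (Pi.single i t) (by rw [hnorm]; linarith)
      rw [sliceMap, Fintype.linearCombination_apply_single] at h4
      have hB : B (Pi.single i t) = 1 := B.one_of_mem_closedBall
        (mem_closedBall_zero_iff.2 (by rw [hnorm]; exact ht.le))
      refine Eq.trans h4 ?_
      simp only [ψ, hB, Complex.ofReal_one, one_mul]
      rw [Finset.sum_eq_single i (fun j _ hj => by simp [hj]) (by simp), Pi.single_eq_same]
    rw [invField_apply_one]
    exact h1.unique h2

/-- A symmetrized operator in the directions transversal to `H` that annihilates all equivariant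
functions is zero. -/
theorem eq_zero_of_symmetrization_apply_eq_zero (hH : IsClosed (H : Set G))
    {e : Module.Basis (Fin r ⊕ Fin d) ℝ E} (he : IsAdaptedBasis H e) (χ : H →ₜ* ℂˣ)
    {P : MvPolynomial (Fin r) ℂ} (hP : ∀ f ∈ equivariantFun E χ,
      symmetrization (G := G) (fun i => (e (Sum.inl i) : GroupLieAlgebra 𝓘(ℝ, E) G)) P f = 0) :
    P = 0 := by
  by_contra hne
  obtain ⟨c, hc⟩ := exists_eval_homogeneousComponent_ne_zero hne
  -- `u` is equivariant for the trivial character, so multiplication by it preserves equivariance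
  obtain ⟨u, hu, hu1, huc⟩ := exists_equivariantFun_jet hH he 1 0 c
  obtain ⟨f, hf, hf1, -⟩ := exists_equivariantFun_jet hH he χ 1 0
  have hmem : ∀ k : ℕ, (mulOp u ^ k) f ∈ equivariantFun E χ := by
    intro k
    induction k with
    | zero => exact hf
    | succ k ih =>
      rw [pow_succ', Module.End.mul_apply]
      refine mem_equivariantFun.2 fun g h => ?_
      have h1 : u (g * h) = u g := (mem_equivariantFun.1 hu g h).trans (mul_one _)
      rw [mulOp_apply, mulOp_apply, h1, mem_equivariantFun.1 ih g h, mul_assoc]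
  have h1 := symmetrization_mulOp_pow_apply_one (fun i => e (Sum.inl i)) hu1 P le_rfl f
  rw [hP _ (hmem _), SmoothFun.zero_apply, hf1, mul_one] at h1
  have hfac : (P.totalDegree.factorial : ℂ) ≠ 0 := by
    exact_mod_cast P.totalDegree.factorial_ne_zero
  simp only [huc] at h1
  exact mul_ne_zero hfac hc h1.symm

end Injectivity

/-! ### The twisted ideal as an annihilator, the invariant operators as a stabilizer -/

section Stabilizer

variable {E : Type*} [NormedAddCommGroup E] [NormedSpace ℝ E]
  {G : Type*} [TopologicalSpace G] [ChartedSpace E G] [Group G] [LieGroup 𝓘(ℝ, E) ∞ G]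

theorem Ad_one (g : G) : Ad g (1 : Module.End ℂ (SmoothFun E G)) = 1 := by
  refine LinearMap.ext fun f => DFunLike.ext _ _ fun x => ?_
  change f (x * g * g⁻¹) = f x
  rw [mul_inv_cancel_right]

theorem Ad_fieldProd_mem [FiniteDimensional ℝ E] (g : G) (l : List E) :
    Ad g (fieldProd G l) ∈ LeftInvDiffOp E G := by
  induction l with
  | nil =>
    rw [fieldProd_nil, Ad_one]
    exact one_mem _
  | cons X l ih =>
    rw [fieldProd_cons, Ad_mul]
    refine mul_mem ?_ ih
    have h := Ad_leftInvField g (X : GroupLieAlgebra 𝓘(ℝ, E) G)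
    exact h ▸ invField_mem _

theorem Ad_mem_leftInvDiffOp [FiniteDimensional ℝ E] (g : G) {D : Module.End ℂ (SmoothFun E G)}
    (hD : D ∈ LeftInvDiffOp E G) : Ad g D ∈ LeftInvDiffOp E G := by
  have h := leftInvDiffOp_le_span hD
  clear hD
  induction h using Submodule.span_induction with
  | mem D h =>
    obtain ⟨l, rfl⟩ := h
    exact Ad_fieldProd_mem g l
  | zero => simp [Ad]
  | add D D' _ _ h h' =>
    rw [Ad, mul_add, add_mul]
    exact add_mem h h'
  | smul c D _ h =>
    rw [Ad, mul_smul_comm, smul_mul_assoc]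
    exact (LeftInvDiffOp E G).smul_mem h c

variable [FiniteDimensional ℝ E] [T2Space G] {H : Subgroup G}

theorem rightTranslation_apply_of_mem {χ : H →ₜ* ℂˣ} {f : SmoothFun E G}
    (hf : f ∈ equivariantFun E χ) (h : H) :
    rightTranslation E (h : G) f = ((χ h⁻¹ : ℂˣ) : ℂ) • f :=
  DFunLike.ext _ _ fun g => (mem_equivariantFun.1 hf g h).trans (mul_comm _ _)

theorem Ad_apply_of_mem {χ : H →ₜ* ℂˣ} {f : SmoothFun E G} (hf : f ∈ equivariantFun E χ)
    (D : Module.End ℂ (SmoothFun E G)) (h : H) :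
    Ad (h : G) D f = ((χ h : ℂˣ) : ℂ) • rightTranslation E (h : G) (D f) := by
  have h1 := rightTranslation_apply_of_mem hf h⁻¹
  rw [inv_inv] at h1
  change rightTranslation E (h : G) (D (rightTranslation E ((h⁻¹ : H) : G) f)) = _
  rw [h1, map_smul, map_smul]

variable {r d : ℕ}

theorem IsAdaptedBasis.span_eq_top {e : Module.Basis (Fin r ⊕ Fin d) ℝ E}
    (he : IsAdaptedBasis H e) :
    Submodule.span ℝ (Set.range (fun i => e (Sum.inl i)) ∪ lieVec E H) = ⊤ := by
  rw [eq_top_iff, ← e.span_eq]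
  refine Submodule.span_mono ?_
  rintro _ ⟨i | j, rfl⟩
  · exact Or.inl ⟨i, rfl⟩
  · exact Or.inr (he.inr_mem j)

theorem twistedIdeal_le_leftInvDiffOp (χ : H →ₜ* ℂˣ) :
    twistedIdeal χ ≤ Subalgebra.toSubmodule (LeftInvDiffOp E G) := by
  refine Submodule.span_le.2 ?_
  rintro _ ⟨v, hv, w, hw, rfl⟩
  obtain ⟨X, -, Y, -, rfl⟩ := mem_twistedLieAlg_iff.1 hw
  have hX : ∀ X : E, invField G X + algebraMap ℂ (Module.End ℂ (SmoothFun E G)) (charDiff E χ X) ∈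
      LeftInvDiffOp E G := fun X => add_mem (invField_mem X) ((LeftInvDiffOp E G).algebraMap_mem _)
  exact (LeftInvDiffOp E G).mul_mem hv (add_mem (hX X) ((LeftInvDiffOp E G).smul_mem (hX Y) _))

/-- Modulo `𝔻(G)𝔥^χ` every left invariant differential operator is symmetrized from directions
transversal to the Lie algebra of `H`. -/
theorem leftInvDiffOp_le_sup {e : Module.Basis (Fin r ⊕ Fin d) ℝ E} (he : IsAdaptedBasis H e)
    (χ : H →ₜ* ℂˣ) :
    Subalgebra.toSubmodule (LeftInvDiffOp E G) ≤ twistedIdeal χ ⊔ LinearMap.range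
      (symmetrization (G := G) fun i => (e (Sum.inl i) : GroupLieAlgebra 𝓘(ℝ, E) G)) := by
  refine leftInvDiffOp_le_span.trans (Submodule.span_le.2 ?_)
  rintro _ ⟨l, rfl⟩
  exact fieldFiltration_le_sup _ he.span_eq_top (charDiff E χ)
    (fun l X hX => mul_invField_add_mem_twistedIdeal (fieldProd_mem l) hX) l.length
    (fieldProd_mem_filtration le_rfl)

/-- `𝔻(G)𝔥^χ` is the annihilator of `C^∞_{H,χ}(G)` in `𝔻(G)`. -/
theorem mem_twistedIdeal_iff (hH : IsClosed (H : Set G)) {e : Module.Basis (Fin r ⊕ Fin d) ℝ E}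
    (he : IsAdaptedBasis H e) {χ : H →ₜ* ℂˣ} {D : Module.End ℂ (SmoothFun E G)} :
    D ∈ twistedIdeal χ ↔ D ∈ LeftInvDiffOp E G ∧ ∀ f ∈ equivariantFun E χ, D f = 0 := by
  refine ⟨fun hD => ⟨twistedIdeal_le_leftInvDiffOp χ hD, fun f hf => twistedIdeal_apply hD hf⟩, ?_⟩
  rintro ⟨hD, hD0⟩
  obtain ⟨v, hv, _, ⟨P, rfl⟩, rfl⟩ := Submodule.mem_sup.1 (leftInvDiffOp_le_sup he χ hD)
  have hP : P = 0 := eq_zero_of_symmetrization_apply_eq_zero hH he χ fun f hf => by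
    have h := hD0 f hf
    rwa [LinearMap.add_apply, twistedIdeal_apply hv hf, zero_add] at h
  rwa [hP, map_zero, add_zero]

/-- `𝔻_{H,χ,mod}(G)` is the stabilizer of `C^∞_{H,χ}(G)` in `𝔻(G)`. -/
theorem mem_modInvDiffOp_iff (hH : IsClosed (H : Set G)) {e : Module.Basis (Fin r ⊕ Fin d) ℝ E}
    (he : IsAdaptedBasis H e) {χ : H →ₜ* ℂˣ} {D : Module.End ℂ (SmoothFun E G)} :
    D ∈ modInvDiffOp χ ↔
      D ∈ LeftInvDiffOp E G ∧ ∀ f ∈ equivariantFun E χ, D f ∈ equivariantFun E χ := by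
  refine and_congr_right fun hD => ⟨fun hAd f hf => ?_, fun hst h hh => ?_⟩
  · refine mem_equivariantFun.2 fun g h => ?_
    have h1 := twistedIdeal_apply (hAd h h.2) hf
    rw [LinearMap.sub_apply, sub_eq_zero, Ad_apply_of_mem hf] at h1
    have h2 : ((χ h : ℂˣ) : ℂ) * D f (g * h) = D f g := congrArg (fun u : SmoothFun E G => u g) h1
    rw [← h2, mul_right_comm, map_inv, Units.mul_inv, one_mul]
  · refine (mem_twistedIdeal_iff hH he).2
      ⟨sub_mem (Ad_mem_leftInvDiffOp h hD) hD, fun f hf => ?_⟩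
    have h1 := Ad_apply_of_mem hf D ⟨h, hh⟩
    rw [rightTranslation_apply_of_mem (hst f hf), smul_smul, map_inv, Units.mul_inv, one_smul] at h1
    rw [LinearMap.sub_apply, sub_eq_zero]
    exact h1

variable (E) in
/-- The algebra of left invariant differential operators that map `C^∞_{H,χ}(G)` into itself. -/
def stabilizer (χ : H →ₜ* ℂˣ) : Subalgebra ℂ (Module.End ℂ (SmoothFun E G)) where
  carrier := {D | D ∈ LeftInvDiffOp E G ∧ ∀ f ∈ equivariantFun E χ, D f ∈ equivariantFun E χ}
  mul_mem' := fun hD hD' => ⟨mul_mem hD.1 hD'.1, fun f hf => hD.2 _ (hD'.2 f hf)⟩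
  add_mem' := fun hD hD' => ⟨add_mem hD.1 hD'.1, fun f hf => add_mem (hD.2 f hf) (hD'.2 f hf)⟩
  algebraMap_mem' := fun c =>
    ⟨(LeftInvDiffOp E G).algebraMap_mem c, fun _ hf => Submodule.smul_mem _ c hf⟩

/-- Restriction of operators to `C^∞_{H,χ}(G)`. -/
def restrictionHom (χ : H →ₜ* ℂˣ) :
    stabilizer E χ →ₐ[ℂ] Module.End ℂ (equivariantFun E χ) where
  toFun D := (D : Module.End ℂ (SmoothFun E G)).restrict D.2.2
  map_one' := rfl
  map_mul' _ _ := rfl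
  map_zero' := rfl
  map_add' _ _ := rfl
  commutes' _ := rfl

theorem restrictionHom_eq_zero_iff (hH : IsClosed (H : Set G))
    {e : Module.Basis (Fin r ⊕ Fin d) ℝ E} (he : IsAdaptedBasis H e) {χ : H →ₜ* ℂˣ}
    {D : stabilizer E χ} :
    restrictionHom χ D = 0 ↔ (D : Module.End ℂ (SmoothFun E G)) ∈ twistedIdeal χ := by
  rw [mem_twistedIdeal_iff hH he]
  refine ⟨fun h => ⟨D.2.1, fun f hf => ?_⟩, fun h => LinearMap.ext fun f => Subtype.ext ?_⟩
  · exact congrArg Subtype.val (LinearMap.congr_fun h ⟨f, hf⟩)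
  · exact h.2 f f.2

end Stabilizer

/-! ### Bases adapted to a complement of the Lie algebra of the subgroup -/

theorem exists_basis_sum_of_isCompl {K V : Type*} [Field K] [AddCommGroup V] [Module K V]
    [FiniteDimensional K V] {Λ : Set V} {m : Submodule K V} (hm : IsCompl m (Submodule.span K Λ))
    {ι : Type*} (b : Module.Basis ι K m) :
    ∃ (d : ℕ) (e : Module.Basis (ι ⊕ Fin d) K V), (∀ i, e (Sum.inl i) = b i) ∧
      (∀ j, e (Sum.inr j) ∈ Λ) ∧ ∀ X ∈ Λ, ∀ i, e.repr X (Sum.inl i) = 0 := by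
  obtain ⟨s, hsΛ, hspan, hli⟩ := exists_linearIndependent K Λ
  let B := (Module.Basis.span hli).map
    (LinearEquiv.ofEq _ (Submodule.span K Λ) (by rw [Subtype.range_coe, hspan]))
  have : Finite s := Module.Finite.finite_basis B
  have : Fintype s := Fintype.ofFinite s
  let B' := B.reindex (Fintype.equivFin s)
  have hB' : ∀ j, (B' j : V) ∈ Λ := fun j => by
    have h : (B' j : V) = ((Fintype.equivFin s).symm j : V) := by
      simp [B', B, Module.Basis.span_apply]
    rw [h]
    exact hsΛ (Subtype.mem _)
  refine ⟨_, (b.prod B').map (Submodule.prodEquivOfIsCompl m _ hm), fun i => ?_, fun j => ?_,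
    fun X hX i => ?_⟩
  · simp
  · simpa using hB' j
  · have h := Submodule.prodEquivOfIsCompl_symm_apply_right m _ hm
      ⟨X, Submodule.subset_span hX⟩
    rw [Module.Basis.map_repr, LinearEquiv.trans_apply, h]
    simp

end InvDiffOp

end

theorem theorem2p6
    {E : Type*} [NormedAddCommGroup E] [NormedSpace ℝ E] [FiniteDimensional ℝ E]
    {G : Type*} [TopologicalSpace G] [T2Space G] [ChartedSpace E G] [Group G]
    [LieGroup 𝓘(ℝ, E) ∞ G]
    (H : Subgroup G) (hH : IsClosed (H : Set G)) (χ : H →ₜ* ℂˣ)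
    (m : Submodule ℝ (GroupLieAlgebra 𝓘(ℝ, E) G))
    (hm : IsCompl m (Submodule.span ℝ (InvDiffOp.lieAlg (E := E) H)))
    {r : ℕ} (b : Module.Basis (Fin r) ℝ m) :
    -- the subalgebra property
    ∃ S : Subalgebra ℂ (Module.End ℂ (InvDiffOp.SmoothFun E G)),
      (S : Set (Module.End ℂ (InvDiffOp.SmoothFun E G))) = InvDiffOp.modInvDiffOp χ ∧
      S ≤ InvDiffOp.LeftInvDiffOp E G ∧
      -- the two-sided ideal
      InvDiffOp.twistedIdeal χ ≤ S.toSubmodule ∧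
      ∃ (J : Ideal S) (_ : J.IsTwoSided),
        (∀ D : S, D ∈ J ↔ (D : Module.End ℂ (InvDiffOp.SmoothFun E G)) ∈
          InvDiffOp.twistedIdeal χ) ∧
        -- the direct sum decomposition
        Disjoint (InvDiffOp.twistedIdeal χ) (InvDiffOp.symmetrizedSubspace b ⊓ S.toSubmodule) ∧
        InvDiffOp.twistedIdeal χ ⊔ (InvDiffOp.symmetrizedSubspace b ⊓ S.toSubmodule) = S.toSubmodule ∧
        -- the map `A` is a linear bijection
        Function.Bijective ((Ideal.Quotient.mkₐ ℂ J).toLinearMap ∘ₗ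
          ((InvDiffOp.symmetrizedSubspace b).comap S.val.toLinearMap).subtype) ∧
        -- restriction to equivariant functions, and the algebra isomorphism `B` induced by it
        ∃ ρ : S →ₐ[ℂ] Module.End ℂ (InvDiffOp.equivariantFun E χ),
          (∀ (D : S) (f : InvDiffOp.equivariantFun E χ),
            ((ρ D f : InvDiffOp.equivariantFun E χ) : InvDiffOp.SmoothFun E G) =
              (D : Module.End ℂ (InvDiffOp.SmoothFun E G)) f) ∧
          ∃ B : (S ⧸ J) ≃ₐ[ℂ] ρ.range,
            ∀ D : S, ((B (Ideal.Quotient.mk J D) : ρ.range) :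
              Module.End ℂ (InvDiffOp.equivariantFun E χ)) = ρ D := by
  -- the Lie algebra is the model space `E` by definition, and the basis is transported to `E`
  have hfin : FiniteDimensional ℝ (GroupLieAlgebra 𝓘(ℝ, E) G) := ‹FiniteDimensional ℝ E›
  obtain ⟨d, e', hinl, hinr, hrepr⟩ := InvDiffOp.exists_basis_sum_of_isCompl hm b
  let e : Module.Basis (Fin r ⊕ Fin d) ℝ E := e'
  have he : InvDiffOp.IsAdaptedBasis H e := ⟨hinr, hrepr⟩
  have hsym : InvDiffOp.symmetrizedSubspace b = LinearMap.range (InvDiffOp.symmetrization (G := G)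
      fun i => (e (Sum.inl i) : GroupLieAlgebra 𝓘(ℝ, E) G)) := by
    have h : (fun i => (e (Sum.inl i) : GroupLieAlgebra 𝓘(ℝ, E) G)) = fun i => (b i).1 :=
      funext hinl
    rw [h]
    rfl
  have hle : InvDiffOp.twistedIdeal χ ≤ (InvDiffOp.stabilizer E χ).toSubmodule := fun D hD =>
    ⟨InvDiffOp.twistedIdeal_le_leftInvDiffOp χ hD, fun f hf => by
      rw [InvDiffOp.twistedIdeal_apply hD hf]
      exact zero_mem _⟩
  have hmem : ∀ D : InvDiffOp.stabilizer E χ, D ∈ RingHom.ker (InvDiffOp.restrictionHom χ) ↔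
      (D : Module.End ℂ (InvDiffOp.SmoothFun E G)) ∈ InvDiffOp.twistedIdeal χ := fun D =>
    InvDiffOp.restrictionHom_eq_zero_iff hH he
  have hdisj : Disjoint (InvDiffOp.twistedIdeal χ) (InvDiffOp.symmetrizedSubspace b) := by
    rw [hsym, Submodule.disjoint_def]
    rintro _ hD ⟨P, rfl⟩
    rw [InvDiffOp.eq_zero_of_symmetrization_apply_eq_zero hH he χ
      fun f hf => InvDiffOp.twistedIdeal_apply hD hf, map_zero]
  have hsup : InvDiffOp.twistedIdeal χ ⊔ (InvDiffOp.symmetrizedSubspace b ⊓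
      (InvDiffOp.stabilizer E χ).toSubmodule) = (InvDiffOp.stabilizer E χ).toSubmodule := by
    -- the modular law, the twisted ideal being contained in the stabilizer
    rw [← sup_inf_assoc_of_le _ hle, inf_eq_right, hsym]
    exact fun D hD => InvDiffOp.leftInvDiffOp_le_sup he χ hD.1
  refine ⟨InvDiffOp.stabilizer E χ,
    Set.ext fun D => (InvDiffOp.mem_modInvDiffOp_iff hH he).symm, fun D hD => hD.1, hle,
    RingHom.ker (InvDiffOp.restrictionHom χ), inferInstance, hmem,
    hdisj.mono_right inf_le_left, hsup, ⟨?_, ?_⟩,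
    InvDiffOp.restrictionHom χ, fun _ _ => rfl,
    Ideal.quotientKerEquivRange (InvDiffOp.restrictionHom χ), fun _ => rfl⟩
  · refine (injective_iff_map_eq_zero _).2 fun D hD => ?_
    have h := (hmem _).1 (Ideal.Quotient.eq_zero_iff_mem.1 hD)
    exact Subtype.ext (Subtype.ext (Submodule.disjoint_def.1 hdisj _ h D.2))
  · intro q
    obtain ⟨D, rfl⟩ := Ideal.Quotient.mk_surjective q
    obtain ⟨v, hv, w, hw, hvw⟩ := Submodule.mem_sup.1 (hsup.ge D.2)
    refine ⟨⟨⟨w, hw.2⟩, hw.1⟩, Ideal.Quotient.eq.2 ((hmem _).2 ?_)⟩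
    change w - (D : Module.End ℂ (InvDiffOp.SmoothFun E G)) ∈ _
    rw [← hvw, sub_add_cancel_right]
    exact neg_mem hv
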